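/- **Setting.** Let $\Bbbk$ be a field, $H$ a Hopf algebra over $\Bbbk$ with bijective antipode, and ${}^H_H\mathcal{YD}$ the category of (left-left) Yetter-Drinfeld modules over $H$; write $\delta(x)=x_{(-1)}\otimes x_{(0)}$ for $H$-coactions. For $W\in{}^H_H\mathcal{YD}$ let $\mathcal B(W)=\bigoplus_{n\ge 0}\mathcal B^n(W)$ be its Nichols algebra, that is, the quotient of the braided Hopf algebra $T(W)$ (in which the elements of $W$ are primitive) by the largest Hopf ideal in ${}^H_H\mathcal{YD}$ generated by homogeneous elements of degree $\ge 2$. Let $V, W\in{}^H_H\mathcal{YD}$, let $\iota:V\to W$ and $\pi:W\to V$ be morphisms in ${}^H_H\mathcal{YD}$ with $\pi\iota=\mathrm{id}_V$, and let $\widetilde V=\ker\pi$, so that $W\cong V\oplus\widetilde V$. Let $\pi_{\mathcal B(V)}:\mathcal B(W)\to\mathcal B(V)$ be the induced map. Identify $V$ with $\iota(V)\subset \mathcal B^1(W)=W$. For $x\in V$, $b\in\mathcal B(W)$ put $\operatorname{ad}_c x(b)=xb-(x_{(-1)}\cdot b)\,x_{(0)}$. For a Yetter-Drinfeld submodule $U$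 of $\widetilde V$ let $$L=\operatorname{ad}\mathcal B(V)(U)\subset\mathcal B(W)$$ be the linear span of the elements $\operatorname{ad}_c x_1(\cdots(\operatorname{ad}_c x_m(y)))$ with $m\ge 0$, $x_1,\dots,x_m\in V$, $y\in U$, and let $L^m=L\cap\mathcal B^m(W)$. With $\Delta$ the comultiplication of $\mathcal B(W)$, the map $(\pi_{\mathcal B(V)}\otimes\mathrm{id})\Delta$ restricts to a left $\mathcal B(V)$-comodule structure on $L$. Condition (F) on $U$ says that there is $M\in\mathbb N$ with $L^M\ne 0$ and $L^p=0$ for all $p>M$; in this case put $L^{\max}=L^M$. **Theorem 3.5.** Suppose that $U$ is irreducible in ${}^H_H\mathcal{YD}$ and satisfies Condition (F). Then $L^{\max}$ is irreducible in ${}^H_H\mathcal{YD}$, and $L$ is generated by $L^{\max}$ as a $\mathcal B(V)$-comodule, that is, $L$ is the smallest $\mathcal B(V)$-subcomodule of $L$ containing $L^{\max}$. -/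

import Mathlib

open scoped TensorProduct

noncomputable section

universe u₁ u₂ u₃ u₄

section Basic

variable {k : Type u₁} [Field k] {H : Type u₂} [Ring H] [HopfAlgebra k H]

/-- For a bilinear action `act` of `H` on `M`, the map
`(a ⊗ b ⊗ c) ↦ (g ⊗ m ↦ a g S(c) ⊗ b · m)`, see `ydTwist_tmul`. -/
def ydTwist {M : Type*} [AddCommGroup M] [Module k M] (act : H →ₗ[k] M →ₗ[k] M) :
    H ⊗[k] (H ⊗[k] H) →ₗ[k] H ⊗[k] M →ₗ[k] H ⊗[k] M :=
  TensorProduct.map₂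
      (TensorProduct.lift
        ((LinearMap.llcomp k H H H).compl₁₂ (LinearMap.mul k H)
          ((LinearMap.mul k H).flip ∘ₗ HopfAlgebra.antipode k))) act ∘ₗ
    (TensorProduct.assoc k H H H).symm.toLinearMap ∘ₗ
    LinearMap.lTensor H (TensorProduct.comm k H H).toLinearMap

theorem ydTwist_tmul {M : Type*} [AddCommGroup M] [Module k M] (act : H →ₗ[k] M →ₗ[k] M)
    (a b c g : H) (m : M) :
    ydTwist act (a ⊗ₜ (b ⊗ₜ c)) (g ⊗ₜ m) =
      (a * (g * HopfAlgebra.antipode k c)) ⊗ₜ[k] act b m := by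
  simp [ydTwist]

variable (k H) in
/-- The structure of a (left-left) Yetter-Drinfeld module over the Hopf algebra `H` on a
`k`-vector space `W`: an `H`-module structure `act`, an `H`-comodule structure `coact`, and
the compatibility `δ(h · x) = h₁ x₋₁ S(h₃) ⊗ h₂ · x₀`. -/
structure YetterDrinfeld (W : Type u₃) [AddCommGroup W] [Module k W] where
  act : H →ₐ[k] Module.End k W
  coact : W →ₗ[k] H ⊗[k] W
  counit_coact : ∀ x, TensorProduct.lid k W (LinearMap.rTensor W Coalgebra.counit (coact x)) = x
  coassoc_coact : ∀ x,
    TensorProduct.assoc k H H W (LinearMap.rTensor W Coalgebra.comul (coact x)) =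
      LinearMap.lTensor H coact (coact x)
  coact_act : ∀ (h : H) (x : W),
    coact (act h x) =
      ydTwist act.toLinearMap (LinearMap.lTensor H Coalgebra.comul (Coalgebra.comul h)) (coact x)

/-- `N` is stable under the action and the coaction of `H` (the latter meaning
`δ(N) ⊆ H ⊗ N`): for a Yetter-Drinfeld module `M`, a Yetter-Drinfeld submodule. -/
structure IsYDSubmodule {M : Type*} [AddCommGroup M] [Module k M]
    (act : H →ₗ[k] M →ₗ[k] M) (coact : M →ₗ[k] H ⊗[k] M) (N : Submodule k M) : Prop where
  act_mem : ∀ (h : H), ∀ x ∈ N, act h x ∈ N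
  coact_mem : ∀ x ∈ N, coact x ∈ LinearMap.range (LinearMap.lTensor H N.subtype)

/-- `N` is a Yetter-Drinfeld submodule which is irreducible as a Yetter-Drinfeld module: it is
nonzero, and its only Yetter-Drinfeld submodules are `0` and `N`. -/
structure IsIrreducibleYDSubmodule {M : Type*} [AddCommGroup M] [Module k M]
    (act : H →ₗ[k] M →ₗ[k] M) (coact : M →ₗ[k] H ⊗[k] M) (N : Submodule k M) : Prop where
  isYDSubmodule : IsYDSubmodule act coact N
  ne_bot : N ≠ ⊥
  eq_bot_or_eq : ∀ N' ≤ N, IsYDSubmodule act coact N' → N' = ⊥ ∨ N' = N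

/-- For a left coaction `δ : M → C ⊗ M` of a coalgebra `C`, the subspace `N` is a
subcomodule: `δ(N) ⊆ C ⊗ N`. -/
def IsSubcomodule {C M : Type*} [AddCommGroup C] [Module k C] [AddCommGroup M] [Module k M]
    (δ : M →ₗ[k] C ⊗[k] M) (N : Submodule k M) : Prop :=
  ∀ x ∈ N, δ x ∈ LinearMap.range (LinearMap.lTensor C N.subtype)

end Basic

namespace YetterDrinfeld

variable {k : Type u₁} [Field k] {H : Type u₂} [Ring H] [HopfAlgebra k H]
variable {W : Type u₃} [AddCommGroup W] [Module k W] (Y : YetterDrinfeld k H W)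
variable {V : Type u₄} [AddCommGroup V] [Module k V] (Z : YetterDrinfeld k H V)

/-! ### The braided Hopf algebra `T(W)` -/

/-- The algebra map from `T(W)` to the convolution algebra `Hom(H, T(W))` which sends
`w ∈ W` to `h ↦ h · w`. -/
def tensorActHom : TensorAlgebra k W →ₐ[k] WithConv (H →ₗ[k] TensorAlgebra k W) :=
  TensorAlgebra.lift k
    ((WithConv.linearEquiv k (H →ₗ[k] TensorAlgebra k W)).symm.toLinearMap ∘ₗ
      (Y.act.toLinearMap.compr₂ (TensorAlgebra.ι k)).flip)

/-- The action of `H` on `T(W)`. It extends the action on `W` and satisfies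
`h · 1 = ε(h) 1` and `h · (xy) = (h₁ · x)(h₂ · y)`. -/
def tensorAct : H →ₗ[k] TensorAlgebra k W →ₗ[k] TensorAlgebra k W :=
  ((WithConv.linearEquiv k (H →ₗ[k] TensorAlgebra k W)).toLinearMap ∘ₗ
    Y.tensorActHom.toLinearMap).flip

/-- The coaction of `H` on `T(W)`: the algebra map extending the coaction on `W`. -/
def tensorCoact : TensorAlgebra k W →ₐ[k] H ⊗[k] TensorAlgebra k W :=
  TensorAlgebra.lift k (LinearMap.lTensor H (TensorAlgebra.ι k) ∘ₗ Y.coact)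

/-- The map sending `h ⊗ w` (with `w ∈ W`) to the operator
`a ⊗ b ↦ (h · a) ⊗ w b` on `T(W) ⊗ T(W)`. -/
def braidedMulRight :
    H ⊗[k] W →ₗ[k] Module.End k (TensorAlgebra k W ⊗[k] TensorAlgebra k W) :=
  TensorProduct.homTensorHomMap (RingHom.id k) _ _ _ _ ∘ₗ
    TensorProduct.map Y.tensorAct (LinearMap.mul k (TensorAlgebra k W) ∘ₗ TensorAlgebra.ι k)

/-- The algebra map from `T(W)` to `End (T(W) ⊗ T(W))` sending `w ∈ W` to left multiplication
by `w ⊗ 1 + 1 ⊗ w` in the braided tensor product algebra: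
`a ⊗ b ↦ w a ⊗ b + (w₋₁ · a) ⊗ w₀ b`. -/
def comulOp :
    TensorAlgebra k W →ₐ[k] Module.End k (TensorAlgebra k W ⊗[k] TensorAlgebra k W) :=
  TensorAlgebra.lift k
    (LinearMap.rTensorHom (TensorAlgebra k W) ∘ₗ
        (LinearMap.mul k (TensorAlgebra k W) ∘ₗ TensorAlgebra.ι k) +
      Y.braidedMulRight ∘ₗ Y.coact)

/-- The comultiplication of the braided Hopf algebra `T(W)`: the algebra map from `T(W)` to the
braided tensor product algebra of `T(W)` with itself with `w ↦ w ⊗ 1 + 1 ⊗ w` for `w ∈ W`. -/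
def tensorComul : TensorAlgebra k W →ₗ[k] TensorAlgebra k W ⊗[k] TensorAlgebra k W :=
  Y.comulOp.toLinearMap.flip (1 ⊗ₜ 1)

/-! ### The Nichols algebra -/

/-- A Hopf ideal of `T(W)` in the category of Yetter-Drinfeld modules which is generated by
homogeneous elements of degree at least two, that is, which is the sum of its homogeneous
components and has none in degrees `0` and `1`. -/
structure IsNicholsHopfIdeal (I : Submodule k (TensorAlgebra k W)) : Prop where
  mul_mem_left : ∀ a, ∀ x ∈ I, a * x ∈ I
  mul_mem_right : ∀ a, ∀ x ∈ I, x * a ∈ I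
  homogeneous : I ≤ ⨆ n : ℕ, I ⊓ LinearMap.range (TensorAlgebra.ι k : W →ₗ[k] _) ^ (n + 2)
  isYDSubmodule : IsYDSubmodule Y.tensorAct Y.tensorCoact.toLinearMap I
  comul_mem : ∀ x ∈ I, Y.tensorComul x ∈
    LinearMap.range (LinearMap.rTensor (TensorAlgebra k W) I.subtype) ⊔
      LinearMap.range (LinearMap.lTensor (TensorAlgebra k W) I.subtype)

/-- The sum of all Hopf ideals of `T(W)` as in `IsNicholsHopfIdeal`, as a subspace. -/
def nicholsSubspace : Submodule k (TensorAlgebra k W) := sSup {I | Y.IsNicholsHopfIdeal I}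

section IdealFacts

variable {k' : Type*} [Field k'] {A B M : Type*} [AddCommGroup A] [Module k' A]
  [AddCommGroup B] [Module k' B] [AddCommGroup M] [Module k' M]

theorem range_lTensor_mono {I J : Submodule k' M} (h : I ≤ J) :
    LinearMap.range (LinearMap.lTensor A I.subtype) ≤
      LinearMap.range (LinearMap.lTensor A J.subtype) := by
  rw [← Submodule.subtype_comp_inclusion I J h, LinearMap.lTensor_comp]
  exact LinearMap.range_comp_le_range _ _

theorem range_rTensor_mono {I J : Submodule k' M} (h : I ≤ J) :
    LinearMap.range (LinearMap.rTensor A I.subtype) ≤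
      LinearMap.range (LinearMap.rTensor A J.subtype) := by
  rw [← Submodule.subtype_comp_inclusion I J h, LinearMap.rTensor_comp]
  exact LinearMap.range_comp_le_range _ _

end IdealFacts

theorem le_nicholsSubspace {I : Submodule k (TensorAlgebra k W)} (hI : Y.IsNicholsHopfIdeal I) :
    I ≤ Y.nicholsSubspace := le_sSup hI

theorem map_mem_of_mem_nicholsSubspace {P : Type*} [AddCommGroup P] [Module k P]
    (f : TensorAlgebra k W →ₗ[k] P) (Q : Submodule k P)
    (h : ∀ I, Y.IsNicholsHopfIdeal I → ∀ x ∈ I, f x ∈ Q) : ∀ x ∈ Y.nicholsSubspace, f x ∈ Q :=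
  have : Y.nicholsSubspace ≤ Q.comap f := sSup_le fun I hI x hx => h I hI x hx
  this

theorem isNicholsHopfIdeal_nicholsSubspace : Y.IsNicholsHopfIdeal Y.nicholsSubspace := by
  refine ⟨fun a => ?_, fun a => ?_, ?_, ⟨fun h => ?_, ?_⟩, ?_⟩
  · exact Y.map_mem_of_mem_nicholsSubspace (LinearMap.mulLeft k a) _ fun I hI x hx =>
      Y.le_nicholsSubspace hI (hI.mul_mem_left a x hx)
  · exact Y.map_mem_of_mem_nicholsSubspace (LinearMap.mulRight k a) _ fun I hI x hx =>
      Y.le_nicholsSubspace hI (hI.mul_mem_right a x hx)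
  · refine sSup_le fun I hI => hI.homogeneous.trans (iSup_mono fun n => ?_)
    exact inf_le_inf_right _ (Y.le_nicholsSubspace hI)
  · exact Y.map_mem_of_mem_nicholsSubspace (Y.tensorAct h) _ fun I hI x hx =>
      Y.le_nicholsSubspace hI (hI.isYDSubmodule.act_mem h x hx)
  · exact Y.map_mem_of_mem_nicholsSubspace Y.tensorCoact.toLinearMap _ fun I hI x hx =>
      range_lTensor_mono (Y.le_nicholsSubspace hI) (hI.isYDSubmodule.coact_mem x hx)
  · exact Y.map_mem_of_mem_nicholsSubspace Y.tensorComul _ fun I hI x hx =>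
      sup_le_sup (range_rTensor_mono (Y.le_nicholsSubspace hI))
        (range_lTensor_mono (Y.le_nicholsSubspace hI)) (hI.comul_mem x hx)

/-- The defining ideal of the Nichols algebra: the largest Hopf ideal of `T(W)` in the category
of Yetter-Drinfeld modules generated by homogeneous elements of degree at least two. -/
def nicholsIdeal : Ideal (TensorAlgebra k W) where
  __ := Y.nicholsSubspace
  smul_mem' := Y.isNicholsHopfIdeal_nicholsSubspace.mul_mem_left

instance : Y.nicholsIdeal.IsTwoSided :=
  ⟨fun b h => Y.isNicholsHopfIdeal_nicholsSubspace.mul_mem_right b _ h⟩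

theorem mem_nicholsIdeal {x : TensorAlgebra k W} : x ∈ Y.nicholsIdeal ↔ x ∈ Y.nicholsSubspace :=
  Iff.rfl

/-- The Nichols algebra `B(W)`. -/
abbrev NicholsAlgebra : Type (max u₁ u₃) := TensorAlgebra k W ⧸ Y.nicholsIdeal

/-- The projection of `T(W)` onto `B(W)`. -/
abbrev nicholsMk : TensorAlgebra k W →ₐ[k] Y.NicholsAlgebra := Ideal.Quotient.mkₐ k Y.nicholsIdeal

theorem nicholsMk_eq_zero {x : TensorAlgebra k W} (hx : x ∈ Y.nicholsSubspace) :
    Y.nicholsMk x = 0 := Ideal.Quotient.eq_zero_iff_mem.2 hx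

/-- The inclusion of `W` in `B(W)`. -/
def nicholsIncl : W →ₗ[k] Y.NicholsAlgebra := Y.nicholsMk.toLinearMap ∘ₗ TensorAlgebra.ι k

/-- The homogeneous component of degree `n` of `B(W)`. -/
def nicholsDeg (n : ℕ) : Submodule k Y.NicholsAlgebra := LinearMap.range Y.nicholsIncl ^ n

/-- The linear map on `B(W)` induced by a linear map on `T(W)`. -/
def nicholsLift {P : Type*} [AddCommGroup P] [Module k P] (f : TensorAlgebra k W →ₗ[k] P)
    (hf : ∀ x ∈ Y.nicholsSubspace, f x = 0) : Y.NicholsAlgebra →ₗ[k] P :=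
  (Y.nicholsIdeal.restrictScalars k).liftQ f hf ∘ₗ
    (Submodule.Quotient.restrictScalarsEquiv k Y.nicholsIdeal).symm.toLinearMap

@[simp]
theorem nicholsLift_mk {P : Type*} [AddCommGroup P] [Module k P] (f : TensorAlgebra k W →ₗ[k] P)
    (hf : ∀ x ∈ Y.nicholsSubspace, f x = 0) (x : TensorAlgebra k W) :
    Y.nicholsLift f hf (Y.nicholsMk x) = f x := rfl

theorem lTensor_nicholsMk_eq_zero {A : Type*} [AddCommGroup A] [Module k A]
    {t : A ⊗[k] TensorAlgebra k W}
    (ht : t ∈ LinearMap.range (LinearMap.lTensor A Y.nicholsSubspace.subtype)) :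
    LinearMap.lTensor A Y.nicholsMk.toLinearMap t = 0 := by
  obtain ⟨s, rfl⟩ := ht
  rw [← LinearMap.comp_apply, ← LinearMap.lTensor_comp]
  have : Y.nicholsMk.toLinearMap ∘ₗ Y.nicholsSubspace.subtype = 0 :=
    LinearMap.ext fun x => Y.nicholsMk_eq_zero x.2
  rw [this, LinearMap.lTensor_zero, LinearMap.zero_apply]

theorem rTensor_nicholsMk_eq_zero {A : Type*} [AddCommGroup A] [Module k A]
    {t : TensorAlgebra k W ⊗[k] A}
    (ht : t ∈ LinearMap.range (LinearMap.rTensor A Y.nicholsSubspace.subtype)) :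
    LinearMap.rTensor A Y.nicholsMk.toLinearMap t = 0 := by
  obtain ⟨s, rfl⟩ := ht
  rw [← LinearMap.comp_apply, ← LinearMap.rTensor_comp]
  have : Y.nicholsMk.toLinearMap ∘ₗ Y.nicholsSubspace.subtype = 0 :=
    LinearMap.ext fun x => Y.nicholsMk_eq_zero x.2
  rw [this, LinearMap.rTensor_zero, LinearMap.zero_apply]

/-- The action of `H` on `B(W)`, induced from `T(W)`. -/
def nicholsAct : H →ₗ[k] Y.NicholsAlgebra →ₗ[k] Y.NicholsAlgebra :=
  (Y.nicholsLift (Y.tensorAct.compr₂ Y.nicholsMk.toLinearMap).flip fun x hx =>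
    LinearMap.ext fun h => Y.nicholsMk_eq_zero
      (Y.isNicholsHopfIdeal_nicholsSubspace.isYDSubmodule.act_mem h x hx)).flip

/-- The coaction of `H` on `B(W)`, induced from `T(W)`. -/
def nicholsCoact : Y.NicholsAlgebra →ₗ[k] H ⊗[k] Y.NicholsAlgebra :=
  Y.nicholsLift (LinearMap.lTensor H Y.nicholsMk.toLinearMap ∘ₗ Y.tensorCoact.toLinearMap)
    fun x hx => Y.lTensor_nicholsMk_eq_zero
      (Y.isNicholsHopfIdeal_nicholsSubspace.isYDSubmodule.coact_mem x hx)

theorem map_nicholsMk_comul_eq_zero {x : TensorAlgebra k W} (hx : x ∈ Y.nicholsSubspace) :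
    TensorProduct.map Y.nicholsMk.toLinearMap Y.nicholsMk.toLinearMap (Y.tensorComul x) = 0 := by
  obtain ⟨a, ha, b, hb, hab⟩ :=
    Submodule.mem_sup.1 (Y.isNicholsHopfIdeal_nicholsSubspace.comul_mem x hx)
  rw [← hab, map_add]
  nth_rewrite 1 [← LinearMap.lTensor_comp_rTensor]
  nth_rewrite 1 [← LinearMap.rTensor_comp_lTensor]
  rw [LinearMap.comp_apply, LinearMap.comp_apply, Y.rTensor_nicholsMk_eq_zero ha,
    Y.lTensor_nicholsMk_eq_zero hb, map_zero, map_zero, add_zero]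

/-- The comultiplication of the braided Hopf algebra `B(W)`, induced from `T(W)`. -/
def nicholsComul : Y.NicholsAlgebra →ₗ[k] Y.NicholsAlgebra ⊗[k] Y.NicholsAlgebra :=
  Y.nicholsLift
    (TensorProduct.map Y.nicholsMk.toLinearMap Y.nicholsMk.toLinearMap ∘ₗ Y.tensorComul)
    fun _ hx => Y.map_nicholsMk_comul_eq_zero hx

/-- The braided adjoint action of `w ∈ W` on `B(W)`: `ad_c w (b) = w b - (w₋₁ · b) w₀`. -/
def adc (w : W) : Module.End k Y.NicholsAlgebra :=
  LinearMap.mulLeft k (Y.nicholsIncl w) -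
    TensorProduct.lift
      ((LinearMap.llcomp k Y.NicholsAlgebra Y.NicholsAlgebra Y.NicholsAlgebra).flip.compl₁₂
        Y.nicholsAct ((LinearMap.mul k Y.NicholsAlgebra).flip ∘ₗ Y.nicholsIncl))
      (Y.coact w)

/-! ### Functoriality -/

/-- `f` is a morphism of Yetter-Drinfeld modules. -/
structure IsHom (Y : YetterDrinfeld k H W) (Z : YetterDrinfeld k H V) (f : W →ₗ[k] V) :
    Prop where
  map_act : ∀ (h : H) (w : W), f (Y.act h w) = Z.act h (f w)
  map_coact : ∀ w : W, Z.coact (f w) = LinearMap.lTensor H f (Y.coact w)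

section Functoriality

/-- The algebra map `T(W) → T(V)` extending a linear map `W → V`. -/
def tensorMap (f : W →ₗ[k] V) : TensorAlgebra k W →ₐ[k] TensorAlgebra k V :=
  TensorAlgebra.lift k (TensorAlgebra.ι k ∘ₗ f)

@[simp]
theorem tensorMap_ι (f : W →ₗ[k] V) (w : W) :
    tensorMap f (TensorAlgebra.ι k w) = TensorAlgebra.ι k (f w) := by
  simp [tensorMap]

variable {Y Z} {f : W →ₗ[k] V}

theorem tensorAct_ι (h : H) (w : W) :
    Y.tensorAct h (TensorAlgebra.ι k w) = TensorAlgebra.ι k (Y.act h w) := by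
  simp [tensorAct, tensorActHom]

theorem tensorAct_one (h : H) :
    Y.tensorAct h 1 = algebraMap k _ (Coalgebra.counit h) := by
  simp [tensorAct]

theorem tensorAct_mul (h : H) (x y : TensorAlgebra k W) :
    Y.tensorAct h (x * y) = LinearMap.mul' k _
      (TensorProduct.map (Y.tensorAct.flip x) (Y.tensorAct.flip y) (Coalgebra.comul h)) := by
  simp [tensorAct]

theorem IsHom.map_tensorAct (hf : IsHom Y Z f) (h : H) (t : TensorAlgebra k W) :
    tensorMap f (Y.tensorAct h t) = Z.tensorAct h (tensorMap f t) := by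
  induction t using TensorAlgebra.induction generalizing h with
  | algebraMap r =>
    simp [Algebra.algebraMap_eq_smul_one, tensorAct_one]
  | ι w => simp [tensorAct_ι, hf.map_act]
  | mul x y hx hy =>
    rw [tensorAct_mul, map_mul (tensorMap f), tensorAct_mul]
    generalize (Coalgebra.comul h : H ⊗[k] H) = c
    induction c with
    | zero => simp
    | add a b ha hb => simp only [map_add, ha, hb]
    | tmul a b => simp [hx, hy]
  | add x y hx hy => simp [hx, hy]

theorem IsHom.map_tensorCoact (hf : IsHom Y Z f) (t : TensorAlgebra k W) :
    Z.tensorCoact (tensorMap f t) =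
      LinearMap.lTensor H (tensorMap f).toLinearMap (Y.tensorCoact t) := by
  have : Z.tensorCoact.comp (tensorMap f) =
      (Algebra.TensorProduct.map (AlgHom.id k H) (tensorMap f)).comp Y.tensorCoact := by
    ext w
    simp only [AlgHom.toLinearMap_apply, LinearMap.comp_apply, AlgHom.comp_apply, tensorCoact,
      tensorMap_ι, TensorAlgebra.lift_ι_apply, hf.map_coact]
    generalize Y.coact w = c
    induction c with
    | zero => simp
    | add a b ha hb => simp only [map_add, ha, hb]
    | tmul a b => simp
  exact DFunLike.congr_fun this t

theorem comulOp_ι_tmul (w : W) (a b : TensorAlgebra k W) :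
    Y.comulOp (TensorAlgebra.ι k w) (a ⊗ₜ b) =
      (TensorAlgebra.ι k w * a) ⊗ₜ b +
        TensorProduct.map (Y.tensorAct.flip a) (LinearMap.mulRight k b ∘ₗ TensorAlgebra.ι k)
          (Y.coact w) := by
  simp only [comulOp, TensorAlgebra.lift_ι_apply, LinearMap.add_apply, LinearMap.comp_apply]
  congr 1
  generalize Y.coact w = c
  induction c with
  | zero => simp
  | add x y hx hy => simp only [map_add, LinearMap.add_apply, hx, hy]
  | tmul x y => simp [braidedMulRight]

theorem IsHom.map_comulOp (hf : IsHom Y Z f) (t : TensorAlgebra k W)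
    (s : TensorAlgebra k W ⊗[k] TensorAlgebra k W) :
    TensorProduct.map (tensorMap f).toLinearMap (tensorMap f).toLinearMap
        (Y.comulOp t s) =
      Z.comulOp (tensorMap f t)
        (TensorProduct.map (tensorMap f).toLinearMap
          (tensorMap f).toLinearMap s) := by
  induction t using TensorAlgebra.induction generalizing s with
  | algebraMap r => simp [Algebra.algebraMap_eq_smul_one]
  | ι w =>
    induction s with
    | zero => simp
    | add a b ha hb => simp only [map_add, ha, hb]
    | tmul a b =>
      simp only [comulOp_ι_tmul, TensorProduct.map_tmul, AlgHom.toLinearMap_apply,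
        tensorMap_ι, map_add, map_mul, hf.map_coact]
      congr 1
      generalize Y.coact w = c
      induction c with
      | zero => simp
      | add x y hx hy => simp only [map_add, hx, hy]
      | tmul x y => simp [hf.map_tensorAct]
  | mul x y hx hy => simp [hx, hy]
  | add x y hx hy => simp [hx, hy]

theorem IsHom.map_tensorComul (hf : IsHom Y Z f) (t : TensorAlgebra k W) :
    Z.tensorComul (tensorMap f t) =
      TensorProduct.map (tensorMap f).toLinearMap (tensorMap f).toLinearMap
        (Y.tensorComul t) := by
  simp [tensorComul, hf.map_comulOp]

theorem isNicholsHopfIdeal_map (hf : IsHom Y Z f) (hs : Function.Surjective f)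
    {I : Submodule k (TensorAlgebra k W)} (hI : Y.IsNicholsHopfIdeal I) :
    Z.IsNicholsHopfIdeal (I.map (tensorMap f).toLinearMap) := by
  have hsurj : Function.Surjective (tensorMap f) := by
    rw [← AlgHom.range_eq_top, ← top_le_iff, ← TensorAlgebra.adjoin_range_ι, Algebra.adjoin_le_iff]
    rintro _ ⟨v, rfl⟩
    obtain ⟨w, rfl⟩ := hs v
    exact ⟨TensorAlgebra.ι k w, by simp⟩
  set g : TensorAlgebra k W →ₗ[k] TensorAlgebra k V := (tensorMap f).toLinearMap with hg
  let g' : I →ₗ[k] I.map g := g.restrict fun x hx => Submodule.mem_map_of_mem hx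
  have hg' : g ∘ₗ I.subtype = (I.map g).subtype ∘ₗ g' := rfl
  refine ⟨?_, ?_, ?_, ⟨?_, ?_⟩, ?_⟩
  · rintro a _ ⟨x, hx, rfl⟩
    obtain ⟨a, rfl⟩ := hsurj a
    exact ⟨a * x, hI.mul_mem_left a x hx, by simp [hg]⟩
  · rintro a _ ⟨x, hx, rfl⟩
    obtain ⟨a, rfl⟩ := hsurj a
    exact ⟨x * a, hI.mul_mem_right a x hx, by simp [hg]⟩
  · refine (Submodule.map_mono hI.homogeneous).trans ?_
    rw [Submodule.map_iSup]
    refine iSup_mono fun n => (Submodule.map_inf_le _).trans (inf_le_inf_left _ ?_)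
    rw [hg, Submodule.map_pow]
    refine pow_le_pow_left' ?_ _
    rintro _ ⟨_, ⟨w, rfl⟩, rfl⟩
    exact ⟨f w, by simp⟩
  · rintro h _ ⟨x, hx, rfl⟩
    exact ⟨_, hI.isYDSubmodule.act_mem h x hx, hf.map_tensorAct h x⟩
  · rintro _ ⟨x, hx, rfl⟩
    obtain ⟨s, hs⟩ := hI.isYDSubmodule.coact_mem x hx
    refine ⟨LinearMap.lTensor H g' s, ?_⟩
    refine Eq.trans ?_ (hf.map_tensorCoact x).symm
    rw [← AlgHom.toLinearMap_apply Y.tensorCoact, ← hs, ← LinearMap.comp_apply,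
      ← LinearMap.lTensor_comp, ← hg', LinearMap.lTensor_comp]
    rfl
  · rintro _ ⟨x, hx, rfl⟩
    obtain ⟨_, ⟨a, rfl⟩, _, ⟨b, rfl⟩, hab⟩ := Submodule.mem_sup.1 (hI.comul_mem x hx)
    rw [hg, AlgHom.toLinearMap_apply, hf.map_tensorComul, ← hab, map_add]
    refine add_mem (Submodule.mem_sup_left ⟨TensorProduct.map g' g a, ?_⟩)
      (Submodule.mem_sup_right ⟨TensorProduct.map g g' b, ?_⟩)
    · simp only [LinearMap.rTensor, ← LinearMap.comp_apply, ← TensorProduct.map_comp]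
      rfl
    · simp only [LinearMap.lTensor, ← LinearMap.comp_apply, ← TensorProduct.map_comp]
      rfl

/-- The map `B(W) → B(V)` induced by a surjective morphism `f : W → V`. -/
def nicholsMap (hf : IsHom Y Z f) (hs : Function.Surjective f) :
    Y.NicholsAlgebra →ₐ[k] Z.NicholsAlgebra :=
  Ideal.Quotient.liftₐ Y.nicholsIdeal (Z.nicholsMk.comp (tensorMap f)) fun _ hx =>
    Z.nicholsMk_eq_zero (Z.le_nicholsSubspace
      (isNicholsHopfIdeal_map hf hs Y.isNicholsHopfIdeal_nicholsSubspace)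
      (Submodule.mem_map_of_mem hx))

theorem nicholsMap_incl (hf : IsHom Y Z f) (hs : Function.Surjective f) (w : W) :
    nicholsMap hf hs (Y.nicholsIncl w) = Z.nicholsIncl (f w) := by
  change Z.nicholsMk (tensorMap f (TensorAlgebra.ι k w)) = _
  rw [tensorMap_ι]
  rfl

end Functoriality

/-! ### The module `L` -/

/-- A realization of the Yetter-Drinfeld module `V` as a direct summand of the Yetter-Drinfeld
module `W`: morphisms `incl : V → W` and `proj : W → V` with `proj ∘ incl = id`. The
complement is the kernel of `proj`. -/
structure DirectSummand (Z : YetterDrinfeld k H V) (Y : YetterDrinfeld k H W) where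
  incl : V →ₗ[k] W
  proj : W →ₗ[k] V
  isHom_incl : IsHom Z Y incl
  isHom_proj : IsHom Y Z proj
  leftInverse : Function.LeftInverse proj incl

namespace DirectSummand

variable {Y Z} (D : DirectSummand Z Y)

/-- The projection `B(W) → B(V)` induced by `W → V`. -/
def nicholsProj : Y.NicholsAlgebra →ₐ[k] Z.NicholsAlgebra :=
  nicholsMap D.isHom_proj D.leftInverse.surjective

/-- The left coaction of the coalgebra `B(V)` given by the comultiplication of `B(W)` followed
by the projection of the first factor to `B(V)`. -/
def nicholsLeftCoact : Y.NicholsAlgebra →ₗ[k] Z.NicholsAlgebra ⊗[k] Y.NicholsAlgebra :=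
  LinearMap.rTensor Y.NicholsAlgebra D.nicholsProj.toLinearMap ∘ₗ Y.nicholsComul

/-- `L = ad B(V) (U)`: the span in `B(W)` of the elements
`ad_c x₁ (⋯ (ad_c xₘ (y)))` with `m ≥ 0`, `xᵢ ∈ V` and `y ∈ U`. -/
def L (U : Submodule k W) : Submodule k Y.NicholsAlgebra :=
  Submodule.span k {b | ∃ (l : List V) (y : W), y ∈ U ∧
    b = l.foldr (fun x b => Y.adc (D.incl x) b) (Y.nicholsIncl y)}

/-- `Lᵐ`: the homogeneous component of degree `m` of `L`. -/
def LDeg (U : Submodule k W) (m : ℕ) : Submodule k Y.NicholsAlgebra := D.L U ⊓ Y.nicholsDeg m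

end DirectSummand

end YetterDrinfeld

end

/-! Let L' be a nonzero Yetter-Drinfeld submodule of L^max and let N be the B(V)-subcomodule of B(W)
generated by L'. Everything follows from N = L. For L' = L^max this is the generation statement. For
irreducibility, note that the coaction sends an element x of degree M to 1 ⊗ x plus terms whose
second factor has smaller degree. Hence the degree M part of N is L'
(`mem_of_mem_subcomoduleClosure`), while the degree M part of L is L^max, so L' = L^max.

To prove N = L (`subcomoduleClosure_eq_L`), observe that ad_c V kills L', because it raises degrees
by one inside L and L vanishes above degree M. Let K be the kernel of B(W) → B(V). A subspace N is a
subcomodule exactly when Δ(N) ⊆ K ⊗ B(W) + B(W) ⊗ N (`isSubcomodule_iff`). The formula `comul_ad`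
for Δ(ad_c v (x)), solved for the term with ad_c in the second factor, shows that stability under
ad_c V spreads from L' along the coaction to all of N (`ad_mem_subcomoduleClosure`). An argument of
the same kind shows that N is a Yetter-Drinfeld submodule (`isYDSubmodule_subcomoduleClosure`); for
the H-coaction it needs the inverse of the antipode.

It remains to find U inside N. A nonzero element x of N of least degree is coinvariant. For x in L
the difference Δ(x) - x ⊗ 1 lies in B(V) ⊗ B(W) (`comul_sub_mem_range`), so a coinvariant x is
primitive. A Nichols algebra has no nonzero primitive elements of degree at least two
(`eq_zero_of_mem_primitives`), hence x lies in U. Thus U ∩ N is a nonzero Yetter-Drinfeld submodule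
of U; irreducibility gives U ⊆ N, and stability under ad_c V gives L ⊆ N.

The identities for the braided structure are needed both for T(W), where the maximality of the
Nichols ideal is exploited, and for B(W). They are proved once, for a `BraidedQuotient`, by
induction over products of a generator with an element. -/

noncomputable section

set_option linter.unusedSectionVars false

/-! ### Sweedler sums -/

section Sweedler

variable {k : Type*} [Field k]
variable {A B C M P Q : Type*} [AddCommGroup A] [Module k A] [AddCommGroup B] [Module k B]
  [AddCommGroup C] [Module k C] [AddCommGroup M] [Module k M]
  [AddCommGroup P] [Module k P] [AddCommGroup Q] [Module k Q]

/-- The sum `∑ f aᵢ bᵢ` for a chosen decomposition `t = ∑ aᵢ ⊗ bᵢ`. -/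
def sweedler (t : A ⊗[k] B) (f : A → B → P) : P :=
  ∑ p ∈ (TensorProduct.exists_finset t).choose, f p.1 p.2

theorem sweedler_tmul_self (t : A ⊗[k] B) : sweedler t (fun a b => a ⊗ₜ[k] b) = t :=
  (TensorProduct.exists_finset t).choose_spec.symm

/-- A function of one variable which is linear. -/
structure IsLin (k : Type*) [Field k] {A P : Type*} [AddCommGroup A] [Module k A]
    [AddCommGroup P] [Module k P] (f : A → P) : Prop where
  add : ∀ a a', f (a + a') = f a + f a'
  smul : ∀ (c : k) a, f (c • a) = c • f a

/-- A function of two variables which is bilinear. -/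
structure IsBilin (k : Type*) [Field k] {A B P : Type*} [AddCommGroup A] [Module k A]
    [AddCommGroup B] [Module k B] [AddCommGroup P] [Module k P] (f : A → B → P) : Prop where
  add_left : ∀ a a' b, f (a + a') b = f a b + f a' b
  smul_left : ∀ (c : k) a b, f (c • a) b = c • f a b
  add_right : ∀ a b b', f a (b + b') = f a b + f a b'
  smul_right : ∀ (c : k) a b, f a (c • b) = c • f a b

/-- A function of three variables which is trilinear. -/
structure IsTrilin (k : Type*) [Field k] {A B C P : Type*} [AddCommGroup A] [Module k A]
    [AddCommGroup B] [Module k B] [AddCommGroup C] [Module k C] [AddCommGroup P] [Module k P]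
    (f : A → B → C → P) : Prop where
  add_left : ∀ a a' b c, f (a + a') b c = f a b c + f a' b c
  smul_left : ∀ (r : k) a b c, f (r • a) b c = r • f a b c
  add_mid : ∀ a b b' c, f a (b + b') c = f a b c + f a b' c
  smul_mid : ∀ (r : k) a b c, f a (r • b) c = r • f a b c
  add_right : ∀ a b c c', f a b (c + c') = f a b c + f a b c'
  smul_right : ∀ (r : k) a b c, f a b (r • c) = r • f a b c

/-- The linear map on the tensor product defined by a bilinear function. -/
def IsBilin.lift {f : A → B → P} (hf : IsBilin k f) : A ⊗[k] B →ₗ[k] P :=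
  TensorProduct.lift (LinearMap.mk₂ k f hf.add_left hf.smul_left hf.add_right hf.smul_right)

@[simp]
theorem IsBilin.lift_tmul {f : A → B → P} (hf : IsBilin k f) (a : A) (b : B) :
    hf.lift (a ⊗ₜ b) = f a b := rfl

/-- The decomposition behind `sweedler` is arbitrary; bilinearity of f makes the sum independent of
it. Lemmas without an `IsBilin` hypothesis, such as `map_sweedler` and `sweedler_comm`, only
rearrange one fixed finite sum. -/
theorem sweedler_eq_lift {f : A → B → P} (hf : IsBilin k f) (t : A ⊗[k] B) :
    sweedler t f = hf.lift t := by
  conv_rhs => rw [← sweedler_tmul_self t]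
  simp [sweedler]

theorem map_sweedler {F : Type*} [FunLike F P Q] [AddMonoidHomClass F P Q] (φ : F)
    (t : A ⊗[k] B) (f : A → B → P) : φ (sweedler t f) = sweedler t fun a b => φ (f a b) := by
  simp [sweedler]

theorem sweedler_linearMap (F : A ⊗[k] B →ₗ[k] P) (t : A ⊗[k] B) :
    sweedler t (fun a b => F (a ⊗ₜ b)) = F t := by
  rw [← map_sweedler, sweedler_tmul_self]

theorem sweedler_add {f : A → B → P} (hf : IsBilin k f) (s t : A ⊗[k] B) :
    sweedler (s + t) f = sweedler s f + sweedler t f := by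
  simp [sweedler_eq_lift hf]

theorem sweedler_smul {f : A → B → P} (hf : IsBilin k f) (c : k) (t : A ⊗[k] B) :
    sweedler (c • t) f = c • sweedler t f := by
  simp [sweedler_eq_lift hf]

theorem sweedler_zero {f : A → B → P} (hf : IsBilin k f) :
    sweedler (0 : A ⊗[k] B) f = 0 := by
  simp [sweedler_eq_lift hf]

theorem sweedler_tmul {f : A → B → P} (hf : IsBilin k f) (a : A) (b : B) :
    sweedler (a ⊗ₜ[k] b) f = f a b := by
  simp [sweedler_eq_lift hf]

theorem sweedler_sweedler {f : A → B → P} (hf : IsBilin k f) (t : C ⊗[k] M)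
    (g : C → M → A ⊗[k] B) :
    sweedler (sweedler t g) f = sweedler t fun c m => sweedler (g c m) f := by
  simp [sweedler_eq_lift hf, map_sweedler]

theorem sweedler_map {f : A → B → P} (hf : IsBilin k f) (φ : C →ₗ[k] A) (ψ : M →ₗ[k] B)
    (t : C ⊗[k] M) :
    sweedler (TensorProduct.map φ ψ t) f = sweedler t fun c m => f (φ c) (ψ m) := by
  rw [← sweedler_linearMap, sweedler_sweedler hf]
  simp [sweedler_tmul hf]

theorem sweedler_lTensor {f : A → B → P} (hf : IsBilin k f) (ψ : M →ₗ[k] B)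
    (t : A ⊗[k] M) :
    sweedler (LinearMap.lTensor A ψ t) f = sweedler t fun c m => f c (ψ m) :=
  sweedler_map hf LinearMap.id ψ t

theorem sweedler_rTensor {f : A → B → P} (hf : IsBilin k f) (φ : C →ₗ[k] A)
    (t : C ⊗[k] B) :
    sweedler (LinearMap.rTensor B φ t) f = sweedler t fun c m => f (φ c) m :=
  sweedler_map hf φ LinearMap.id t

theorem sweedler_comm (s : A ⊗[k] B) (t : C ⊗[k] M) (f : A → B → C → M → P) :
    sweedler s (fun a b => sweedler t fun c m => f a b c m) =
      sweedler t fun c m => sweedler s fun a b => f a b c m :=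
  Finset.sum_comm

theorem sweedler_add_fun (t : A ⊗[k] B) (f g : A → B → P) :
    sweedler t (fun a b => f a b + g a b) = sweedler t f + sweedler t g :=
  Finset.sum_add_distrib

@[simp]
theorem sweedler_zero_fun (t : A ⊗[k] B) : sweedler t (fun _ _ => (0 : P)) = 0 :=
  Finset.sum_const_zero

theorem sweedler_sub_fun (t : A ⊗[k] B) (f g : A → B → P) :
    sweedler t (fun a b => f a b - g a b) = sweedler t f - sweedler t g :=
  Finset.sum_sub_distrib _ _

theorem sweedler_smul_fun (t : A ⊗[k] B) (c : k) (f : A → B → P) :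
    sweedler t (fun a b => c • f a b) = c • sweedler t f :=
  Finset.smul_sum.symm

theorem sweedler_mul_left {R : Type*} [Ring R] (t : A ⊗[k] B) (c : R) (f : A → B → R) :
    c * sweedler t f = sweedler t fun a b => c * f a b :=
  Finset.mul_sum _ _ _

theorem sweedler_mul_right {R : Type*} [Ring R] (t : A ⊗[k] B) (c : R) (f : A → B → R) :
    sweedler t f * c = sweedler t fun a b => f a b * c :=
  Finset.sum_mul _ _ _

theorem sweedler_mem (N : Submodule k P) (t : A ⊗[k] B) (f : A → B → P)
    (h : ∀ a b, f a b ∈ N) : sweedler t f ∈ N :=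
  Submodule.sum_mem _ fun _ _ => h _ _

theorem sweedler_tmul_left (t : A ⊗[k] B) (f : A → B → P) (c : C) :
    c ⊗ₜ[k] sweedler t f = sweedler t fun a b => c ⊗ₜ[k] f a b :=
  map_sweedler (TensorProduct.mk k C P c) t f

theorem sweedler_tmul_right (t : A ⊗[k] B) (f : A → B → P) (c : C) :
    sweedler t f ⊗ₜ[k] c = sweedler t fun a b => f a b ⊗ₜ[k] c :=
  map_sweedler ((TensorProduct.mk k P C).flip c) t f

/-- If `t` lies in `A ⊗ N`, its Sweedler sums can be estimated using elements of `N` only. -/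
theorem sweedler_mem_of_mem_range_lTensor {N : Submodule k B} (T : Submodule k P)
    {t : A ⊗[k] B} (ht : t ∈ LinearMap.range (LinearMap.lTensor A N.subtype))
    {f : A → B → P} (hf : IsBilin k f) (h : ∀ a, ∀ b ∈ N, f a b ∈ T) : sweedler t f ∈ T := by
  obtain ⟨s, rfl⟩ := ht
  rw [sweedler_lTensor hf]
  exact sweedler_mem T s _ fun a b => h a b b.2

section Trilinear

variable {f : A → B → C → P} (hf : IsTrilin k f)
include hf

theorem IsTrilin.bilin (a : A) : IsBilin k (f a) :=
  ⟨hf.add_mid a, fun c b => hf.smul_mid c a b, hf.add_right a, fun c b => hf.smul_right c a b⟩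

theorem IsTrilin.bilin_left (c : C) : IsBilin k fun a b => f a b c :=
  ⟨fun a a' b => hf.add_left a a' b c, fun r a b => hf.smul_left r a b c,
    fun a b b' => hf.add_mid a b b' c, fun r a b => hf.smul_mid r a b c⟩

theorem IsTrilin.bilin_sweedler :
    IsBilin k fun (a : A) (t : B ⊗[k] C) => sweedler t (f a) where
  add_left a a' t := by rw [← sweedler_add_fun]; simp only [← hf.add_left]
  smul_left c a t := by rw [← sweedler_smul_fun]; simp only [← hf.smul_left]
  add_right a t t' := sweedler_add (hf.bilin a) t t'
  smul_right c a t := sweedler_smul (hf.bilin a) c t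

theorem sweedler_assoc (t : (A ⊗[k] B) ⊗[k] C) :
    sweedler (TensorProduct.assoc k A B C t) (fun a s => sweedler s (f a)) =
      sweedler t fun s c => sweedler s fun a b => f a b c := by
  conv_lhs => rw [← sweedler_tmul_self t]
  rw [map_sweedler, sweedler_sweedler hf.bilin_sweedler]
  congr 1
  funext s c
  conv_lhs => rw [← sweedler_tmul_self s]
  rw [sweedler_tmul_right, map_sweedler, sweedler_sweedler hf.bilin_sweedler]
  congr 1
  funext a b
  simp [sweedler_tmul hf.bilin_sweedler, sweedler_tmul (hf.bilin a)]

end Trilinear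

variable {H : Type*} [Ring H] [HopfAlgebra k H]

/-- Only one element x and an arbitrary map δ are involved, so that the same statement serves for
the comultiplication of H and for the coactions on W and on its braided quotients. -/
theorem sweedler_coassoc {δ : M →ₗ[k] H ⊗[k] M} {x : M}
    (hδ : TensorProduct.assoc k H H M (LinearMap.rTensor M Coalgebra.comul (δ x)) =
      LinearMap.lTensor H δ (δ x)) {f : H → H → M → P} (hf : IsTrilin k f) :
    sweedler (δ x)
        (fun a m => sweedler (Coalgebra.comul (R := k) a) fun b c => f b c m) =
      sweedler (δ x) fun a m => sweedler (δ m) fun b n => f a b n := by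
  have h := congrArg (fun t => sweedler t fun a s => sweedler s (f a)) hδ
  simp only [sweedler_assoc hf, sweedler_lTensor hf.bilin_sweedler] at h
  rw [sweedler_rTensor] at h
  · exact h
  · refine ⟨fun a a' b => ?_, fun c a b => ?_, fun a b b' => ?_, fun c a b => ?_⟩
    · exact sweedler_add (hf.bilin_left b) a a'
    · exact sweedler_smul (hf.bilin_left b) c a
    · simp only [hf.add_right, sweedler_add_fun]
    · simp only [hf.smul_right, sweedler_smul_fun]

theorem sweedler_comul_coassoc (h : H) {f : H → H → H → P} (hf : IsTrilin k f) :
    sweedler (Coalgebra.comul (R := k) h)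
        (fun a m => sweedler (Coalgebra.comul (R := k) a) fun b c => f b c m) =
      sweedler (Coalgebra.comul (R := k) h)
        fun a m => sweedler (Coalgebra.comul (R := k) m) fun b n => f a b n :=
  sweedler_coassoc (Coalgebra.coassoc_apply h) hf

theorem sweedler_counit_left {δ : M →ₗ[k] H ⊗[k] M} {x : M}
    (hδ : TensorProduct.lid k M (LinearMap.rTensor M Coalgebra.counit (δ x)) = x)
    {f : M → P} (hf : IsLin k f) :
    sweedler (δ x) (fun a m => Coalgebra.counit (R := k) a • f m) = f x := by
  have h := congrArg f hδ
  rw [← h]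
  let F : M →ₗ[k] P := ⟨⟨f, hf.add⟩, hf.smul⟩
  change _ = F _
  conv_rhs => rw [← sweedler_tmul_self (δ x)]
  simp only [map_sweedler, LinearMap.rTensor_tmul, TensorProduct.lid_tmul,
    map_smul]
  rfl

theorem sweedler_comul_counit_left (h : H) {f : H → P} (hf : IsLin k f) :
    sweedler (Coalgebra.comul (R := k) h) (fun a m => Coalgebra.counit (R := k) a • f m) = f h :=
  sweedler_counit_left (by simp) hf

theorem sweedler_comul_counit_right (h : H) {f : H → P} (hf : IsLin k f) :
    sweedler (Coalgebra.comul (R := k) h) (fun a m => Coalgebra.counit (R := k) m • f a) = f h := by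
  let F : H →ₗ[k] P := ⟨⟨f, hf.add⟩, hf.smul⟩
  have h' := congrArg (TensorProduct.rid k H) (Coalgebra.lTensor_counit_comul (R := k) h)
  rw [TensorProduct.rid_tmul, one_smul] at h'
  refine Eq.trans ?_ (congrArg F h')
  conv_rhs => rw [← sweedler_tmul_self (Coalgebra.comul h)]
  simp only [map_sweedler, LinearMap.lTensor_tmul, TensorProduct.rid_tmul, map_smul]
  rfl

theorem sweedler_antipode_mul (h : H) {f : H → P} (hf : IsLin k f) :
    sweedler (Coalgebra.comul (R := k) h) (fun a b => f (HopfAlgebra.antipode k a * b)) =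
      Coalgebra.counit (R := k) h • f 1 := by
  let F : H →ₗ[k] P := ⟨⟨f, hf.add⟩, hf.smul⟩
  have h' := congrArg F (HopfAlgebra.mul_antipode_rTensor_comul_apply (R := k) h)
  rw [Algebra.algebraMap_eq_smul_one, map_smul] at h'
  refine Eq.trans ?_ h'
  conv_rhs => rw [← sweedler_tmul_self (Coalgebra.comul h)]
  simp only [map_sweedler, LinearMap.rTensor_tmul, LinearMap.mul'_apply]
  rfl

end Sweedler

/-! ### Slices of tensors -/

section Slice

variable {k : Type*} [Field k]
variable {A B C P : Type*} [AddCommGroup A] [Module k A] [AddCommGroup B] [Module k B]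
  [AddCommGroup C] [Module k C] [AddCommGroup P] [Module k P]

/-- The map `f ⊗ id : A ⊗ B → B` for a linear form `f` on `A`. -/
def slice (f : A →ₗ[k] k) : A ⊗[k] B →ₗ[k] B :=
  (TensorProduct.lid k B).toLinearMap ∘ₗ LinearMap.rTensor B f

@[simp]
theorem slice_tmul (f : A →ₗ[k] k) (a : A) (b : B) : slice f (a ⊗ₜ[k] b) = f a • b := by
  simp [slice]

theorem slice_lTensor (f : A →ₗ[k] k) (g : B →ₗ[k] C) (t : A ⊗[k] B) :
    slice f (LinearMap.lTensor A g t) = g (slice f t) := by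
  induction t with
  | zero => simp
  | tmul a b => simp
  | add s t hs ht => simp only [map_add, hs, ht]

theorem slice_rTensor (f : A →ₗ[k] k) (g : C →ₗ[k] A) (t : C ⊗[k] B) :
    slice f (LinearMap.rTensor B g t) = slice (f ∘ₗ g) t := by
  induction t with
  | zero => simp
  | tmul a b => simp
  | add s t hs ht => simp only [map_add, hs, ht]

theorem eq_zero_of_slice_eq_zero {t : A ⊗[k] B} (h : ∀ f : A →ₗ[k] k, slice f t = 0) :
    t = 0 := by
  classical
  let b := Module.Basis.ofVectorSpace k A
  apply (TensorProduct.equivFinsuppOfBasisLeft (N := B) b).injective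
  ext i
  rw [map_zero, Finsupp.zero_apply, ← h (b.coord i)]
  clear h
  induction t with
  | zero => simp
  | tmul a c => simp
  | add s t hs ht => simp only [map_add, Finsupp.add_apply, hs, ht]

/-- Over a field, A ⊗ N is the kernel of A ⊗ B → A ⊗ B/N, and an element of A ⊗ B/N is zero once all
its slices are. Slices thus turn conditions on tensors into conditions on elements, which behave
well under intersections. -/
theorem mem_range_lTensor_iff {N : Submodule k B} {t : A ⊗[k] B} :
    t ∈ LinearMap.range (LinearMap.lTensor A N.subtype) ↔ ∀ f : A →ₗ[k] k, slice f t ∈ N := by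
  refine ⟨?_, fun h => ?_⟩
  · rintro ⟨s, rfl⟩ f
    rw [slice_lTensor]
    exact (slice f s).2
  · have hex : Function.Exact N.subtype N.mkQ := by
      intro x; simp
    refine (lTensor_exact A hex N.mkQ_surjective t).1 (eq_zero_of_slice_eq_zero fun f => ?_)
    rw [slice_lTensor]
    simpa using h f

end Slice

open Coalgebra (counit)

section SweedlerMul

variable {k : Type*} [Field k] {A B P : Type*} [Ring A] [Algebra k A] [Ring B] [Algebra k B]
  [AddCommGroup P] [Module k P]

theorem sweedler_mul {f : A → B → P} (hf : IsBilin k f) (s t : A ⊗[k] B) :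
    sweedler (s * t) f =
      sweedler s fun a b => sweedler t fun c d => f (a * c) (b * d) := by
  conv_lhs => rw [← sweedler_tmul_self s, ← sweedler_tmul_self t]
  simp only [sweedler_mul_left, sweedler_mul_right, sweedler_sweedler hf,
    Algebra.TensorProduct.tmul_mul_tmul, sweedler_tmul hf]
  exact sweedler_comm _ _ _

end SweedlerMul

/-! ### The Yetter-Drinfeld compatibility in a form without antipode -/

namespace YetterDrinfeld

variable {k : Type*} [Field k] {H : Type*} [Ring H] [HopfAlgebra k H]
variable {W : Type*} [AddCommGroup W] [Module k W]

section

variable (Y : YetterDrinfeld k H W)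

theorem sweedler_coact_coassoc {P : Type*} [AddCommGroup P] [Module k P] (w : W)
    {f : H → H → W → P} (hf : IsTrilin k f) :
    sweedler (Y.coact w)
        (fun a m => sweedler (Coalgebra.comul (R := k) a) fun b c => f b c m) =
      sweedler (Y.coact w) fun a m => sweedler (Y.coact m) fun b n => f a b n :=
  sweedler_coassoc (Y.coassoc_coact w) hf

theorem coact_act_eq (h : H) (w : W) :
    Y.coact (Y.act h w) = sweedler (Coalgebra.comul (R := k) h) fun a b =>
      sweedler (Coalgebra.comul (R := k) b) fun c d =>
        TensorProduct.map (LinearMap.mulLeft k a ∘ₗ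
          LinearMap.mulRight k (HopfAlgebra.antipode k d)) (Y.act c) (Y.coact w) := by
  rw [Y.coact_act]
  generalize Y.coact w = t
  have h1 : LinearMap.lTensor H Coalgebra.comul (Coalgebra.comul (R := k) h) =
      sweedler (Coalgebra.comul (R := k) h) fun a b =>
        sweedler (Coalgebra.comul (R := k) b) fun c d => a ⊗ₜ[k] (c ⊗ₜ[k] d) := by
    conv_lhs => rw [← sweedler_tmul_self (Coalgebra.comul (R := k) h)]
    rw [map_sweedler]
    simp only [← sweedler_tmul_left, sweedler_tmul_self, LinearMap.lTensor_tmul]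
  rw [h1]
  let ev : (H ⊗[k] W →ₗ[k] H ⊗[k] W) →ₗ[k] H ⊗[k] W := LinearMap.applyₗ t
  change ev _ = _
  simp only [map_sweedler]
  rfl

/-- The Yetter-Drinfeld compatibility in the form
`(h₁ x)₋₁ h₂ ⊗ (h₁ x)₀ = h₁ x₋₁ ⊗ h₂ x₀`. -/
theorem sweedler_coact_act (h : H) (w : W) :
    sweedler (Coalgebra.comul (R := k) h) (fun a b =>
        LinearMap.rTensor W (LinearMap.mulRight k b) (Y.coact (Y.act a w))) =
      sweedler (Coalgebra.comul (R := k) h) fun a b =>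
        TensorProduct.map (LinearMap.mulLeft k a) (Y.act b) (Y.coact w) := by
  simp only [coact_act_eq, map_sweedler]
  generalize Y.coact w = t
  induction t with
  | zero => simp
  | add x y hx hy => simp only [map_add, sweedler_add_fun, hx, hy]
  | tmul g m =>
    simp only [TensorProduct.map_tmul, LinearMap.rTensor_tmul, LinearMap.comp_apply,
      LinearMap.mulLeft_apply, LinearMap.mulRight_apply, mul_assoc]
    have hin : ∀ a : H, IsTrilin k fun c d b : H =>
        (a * (g * (HopfAlgebra.antipode k d * b))) ⊗ₜ[k] (Y.act c) m := fun a => by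
      constructor <;> intros <;> simp [mul_add, add_mul, TensorProduct.add_tmul,
        TensorProduct.tmul_add, TensorProduct.smul_tmul']
    -- The left side is h₁ g S(h₃) h₄ ⊗ h₂ m. Two applications of coassociativity expose S(h₃) h₄,
    -- which the antipode axiom replaces by a counit.
    rw [sweedler_comul_coassoc h (f := fun a b' b => sweedler (Coalgebra.comul (R := k) b')
      fun c d => (a * (g * (HopfAlgebra.antipode k d * b))) ⊗ₜ[k] (Y.act c) m)]
    · congr 1; funext a h'
      rw [sweedler_comul_coassoc h' (hin a)]
      have hlin : ∀ c : H, IsLin k fun x : H => (a * (g * x)) ⊗ₜ[k] (Y.act c) m := fun c => by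
        constructor <;> intros <;> simp [mul_add, TensorProduct.add_tmul,
          TensorProduct.smul_tmul']
      simp only [fun c x => sweedler_antipode_mul x (hlin c)]
      rw [sweedler_comul_counit_right h'
        (f := fun c => (a * (g * 1)) ⊗ₜ[k] (Y.act c) m), mul_one]
      constructor <;> intros <;> simp [TensorProduct.tmul_add]
    · constructor <;> intros
      all_goals first
        | rw [map_add, sweedler_add ((hin _).bilin_left _)]
        | rw [map_smul, sweedler_smul ((hin _).bilin_left _)]
        | rw [← sweedler_add_fun] | rw [← sweedler_smul_fun]
      all_goals simp [mul_add, add_mul, TensorProduct.add_tmul,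
        TensorProduct.smul_tmul']

/-- The compatibility `sweedler_coact_act`, evaluated at a bilinear function. -/
theorem sweedler_coact_act_apply {P : Type*} [AddCommGroup P] [Module k P] (h : H) (w : W)
    {f : H → W → P} (hf : IsBilin k f) :
    sweedler (Coalgebra.comul (R := k) h) (fun a b =>
        sweedler (Y.coact (Y.act a w)) fun c v => f (c * b) v) =
      sweedler (Coalgebra.comul (R := k) h) fun a b =>
        sweedler (Y.coact w) fun c v => f (a * c) (Y.act b v) := by
  have h1 := congrArg (fun t => sweedler t f) (Y.sweedler_coact_act h w)
  simpa only [sweedler_sweedler hf, sweedler_rTensor hf, sweedler_map hf,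
    LinearMap.mulRight_apply, LinearMap.mulLeft_apply] using h1

end

end YetterDrinfeld

/-! ### Braided quotients of T(W): action and coaction of H -/

namespace YetterDrinfeld

variable {k : Type*} [Field k] {H : Type*} [Ring H] [HopfAlgebra k H]
variable {W : Type*} [AddCommGroup W] [Module k W]

/-- An algebra `R` generated by the image of a Yetter-Drinfeld module `W`, with an action and a
coaction of `H` for which `R` is an algebra in Yetter-Drinfeld modules, and with a braided
comultiplication for which the image of `W` is primitive. Examples are `T(W)` and `B(W)`. -/
structure BraidedQuotient (Y : YetterDrinfeld k H W) (R : Type*) [Ring R] [Algebra k R] where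
  ι : W →ₗ[k] R
  act : H →ₗ[k] R →ₗ[k] R
  coact : R →ₐ[k] H ⊗[k] R
  comul : R →ₗ[k] R ⊗[k] R
  adjoin_range_ι : Algebra.adjoin k (Set.range ι) = ⊤
  act_ι : ∀ h w, act h (ι w) = ι (Y.act h w)
  act_one : ∀ h, act h 1 = Coalgebra.counit (R := k) h • (1 : R)
  act_mul : ∀ h x y, act h (x * y) =
    sweedler (Coalgebra.comul (R := k) h) fun a b => act a x * act b y
  coact_ι : ∀ w, coact (ι w) = LinearMap.lTensor H ι (Y.coact w)
  comul_one : comul 1 = 1 ⊗ₜ 1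
  comul_ι_mul : ∀ w x, comul (ι w * x) =
    LinearMap.rTensor R (LinearMap.mulLeft k (ι w)) (comul x) +
      sweedler (Y.coact w) fun h v =>
        TensorProduct.map (act h) (LinearMap.mulLeft k (ι v)) (comul x)

namespace BraidedQuotient

variable {Y : YetterDrinfeld k H W} {R : Type*} [Ring R] [Algebra k R] (S : BraidedQuotient Y R)

/-- The elements whose left multiplication preserves N form a subalgebra containing the generators,
hence all of R; apply them to 1 ∈ N. -/
theorem eq_top_of_ι_mul_mem (N : Submodule k R) (h1 : 1 ∈ N)
    (hN : ∀ w, ∀ x ∈ N, S.ι w * x ∈ N) : N = ⊤ := by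
  let A : Subalgebra k R :=
    { carrier := {a | ∀ x ∈ N, a * x ∈ N}
      mul_mem' := fun {a b} ha hb x hx => by
        rw [mul_assoc]; exact ha _ (hb _ hx)
      add_mem' := fun {a b} ha hb x hx => by
        rw [add_mul]; exact N.add_mem (ha _ hx) (hb _ hx)
      algebraMap_mem' := fun r x hx => by
        rw [← Algebra.smul_def]; exact N.smul_mem r hx }
  have hA : A = ⊤ := by
    rw [← top_le_iff, ← S.adjoin_range_ι, Algebra.adjoin_le_iff]
    rintro _ ⟨w, rfl⟩
    exact hN w
  refine top_le_iff.1 fun x _ => ?_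
  have : x ∈ A := hA ▸ Algebra.mem_top
  simpa using this 1 h1

theorem induction {p : R → Prop} (one : p 1) (ι_mul : ∀ w x, p x → p (S.ι w * x))
    (add : ∀ x y, p x → p y → p (x + y)) (smul : ∀ (c : k) x, p x → p (c • x)) (x : R) : p x := by
  let N : Submodule k R :=
    { carrier := {x | p x}
      add_mem' := fun {a b} => add a b
      zero_mem' := by simpa using smul 0 1 one
      smul_mem' := smul }
  have : x ∈ N := (S.eq_top_of_ι_mul_mem N one ι_mul) ▸ Submodule.mem_top
  exact this

theorem algHom_ext {B : Type*} [Ring B] [Algebra k B] {f g : R →ₐ[k] B}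
    (h : ∀ w, f (S.ι w) = g (S.ι w)) : f = g := by
  refine AlgHom.ext_of_adjoin_eq_top S.adjoin_range_ι ?_
  rintro _ ⟨w, rfl⟩
  exact h w

theorem act_act (g h : H) (x : R) : S.act g (S.act h x) = S.act (g * h) x := by
  induction x using S.induction generalizing g h with
  | one => simp [act_one, mul_comm, smul_smul]
  | add x y hx hy => simp only [map_add, hx, hy]
  | smul c x hx => simp only [map_smul, hx]
  | ι_mul w x hx =>
    rw [act_mul, act_mul, Bialgebra.comul_mul, sweedler_mul, map_sweedler]
    · simp only [act_mul, act_ι, hx, map_mul, Module.End.mul_apply]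
      exact sweedler_comm _ _ _
    · constructor <;> intros <;> simp [add_mul, mul_add]

theorem act_one_apply (x : R) : S.act 1 x = x := by
  induction x using S.induction with
  | one => simp [act_one]
  | add x y hx hy => simp only [map_add, hx, hy]
  | smul c x hx => simp only [map_smul, hx]
  | ι_mul w x hx =>
    rw [act_mul, Bialgebra.comul_one, Algebra.TensorProduct.one_def, sweedler_tmul]
    · simp [act_ι, hx]
    · constructor <;> intros <;> simp [add_mul, mul_add]

/-- Both sides are algebra maps in x, so the identity only has to be checked on W. The same reason
applies to `counit_coact`. -/
theorem coact_coassoc (x : R) :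
    TensorProduct.assoc k H H R
        (LinearMap.rTensor R Coalgebra.comul (S.coact x)) =
      LinearMap.lTensor H S.coact.toLinearMap (S.coact x) := by
  let f : R →ₐ[k] H ⊗[k] (H ⊗[k] R) :=
    (Algebra.TensorProduct.assoc k k k H H R).toAlgHom.comp
      ((Algebra.TensorProduct.map (Bialgebra.comulAlgHom k H) (AlgHom.id k R)).comp S.coact)
  let g : R →ₐ[k] H ⊗[k] (H ⊗[k] R) :=
    (Algebra.TensorProduct.map (AlgHom.id k H) S.coact).comp S.coact
  have hfg : f = g := by
    refine S.algHom_ext fun w => ?_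
    change TensorProduct.assoc k H H R
        (LinearMap.rTensor R Coalgebra.comul (S.coact (S.ι w))) =
      LinearMap.lTensor H S.coact.toLinearMap (S.coact (S.ι w))
    rw [S.coact_ι]
    have h1 : ∀ t : H ⊗[k] W, TensorProduct.assoc k H H R
        (LinearMap.rTensor R Coalgebra.comul (LinearMap.lTensor H S.ι t)) =
        LinearMap.lTensor H (LinearMap.lTensor H S.ι) (TensorProduct.assoc k H H W
        (LinearMap.rTensor W Coalgebra.comul t)) := fun t => by
      induction t with
      | zero => simp
      | add x y hx hy => simp only [map_add, hx, hy]
      | tmul h v =>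
        simp only [LinearMap.lTensor_tmul, LinearMap.rTensor_tmul]
        generalize (Coalgebra.comul h : H ⊗[k] H) = c
        induction c with
        | zero => simp
        | add x y hx hy => simp only [TensorProduct.add_tmul, map_add, hx, hy]
        | tmul a b => simp
    have h2 : LinearMap.lTensor H S.ι ∘ₗ Y.coact = S.coact.toLinearMap ∘ₗ S.ι :=
      LinearMap.ext fun v => (S.coact_ι v).symm
    rw [h1, Y.coassoc_coact, ← LinearMap.comp_apply, ← LinearMap.lTensor_comp, h2,
      LinearMap.lTensor_comp, LinearMap.comp_apply]
  exact DFunLike.congr_fun hfg x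

theorem counit_coact (x : R) :
    TensorProduct.lid k R (LinearMap.rTensor R Coalgebra.counit (S.coact x)) = x := by
  let f : R →ₐ[k] R :=
    (Algebra.TensorProduct.lid k R).toAlgHom.comp
      ((Algebra.TensorProduct.map (Bialgebra.counitAlgHom k H) (AlgHom.id k R)).comp S.coact)
  have hf : f = AlgHom.id k R := by
    refine S.algHom_ext fun w => ?_
    change TensorProduct.lid k R (LinearMap.rTensor R Coalgebra.counit (S.coact (S.ι w))) = S.ι w
    rw [S.coact_ι]
    conv_rhs => rw [← Y.counit_coact w]
    generalize Y.coact w = t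
    induction t with
    | zero => simp
    | add x y hx hy => simp only [map_add, hx, hy]
    | tmul h v => simp
  exact DFunLike.congr_fun hf x

theorem lTensor_act_mul (h : H) (s t : H ⊗[k] R) :
    LinearMap.lTensor H (S.act h) (s * t) =
      sweedler (Coalgebra.comul (R := k) h) fun a b =>
        LinearMap.lTensor H (S.act a) s * LinearMap.lTensor H (S.act b) t := by
  induction s with
  | zero => simp
  | add x y hx hy => simp only [map_add, add_mul, hx, hy, sweedler_add_fun]
  | tmul g x =>
    induction t with
    | zero => simp
    | add x y hx hy => simp only [map_add, mul_add, hx, hy, sweedler_add_fun]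
    | tmul g' y =>
      simp only [Algebra.TensorProduct.tmul_mul_tmul, LinearMap.lTensor_tmul, act_mul,
        sweedler_tmul_left]

theorem sweedler_coact_act_ι (h : H) (w : W) :
    sweedler (Coalgebra.comul (R := k) h) (fun a b => S.coact (S.act a (S.ι w)) * (b ⊗ₜ 1)) =
      sweedler (Coalgebra.comul (R := k) h) fun a b =>
        (a ⊗ₜ 1) * LinearMap.lTensor H (S.act b) (S.coact (S.ι w)) := by
  have h1 := congrArg (LinearMap.lTensor H S.ι) (Y.sweedler_coact_act h w)
  simp only [map_sweedler] at h1
  simp only [act_ι, coact_ι]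
  convert h1 using 1
  · congr 1; funext a b
    generalize Y.coact (Y.act a w) = t
    induction t with
    | zero => simp
    | add x y hx hy => simp only [map_add, add_mul, hx, hy]
    | tmul g m => simp
  · congr 1; funext a b
    generalize Y.coact w = t
    induction t with
    | zero => simp
    | add x y hx hy => simp only [map_add, mul_add, hx, hy]
    | tmul g m => simp [act_ι]

/-- The Yetter-Drinfeld compatibility `(h₁ x)₋₁ h₂ ⊗ (h₁ x)₀ = h₁ x₋₁ ⊗ h₂ x₀`. -/
theorem sweedler_coact_act (h : H) (x : R) :
    sweedler (Coalgebra.comul (R := k) h) (fun a b => S.coact (S.act a x) * (b ⊗ₜ 1)) =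
      sweedler (Coalgebra.comul (R := k) h) fun a b =>
        (a ⊗ₜ 1) * LinearMap.lTensor H (S.act b) (S.coact x) := by
  -- In this form without antipode the compatibility is multiplicative: given the instances for ι w
  -- and for x, coassociativity allows them to be applied one after the other to ι w * x.
  induction x using S.induction generalizing h with
  | one =>
    have h1 : IsLin k fun b : H => b ⊗ₜ[k] (1 : R) := by
      constructor <;> intros <;> simp [TensorProduct.add_tmul, TensorProduct.smul_tmul']
    simp only [act_one, map_smul, map_one, smul_mul_assoc, one_mul]
    rw [sweedler_comul_counit_left h h1]
    simp only [Algebra.TensorProduct.one_def, LinearMap.lTensor_tmul, act_one,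
      TensorProduct.tmul_smul, Algebra.TensorProduct.tmul_mul_tmul, mul_one, mul_smul_comm]
    rw [sweedler_comul_counit_right h h1]
  | add x y hx hy => simp only [map_add, add_mul, mul_add, sweedler_add_fun, hx, hy]
  | smul c x hx =>
    simp only [map_smul, smul_mul_assoc, mul_smul_comm, sweedler_smul_fun, hx]
  | ι_mul w x hx =>
    simp only [map_mul, act_mul, map_sweedler, sweedler_mul_right, mul_assoc]
    rw [sweedler_comul_coassoc h (f := fun a c b =>
      S.coact (S.act a (S.ι w)) * (S.coact (S.act c x) * (b ⊗ₜ[k] 1)))]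
    · simp only [← sweedler_mul_left, hx]
      simp only [sweedler_mul_left, ← mul_assoc]
      rw [← sweedler_comul_coassoc h (f := fun a c b =>
        S.coact (S.act a (S.ι w)) * (c ⊗ₜ[k] 1) * LinearMap.lTensor H (S.act b) (S.coact x))]
      · simp only [← sweedler_mul_right, S.sweedler_coact_act_ι]
        simp only [sweedler_mul_right, mul_assoc]
        rw [sweedler_comul_coassoc h (f := fun a c b =>
          (a ⊗ₜ[k] 1) * (LinearMap.lTensor H (S.act c) (S.coact (S.ι w)) *
            LinearMap.lTensor H (S.act b) (S.coact x)))]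
        · simp only [← sweedler_mul_left, lTensor_act_mul]
        · constructor <;> intros <;> simp [add_mul, mul_add, TensorProduct.add_tmul,
            ← TensorProduct.smul_tmul']
      · constructor <;> intros <;> simp [add_mul, mul_add, TensorProduct.add_tmul,
          ← TensorProduct.smul_tmul']
    · constructor <;> intros <;> simp [add_mul, mul_add, TensorProduct.add_tmul,
        ← TensorProduct.smul_tmul']

end BraidedQuotient
end YetterDrinfeld

/-! ### H-linearity and H-colinearity of the comultiplication -/

theorem isTrilin_mul {k A B C E : Type*} [Field k] [AddCommGroup A] [Module k A]
    [AddCommGroup B] [Module k B] [AddCommGroup C] [Module k C] [Ring E] [Algebra k E]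
    (f : A →ₗ[k] E) (g : B →ₗ[k] C →ₗ[k] E) : IsTrilin k fun a b c => f a * g b c := by
  constructor <;> intros <;> simp [add_mul, mul_add]

namespace YetterDrinfeld

variable {k : Type*} [Field k] {H : Type*} [Ring H] [HopfAlgebra k H]
variable {W : Type*} [AddCommGroup W] [Module k W]

namespace BraidedQuotient

variable {Y : YetterDrinfeld k H W} {R : Type*} [Ring R] [Algebra k R] (S : BraidedQuotient Y R)

/-- Left multiplication by `w ⊗ 1 + 1 ⊗ w` in the braided tensor product algebra `R ⊗ R`. -/
def primMul (w : W) : R ⊗[k] R →ₗ[k] R ⊗[k] R :=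
  LinearMap.rTensor R (LinearMap.mulLeft k (S.ι w)) +
    sweedler (Y.coact w) fun h v => TensorProduct.map (S.act h) (LinearMap.mulLeft k (S.ι v))

theorem primMul_apply (w : W) (t : R ⊗[k] R) :
    S.primMul w t = LinearMap.rTensor R (LinearMap.mulLeft k (S.ι w)) t +
      sweedler (Y.coact w) fun h v =>
        TensorProduct.map (S.act h) (LinearMap.mulLeft k (S.ι v)) t := by
  rw [primMul, LinearMap.add_apply]
  congr 1
  exact map_sweedler (LinearMap.applyₗ t : (R ⊗[k] R →ₗ[k] R ⊗[k] R) →ₗ[k] R ⊗[k] R) _ _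

theorem primMul_tmul (w : W) (a b : R) :
    S.primMul w (a ⊗ₜ b) = (S.ι w * a) ⊗ₜ b +
      sweedler (Y.coact w) fun h v => S.act h a ⊗ₜ[k] (S.ι v * b) := by
  simp [primMul_apply]

theorem comul_ι_mul_eq (w : W) (x : R) : S.comul (S.ι w * x) = S.primMul w (S.comul x) := by
  rw [comul_ι_mul, primMul_apply]

/-- The induction step for `comul_act`. The summand w a ⊗ b of `primMul` only needs multiplicativity
of the action. In (w₋₁ a) ⊗ w₀ b the action of h has to pass the coaction of w, which is the
Yetter-Drinfeld compatibility. -/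
theorem sweedler_primMul_act (h : H) (w : W) (t : R ⊗[k] R) :
    sweedler (Coalgebra.comul (R := k) h) (fun a b =>
      sweedler (Coalgebra.comul (R := k) b) fun c d =>
        S.primMul (Y.act a w) (TensorProduct.map (S.act c) (S.act d) t)) =
    sweedler (Coalgebra.comul (R := k) h) fun a b =>
      TensorProduct.map (S.act a) (S.act b) (S.primMul w t) := by
  induction t with
  | zero => simp
  | add x y hx hy => simp only [map_add, sweedler_add_fun, hx, hy]
  | tmul p q =>
    simp only [TensorProduct.map_tmul, primMul_tmul, map_add, sweedler_add_fun]
    congr 1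
    · rw [← sweedler_comul_coassoc h (f := fun a c d =>
        (S.ι (Y.act a w) * S.act c p) ⊗ₜ[k] S.act d q)]
      · simp only [act_mul, act_ι, sweedler_tmul_right]
      · constructor <;> intros <;> simp [add_mul, mul_add, TensorProduct.add_tmul,
          TensorProduct.tmul_add, ← TensorProduct.smul_tmul']
    · have hb : ∀ r : R, IsBilin k fun (c : H) (v : W) => S.act c p ⊗ₜ[k] (S.ι v * r) := by
        intro r
        constructor <;> intros <;> simp [add_mul, TensorProduct.add_tmul,
          TensorProduct.tmul_add, ← TensorProduct.smul_tmul']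
      rw [← sweedler_comul_coassoc h (f := fun a c d => sweedler (Y.coact (Y.act a w))
        fun e v => S.act e (S.act c p) ⊗ₜ[k] (S.ι v * S.act d q))]
      · simp only [act_act, fun x r => Y.sweedler_coact_act_apply x w (hb r)]
        rw [sweedler_comul_coassoc h (f := fun a c d => sweedler (Y.coact w)
          fun e v => S.act (a * e) p ⊗ₜ[k] (S.ι (Y.act c v) * S.act d q))]
        · simp only [map_sweedler, TensorProduct.map_tmul, act_act, act_mul, act_ι,
            sweedler_tmul_left]
          congr 1; funext a b
          exact sweedler_comm _ _ _
        · constructor <;> intros <;>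
            simp [add_mul, mul_add, TensorProduct.add_tmul,
              TensorProduct.tmul_add, ← TensorProduct.smul_tmul', sweedler_add_fun,
              sweedler_smul_fun]
      · have hb' : ∀ c d : H, IsBilin k fun (e : H) (v : W) =>
            S.act e (S.act c p) ⊗ₜ[k] (S.ι v * S.act d q) := by
          intro c d
          constructor <;> intros <;> simp [add_mul, TensorProduct.add_tmul,
            TensorProduct.tmul_add, ← TensorProduct.smul_tmul']
        constructor <;> intros <;>
          simp [mul_add, TensorProduct.add_tmul,
            TensorProduct.tmul_add, ← TensorProduct.smul_tmul', sweedler_add_fun,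
            sweedler_smul_fun, sweedler_add (hb' _ _), sweedler_smul (hb' _ _)]

/-- The comultiplication is `H`-linear. -/
theorem comul_act (h : H) (x : R) :
    S.comul (S.act h x) = sweedler (Coalgebra.comul (R := k) h) fun a b =>
      TensorProduct.map (S.act a) (S.act b) (S.comul x) := by
  induction x using S.induction generalizing h with
  | one =>
    simp only [act_one, map_smul, comul_one, TensorProduct.map_tmul, TensorProduct.tmul_smul]
    rw [sweedler_comul_counit_right h
      (f := fun a => (Coalgebra.counit (R := k) a • (1 : R)) ⊗ₜ[k] (1 : R)),
      TensorProduct.smul_tmul']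
    constructor <;> intros <;> simp [add_smul, TensorProduct.add_tmul, mul_smul,
      ← TensorProduct.smul_tmul']
  | add x y hx hy => simp only [map_add, sweedler_add_fun, hx, hy]
  | smul c x hx => simp only [map_smul, sweedler_smul_fun, hx]
  | ι_mul w x hx =>
    simp only [act_mul, map_sweedler, act_ι, comul_ι_mul_eq, hx, sweedler_primMul_act]

/-- The embedding of `H ⊗ R` in `H ⊗ (R ⊗ R)` through the left factor of `R ⊗ R`. -/
def inclLeft : H ⊗[k] R →ₐ[k] H ⊗[k] (R ⊗[k] R) :=
  Algebra.TensorProduct.map (AlgHom.id k H) Algebra.TensorProduct.includeLeft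

/-- The embedding of `H ⊗ R` in `H ⊗ (R ⊗ R)` through the right factor of `R ⊗ R`. -/
def inclRight : H ⊗[k] R →ₐ[k] H ⊗[k] (R ⊗[k] R) :=
  Algebra.TensorProduct.map (AlgHom.id k H) Algebra.TensorProduct.includeRight

@[simp] theorem inclLeft_tmul (h : H) (x : R) :
    (inclLeft (h ⊗ₜ[k] x) : H ⊗[k] (R ⊗[k] R)) = h ⊗ₜ (x ⊗ₜ 1) := rfl

@[simp] theorem inclRight_tmul (h : H) (x : R) :
    (inclRight (h ⊗ₜ[k] x) : H ⊗[k] (R ⊗[k] R)) = h ⊗ₜ (1 ⊗ₜ x) := rfl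

/-- The codiagonal coaction on `R ⊗ R`. -/
def coact₂ : R ⊗[k] R →ₗ[k] H ⊗[k] (R ⊗[k] R) :=
  TensorProduct.lift ((LinearMap.mul k (H ⊗[k] (R ⊗[k] R))).compl₁₂
    (inclLeft.toLinearMap ∘ₗ S.coact.toLinearMap) (inclRight.toLinearMap ∘ₗ S.coact.toLinearMap))

@[simp] theorem coact₂_tmul (x y : R) :
    S.coact₂ (x ⊗ₜ y) = inclLeft (S.coact x) * inclRight (S.coact y) := by
  simp [coact₂]

/-- The products are taken in the ordinary, unbraided algebra H ⊗ (R ⊗ R), where the codiagonal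
coaction of p ⊗ q is a product of two factors. In this language colinearity of `primMul` becomes a
computation with products. -/
theorem lTensor_primMul (w : W) (s t : H ⊗[k] R) :
    LinearMap.lTensor H (S.primMul w) (inclLeft s * inclRight t) =
      (1 ⊗ₜ (S.ι w ⊗ₜ 1)) * (inclLeft s * inclRight t) +
      sweedler (Y.coact w) fun e u => inclLeft (LinearMap.lTensor H (S.act e) s) *
        ((1 ⊗ₜ (1 ⊗ₜ S.ι u)) * inclRight t) := by
  induction s with
  | zero => simp
  | add x y hx hy =>
    simp only [map_add, add_mul, mul_add, sweedler_add_fun, hx, hy]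
    abel
  | tmul g p =>
    induction t with
    | zero => simp
    | add x y hx hy =>
      simp only [map_add, mul_add, sweedler_add_fun, hx, hy]
      abel
    | tmul g' q =>
      simp [primMul_tmul, TensorProduct.tmul_add, sweedler_tmul_left]

/-- The induction step for `coact₂_comul`. The essential term is (w₋₁ p) ⊗ w₀ q: coassociativity
splits the coefficient of w so that `sweedler_coact_act` applies to w₋₁ p. -/
theorem coact₂_primMul (w : W) (t : R ⊗[k] R) :
    S.coact₂ (S.primMul w t) = sweedler (Y.coact w) fun g v =>
      (g ⊗ₜ 1) * LinearMap.lTensor H (S.primMul v) (S.coact₂ t) := by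
  induction t with
  | zero => simp
  | add x y hx hy => simp only [map_add, mul_add, sweedler_add_fun, hx, hy]
  | tmul p q =>
    simp only [primMul_tmul, map_add, coact₂_tmul, lTensor_primMul, mul_add, sweedler_add_fun]
    congr 1
    · rw [map_mul, map_mul, coact_ι]
      conv_lhs => rw [← sweedler_tmul_self (Y.coact w)]
      simp only [map_sweedler, sweedler_mul_right, LinearMap.lTensor_tmul, inclLeft_tmul,
        ← mul_assoc, Algebra.TensorProduct.tmul_mul_tmul, mul_one, one_mul]
    · have h1 : ∀ v : W, inclRight (S.coact (S.ι v)) =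
          sweedler (Y.coact v) fun e u => e ⊗ₜ[k] ((1 : R) ⊗ₜ[k] S.ι u) := fun v => by
        rw [coact_ι]
        conv_lhs => rw [← sweedler_tmul_self (Y.coact v)]
        simp only [map_sweedler, LinearMap.lTensor_tmul, inclRight_tmul]
      simp only [map_sweedler, coact₂_tmul, map_mul, h1, sweedler_mul_left, sweedler_mul_right]
      rw [← Y.sweedler_coact_coassoc w (f := fun c e u => inclLeft (S.coact (S.act c p)) *
        (e ⊗ₜ[k] ((1 : R) ⊗ₜ[k] S.ι u) * inclRight (S.coact q)))]
      · have h2 : ∀ (e : H) (u : W), (e ⊗ₜ[k] ((1 : R) ⊗ₜ[k] S.ι u)) =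
            inclLeft (e ⊗ₜ[k] (1 : R)) * (1 ⊗ₜ[k] (1 ⊗ₜ[k] S.ι u)) := by simp
        have h3 : ∀ (c : H) (u : W), sweedler (Coalgebra.comul (R := k) c) (fun a b =>
            inclLeft (S.coact (S.act a p)) *
              (b ⊗ₜ[k] ((1 : R) ⊗ₜ[k] S.ι u) * inclRight (S.coact q))) =
            sweedler (Coalgebra.comul (R := k) c) fun a b =>
              (a ⊗ₜ 1) * (inclLeft (LinearMap.lTensor H (S.act b) (S.coact p)) *
                ((1 ⊗ₜ[k] (1 ⊗ₜ[k] S.ι u)) * inclRight (S.coact q))) := fun c u => by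
          have h4 : ∀ a b : H, inclLeft (S.coact (S.act a p)) *
              (b ⊗ₜ[k] ((1 : R) ⊗ₜ[k] S.ι u) * inclRight (S.coact q)) =
              inclLeft (S.coact (S.act a p) * (b ⊗ₜ[k] (1 : R))) *
                ((1 ⊗ₜ[k] (1 ⊗ₜ[k] S.ι u)) * inclRight (S.coact q)) := fun a b => by
            rw [h2 b u, map_mul, mul_assoc, mul_assoc]
          simp only [h4]
          rw [← sweedler_mul_right, ← map_sweedler, S.sweedler_coact_act, map_sweedler,
            sweedler_mul_right]
          simp only [map_mul, inclLeft_tmul, mul_assoc, Algebra.TensorProduct.one_def]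
        simp only [h3]
        rw [Y.sweedler_coact_coassoc w (f := fun a b u =>
          (a ⊗ₜ 1) * (inclLeft (LinearMap.lTensor H (S.act b) (S.coact p)) *
                ((1 ⊗ₜ[k] (1 ⊗ₜ[k] S.ι u)) * inclRight (S.coact q))))]
        exact isTrilin_mul (inclLeft.toLinearMap ∘ₗ (TensorProduct.mk k H R).flip 1)
          ((LinearMap.mul k (H ⊗[k] (R ⊗[k] R))).compl₁₂
            (inclLeft.toLinearMap ∘ₗ (LinearMap.lTensorHom H ∘ₗ S.act).flip (S.coact p))
            (LinearMap.mulRight k (inclRight (S.coact q)) ∘ₗ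
              TensorProduct.mk k H _ 1 ∘ₗ TensorProduct.mk k R R 1 ∘ₗ S.ι))
      · exact isTrilin_mul (inclLeft.toLinearMap ∘ₗ S.coact.toLinearMap ∘ₗ S.act.flip p)
          (((TensorProduct.mk k H _).compl₂ (TensorProduct.mk k R R 1 ∘ₗ S.ι)).compr₂
            (LinearMap.mulRight k (inclRight (S.coact q))))

/-- The comultiplication is `H`-colinear. -/
theorem coact₂_comul (x : R) :
    S.coact₂ (S.comul x) = LinearMap.lTensor H S.comul (S.coact x) := by
  induction x using S.induction with
  | one => simp [comul_one, Algebra.TensorProduct.one_def]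
  | add x y hx hy => simp only [map_add, hx, hy]
  | smul c x hx => simp only [map_smul, hx]
  | ι_mul w x hx =>
    rw [comul_ι_mul_eq, coact₂_primMul, hx, map_mul, coact_ι]
    conv_rhs => rw [← sweedler_tmul_self (Y.coact w)]
    simp only [map_sweedler, sweedler_mul_right, LinearMap.lTensor_tmul]
    congr 1; funext g v
    generalize S.coact x = t
    induction t with
    | zero => simp
    | add x y hx hy => simp only [map_add, mul_add, hx, hy]
    | tmul h y => simp [comul_ι_mul_eq]

end BraidedQuotient
end YetterDrinfeld

/-! ### The braided product on R ⊗ R and the braided adjoint action -/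

namespace YetterDrinfeld

variable {k : Type*} [Field k] {H : Type*} [Ring H] [HopfAlgebra k H]
variable {W : Type*} [AddCommGroup W] [Module k W]

namespace BraidedQuotient

variable {Y : YetterDrinfeld k H W} {R : Type*} [Ring R] [Algebra k R] (S : BraidedQuotient Y R)

/-- The map sending `h ⊗ y` to the operator `a ⊗ b ↦ h a ⊗ y b`. -/
def actMul : H ⊗[k] R →ₗ[k] Module.End k (R ⊗[k] R) :=
  TensorProduct.homTensorHomMap (RingHom.id k) _ _ _ _ ∘ₗ
    TensorProduct.map S.act (LinearMap.mul k R)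

/-- The multiplication of the braided tensor product algebra `R ⊗ R`:
`(x ⊗ y) (a ⊗ b) = x (y₋₁ a) ⊗ y₀ b`. -/
def braidedMul : R ⊗[k] R →ₗ[k] Module.End k (R ⊗[k] R) :=
  TensorProduct.lift ((LinearMap.mul k (Module.End k (R ⊗[k] R))).compl₁₂
    (LinearMap.rTensorHom R ∘ₗ LinearMap.mul k R) (S.actMul ∘ₗ S.coact.toLinearMap))

theorem actMul_tmul (c : H ⊗[k] R) (a b : R) :
    S.actMul c (a ⊗ₜ b) = sweedler c fun h z => S.act h a ⊗ₜ[k] (z * b) := by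
  conv_lhs => rw [← sweedler_tmul_self c]
  rw [map_sweedler]
  refine (map_sweedler (LinearMap.applyₗ (a ⊗ₜ[k] b) :
    (R ⊗[k] R →ₗ[k] R ⊗[k] R) →ₗ[k] R ⊗[k] R) _ _).trans ?_
  simp [actMul]

theorem braidedMul_tmul_apply (x y : R) (t : R ⊗[k] R) :
    S.braidedMul (x ⊗ₜ y) t =
      LinearMap.rTensor R (LinearMap.mulLeft k x) (S.actMul (S.coact y) t) := rfl

theorem braidedMul_tmul (x y a b : R) :
    S.braidedMul (x ⊗ₜ y) (a ⊗ₜ b) =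
      sweedler (S.coact y) fun h z => (x * S.act h a) ⊗ₜ[k] (z * b) := by
  rw [braidedMul_tmul_apply, actMul_tmul, map_sweedler]
  simp

theorem braidedMul_sweedler {A B : Type*} [AddCommGroup A] [Module k A] [AddCommGroup B]
    [Module k B] (c : A ⊗[k] B) (f : A → B → R ⊗[k] R) (t : R ⊗[k] R) :
    S.braidedMul (sweedler c f) t = sweedler c fun a b => S.braidedMul (f a b) t :=
  map_sweedler (S.braidedMul.flip t) c f

/-- This is the case of associativity of the braided product in which the first factor is w ⊗ 1 + 1
⊗ w. No other case is required for the induction in `comul_mul`. -/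
theorem primMul_braidedMul (w : W) (s t : R ⊗[k] R) :
    S.primMul w (S.braidedMul s t) = S.braidedMul (S.primMul w s) t := by
  induction s with
  | zero => simp
  | add x y hx hy => simp only [map_add, LinearMap.add_apply, hx, hy]
  | tmul x y =>
    induction t with
    | zero => simp
    | add a b ha hb => simp only [map_add, ha, hb]
    | tmul a b =>
      have hb : ∀ p : R, IsBilin k fun (h : H) (z : R) => (p * S.act h a) ⊗ₜ[k] (z * b) := by
        intro p
        constructor <;> intros <;> simp [add_mul, mul_add, TensorProduct.add_tmul,
          TensorProduct.tmul_add, ← TensorProduct.smul_tmul']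
      simp only [primMul_tmul, map_add, LinearMap.add_apply, braidedMul_sweedler]
      simp only [braidedMul_tmul, map_sweedler, primMul_tmul, sweedler_add_fun, map_mul,
        sweedler_mul (hb _), coact_ι]
      congr 1
      · simp only [mul_assoc]
      · simp only [act_mul, act_act, sweedler_tmul_right]
        rw [sweedler_comm]
        have h1 : ∀ (p : R) (t : H ⊗[k] W), (sweedler (LinearMap.lTensor H S.ι t) fun h z =>
              sweedler (S.coact y) fun c d => (p * S.act (h * c) a) ⊗ₜ[k] (z * d * b)) =
            sweedler t fun h z =>
              sweedler (S.coact y) fun c d => (p * S.act (h * c) a) ⊗ₜ[k] (S.ι z * (d * b)) := by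
          intro p t
          rw [sweedler_lTensor]
          · simp only [mul_assoc]
          · constructor <;> intros <;> simp [add_mul, mul_add, TensorProduct.add_tmul,
              TensorProduct.tmul_add, ← TensorProduct.smul_tmul', sweedler_add_fun,
              sweedler_smul_fun]
        simp only [h1]
        rw [← Y.sweedler_coact_coassoc w (f := fun c e u => sweedler (S.coact y) fun h z =>
          (S.act c x * S.act (e * h) a) ⊗ₜ[k] (S.ι u * (z * b)))]
        · congr 1; funext c v
          exact sweedler_comm _ _ _
        · constructor <;> intros <;> simp [add_mul, mul_add, TensorProduct.add_tmul,
            TensorProduct.tmul_add, ← TensorProduct.smul_tmul', sweedler_add_fun,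
            sweedler_smul_fun]

theorem actMul_one (t : R ⊗[k] R) : S.actMul 1 t = t := by
  rw [Algebra.TensorProduct.one_def]
  induction t with
  | zero => simp
  | add x y hx hy => simp only [map_add, hx, hy]
  | tmul a b => simp [actMul, act_one_apply]

/-- The comultiplication is multiplicative for the braided tensor product algebra. -/
theorem comul_mul (x y : R) : S.comul (x * y) = S.braidedMul (S.comul x) (S.comul y) := by
  induction x using S.induction with
  | one => simp [comul_one, braidedMul_tmul_apply, actMul_one]
  | add a b ha hb => simp only [map_add, add_mul, LinearMap.add_apply, ha, hb]
  | smul c a ha => simp only [map_smul, smul_mul_assoc, LinearMap.smul_apply, ha]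
  | ι_mul w x hx => rw [mul_assoc, comul_ι_mul_eq, hx, primMul_braidedMul, comul_ι_mul_eq]

theorem comul_ι (w : W) : S.comul (S.ι w) = S.ι w ⊗ₜ 1 + 1 ⊗ₜ S.ι w := by
  have h := S.comul_ι_mul w 1
  rw [mul_one] at h
  rw [h, comul_one]
  simp only [LinearMap.rTensor_tmul, LinearMap.mulLeft_apply, mul_one, TensorProduct.map_tmul,
    act_one, ← TensorProduct.smul_tmul']
  rw [sweedler_counit_left (Y.counit_coact w) (f := fun v => 1 ⊗ₜ[k] S.ι v)]
  constructor <;> intros <;> simp [TensorProduct.tmul_add]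

theorem braidedMul_one_tmul (t : R ⊗[k] R) (y : R) :
    S.braidedMul t (1 ⊗ₜ y) = LinearMap.lTensor R (LinearMap.mulRight k y) t := by
  induction t with
  | zero => simp
  | add a b ha hb => simp only [map_add, LinearMap.add_apply, ha, hb]
  | tmul a b =>
    rw [braidedMul_tmul]
    simp only [act_one, mul_smul_comm, mul_one, ← TensorProduct.smul_tmul',
      LinearMap.lTensor_tmul, LinearMap.mulRight_apply]
    have h := S.counit_coact b
    rw [← AlgHom.toLinearMap_apply] at h ⊢
    rw [sweedler_counit_left h (f := fun v => a ⊗ₜ[k] (v * y))]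
    constructor <;> intros <;> simp [add_mul, TensorProduct.tmul_add]

/-- The braided adjoint action of `w ∈ W` on `R`: `w b - (w₋₁ b) w₀`. -/
def ad (w : W) : Module.End k R :=
  LinearMap.mulLeft k (S.ι w) -
    TensorProduct.lift
      ((LinearMap.llcomp k R R R).flip.compl₁₂ S.act ((LinearMap.mul k R).flip ∘ₗ S.ι))
      (Y.coact w)

theorem ad_apply (w : W) (b : R) :
    S.ad w b = S.ι w * b - sweedler (Y.coact w) fun h v => S.act h b * S.ι v := by
  rw [ad, LinearMap.sub_apply]
  congr 1
  conv_lhs => rw [← sweedler_tmul_self (Y.coact w)]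
  rw [map_sweedler]
  exact map_sweedler (LinearMap.applyₗ b : (R →ₗ[k] R) →ₗ[k] R) _ _

/-- The adjoint action is a linear function of the acting element. -/
def adHom : W →ₗ[k] Module.End k R :=
  LinearMap.mul k R ∘ₗ S.ι - TensorProduct.lift
      ((LinearMap.llcomp k R R R).flip.compl₁₂ S.act ((LinearMap.mul k R).flip ∘ₗ S.ι)) ∘ₗ Y.coact

theorem ad_add (v w : W) : S.ad (v + w) = S.ad v + S.ad w := S.adHom.map_add v w

theorem ad_smul (c : k) (w : W) : S.ad (c • w) = c • S.ad w := S.adHom.map_smul c w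

/-- Together with `coact_ad` this says that w ⊗ x ↦ ad_c w (x) is a morphism of Yetter-Drinfeld
modules. It is the multiplication composed with the identity minus the braiding, and the braiding is
a morphism by the Yetter-Drinfeld compatibility. -/
theorem act_ad (h : H) (w : W) (x : R) :
    S.act h (S.ad w x) = sweedler (Coalgebra.comul (R := k) h) fun a b =>
      S.ad (Y.act a w) (S.act b x) := by
  simp only [ad_apply, map_sub, map_sweedler, act_mul, act_ι, sweedler_sub_fun]
  congr 1
  have hb : IsBilin k fun (c : H) (v : W) => S.act c x * S.ι v := by
    constructor <;> intros <;> simp [add_mul, mul_add]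
  simp only [act_act]
  rw [Y.sweedler_coact_act_apply h w hb, sweedler_comm]

theorem coact_ad (w : W) (x : R) :
    S.coact (S.ad w x) = sweedler (Y.coact w) fun g v =>
      (g ⊗ₜ 1) * LinearMap.lTensor H (S.ad v) (S.coact x) := by
  have h0 : ∀ w : W, S.coact (S.ι w) = sweedler (Y.coact w) fun g v => g ⊗ₜ[k] S.ι v := by
    intro w
    rw [coact_ι]
    conv_lhs => rw [← sweedler_tmul_self (Y.coact w)]
    rw [map_sweedler]
    simp
  have h1 : ∀ (v : W) (t : H ⊗[k] R), LinearMap.lTensor H (S.ad v) t =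
      (1 ⊗ₜ S.ι v) * t - sweedler (Y.coact v) fun e u =>
        LinearMap.lTensor H (S.act e) t * (1 ⊗ₜ S.ι u) := by
    intro v t
    induction t with
    | zero => simp
    | add a b ha hb =>
      simp only [map_add, mul_add, add_mul, sweedler_add_fun, ha, hb]
      abel
    | tmul g y => simp [ad_apply, TensorProduct.tmul_sub, sweedler_tmul_left]
  simp only [h1, mul_sub, sweedler_sub_fun, ad_apply, map_sub, map_mul, map_sweedler, h0]
  congr 1
  · rw [sweedler_mul_right]
    simp [← mul_assoc]
  · simp only [sweedler_mul_left]
    rw [← Y.sweedler_coact_coassoc w (f := fun c e u =>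
      S.coact (S.act c x) * (e ⊗ₜ[k] S.ι u))]
    · have h2 : ∀ (c : H) (v : W), sweedler (Coalgebra.comul (R := k) c) (fun a b =>
          S.coact (S.act a x) * (b ⊗ₜ[k] S.ι v)) =
          sweedler (Coalgebra.comul (R := k) c) fun a b =>
            (a ⊗ₜ 1) * (LinearMap.lTensor H (S.act b) (S.coact x) * (1 ⊗ₜ S.ι v)) := by
        intro c v
        have h3 : ∀ a b : H, S.coact (S.act a x) * (b ⊗ₜ[k] S.ι v) =
            S.coact (S.act a x) * (b ⊗ₜ[k] (1 : R)) * (1 ⊗ₜ S.ι v) := fun a b => by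
          rw [mul_assoc, Algebra.TensorProduct.tmul_mul_tmul, mul_one, one_mul]
        simp only [h3]
        simp only [← mul_assoc, ← sweedler_mul_right, sweedler_coact_act]
      simp only [h2]
      rw [Y.sweedler_coact_coassoc w (f := fun a b v =>
        (a ⊗ₜ 1) * (LinearMap.lTensor H (S.act b) (S.coact x) * (1 ⊗ₜ S.ι v)))]
      constructor <;> intros <;> simp [add_mul, mul_add, TensorProduct.add_tmul,
        TensorProduct.tmul_add, ← TensorProduct.smul_tmul']
    · constructor <;> intros <;> simp [mul_add, add_mul, TensorProduct.add_tmul,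
        TensorProduct.tmul_add, ← TensorProduct.smul_tmul']

/-- The comultiplication of `ad w x`. -/
theorem comul_ad (w : W) (x : R) :
    S.comul (S.ad w x) = LinearMap.rTensor R (LinearMap.mulLeft k (S.ι w)) (S.comul x) +
      sweedler (Y.coact w) (fun h v => TensorProduct.map (S.act h) (S.ad v) (S.comul x)) -
      sweedler (Y.coact w) fun h v => sweedler (Coalgebra.comul (R := k) h) fun a b =>
        S.braidedMul (TensorProduct.map (S.act a) (S.act b) (S.comul x)) (S.ι v ⊗ₜ 1) := by
  -- In the subtracted term of ad_c w (x), the factor w₀ contributes Δ(w₀) = w₀ ⊗ 1 + 1 ⊗ w₀. The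
  -- part with 1 ⊗ w₀ combines with a term of Δ(w)Δ(x) to ad_c in the second factor; the part with
  -- w₀ ⊗ 1 survives as the last term of the formula.
  have h1 : ∀ t : R ⊗[k] R, sweedler (Y.coact w)
      (fun h v => TensorProduct.map (S.act h) (S.ad v) t) =
      sweedler (Y.coact w)
        (fun h v => TensorProduct.map (S.act h) (LinearMap.mulLeft k (S.ι v)) t) -
      sweedler (Y.coact w) fun h v => sweedler (Coalgebra.comul (R := k) h) fun a b =>
        LinearMap.lTensor R (LinearMap.mulRight k (S.ι v))
          (TensorProduct.map (S.act a) (S.act b) t) := by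
    intro t
    induction t with
    | zero => simp
    | add a b ha hb =>
      simp only [map_add, sweedler_add_fun, ha, hb]
      abel
    | tmul p q =>
      simp only [TensorProduct.map_tmul, ad_apply, TensorProduct.tmul_sub, sweedler_sub_fun,
        sweedler_tmul_left, LinearMap.mulLeft_apply, LinearMap.lTensor_tmul,
        LinearMap.mulRight_apply]
      congr 1
      rw [Y.sweedler_coact_coassoc w (f := fun a b v =>
        S.act a p ⊗ₜ[k] (S.act b q * S.ι v))]
      constructor <;> intros <;> simp [add_mul, mul_add, TensorProduct.add_tmul,
        TensorProduct.tmul_add, ← TensorProduct.smul_tmul']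
  rw [h1, ad_apply, map_sub, comul_ι_mul, map_sweedler]
  simp only [comul_mul, comul_ι, comul_act, braidedMul_sweedler, map_add, braidedMul_one_tmul,
    sweedler_add_fun]
  simp only [map_sweedler]
  abel

end BraidedQuotient
end YetterDrinfeld

/-! ### T(W) and B(W) as braided quotients -/

namespace YetterDrinfeld

variable {k : Type*} [Field k] {H : Type*} [Ring H] [HopfAlgebra k H]
variable {W : Type*} [AddCommGroup W] [Module k W] (Y : YetterDrinfeld k H W)

theorem tensorComul_ι_mul (w : W) (x : TensorAlgebra k W) :
    Y.tensorComul (TensorAlgebra.ι k w * x) =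
      LinearMap.rTensor _ (LinearMap.mulLeft k (TensorAlgebra.ι k w)) (Y.tensorComul x) +
        sweedler (Y.coact w) fun h v =>
          TensorProduct.map (Y.tensorAct h) (LinearMap.mulLeft k (TensorAlgebra.ι k v))
            (Y.tensorComul x) := by
  have h1 : Y.tensorComul (TensorAlgebra.ι k w * x) =
      Y.comulOp (TensorAlgebra.ι k w) (Y.tensorComul x) := by
    simp [tensorComul]
  rw [h1]
  generalize Y.tensorComul x = t
  induction t with
  | zero => simp
  | add a b ha hb => simp only [map_add, sweedler_add_fun, ha, hb]; abel
  | tmul a b =>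
    rw [comulOp_ι_tmul]
    congr 1
    conv_lhs => rw [← sweedler_tmul_self (Y.coact w)]
    rw [map_sweedler]
    rfl

/-- The tensor algebra `T(W)`. -/
def tensorQuotient : BraidedQuotient Y (TensorAlgebra k W) where
  ι := TensorAlgebra.ι k
  act := Y.tensorAct
  coact := Y.tensorCoact
  comul := Y.tensorComul
  adjoin_range_ι := TensorAlgebra.adjoin_range_ι
  act_ι := tensorAct_ι
  act_one h := by rw [tensorAct_one, Algebra.algebraMap_eq_smul_one]
  act_mul h x y := by
    rw [tensorAct_mul]
    conv_lhs => rw [← sweedler_tmul_self (Coalgebra.comul (R := k) h)]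
    simp only [map_sweedler]
    rfl
  coact_ι w := by simp [tensorCoact]
  comul_one := by simp [tensorComul]
  comul_ι_mul := Y.tensorComul_ι_mul

theorem nicholsMk_surjective : Function.Surjective Y.nicholsMk :=
  Ideal.Quotient.mk_surjective

@[simp]
theorem nicholsAct_mk (h : H) (x : TensorAlgebra k W) :
    Y.nicholsAct h (Y.nicholsMk x) = Y.nicholsMk (Y.tensorAct h x) := rfl

@[simp]
theorem nicholsCoact_mk (x : TensorAlgebra k W) :
    Y.nicholsCoact (Y.nicholsMk x) =
      LinearMap.lTensor H Y.nicholsMk.toLinearMap (Y.tensorCoact x) := rfl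

@[simp]
theorem nicholsComul_mk (x : TensorAlgebra k W) :
    Y.nicholsComul (Y.nicholsMk x) =
      TensorProduct.map Y.nicholsMk.toLinearMap Y.nicholsMk.toLinearMap (Y.tensorComul x) := rfl

theorem adjoin_range_nicholsIncl : Algebra.adjoin k (Set.range Y.nicholsIncl) = ⊤ := by
  have h : Set.range Y.nicholsIncl = Y.nicholsMk '' Set.range (TensorAlgebra.ι k) := by
    rw [← Set.range_comp]; rfl
  rw [h, ← AlgHom.map_adjoin, TensorAlgebra.adjoin_range_ι, Algebra.map_top,
    AlgHom.range_eq_top]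
  exact Y.nicholsMk_surjective

/-- The coaction on `B(W)`, as an algebra map. -/
def nicholsCoactHom : Y.NicholsAlgebra →ₐ[k] H ⊗[k] Y.NicholsAlgebra :=
  AlgHom.ofLinearMap Y.nicholsCoact
    (by
      rw [← map_one Y.nicholsMk, nicholsCoact_mk, map_one, Algebra.TensorProduct.one_def]
      simp [Algebra.TensorProduct.one_def])
    (by
      intro x y
      obtain ⟨x, rfl⟩ := Y.nicholsMk_surjective x
      obtain ⟨y, rfl⟩ := Y.nicholsMk_surjective y
      rw [← map_mul, nicholsCoact_mk, nicholsCoact_mk, nicholsCoact_mk, map_mul]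
      exact map_mul (Algebra.TensorProduct.map (AlgHom.id k H) Y.nicholsMk) _ _)

/-- The Nichols algebra `B(W)`. -/
def nicholsQuotient : BraidedQuotient Y Y.NicholsAlgebra where
  ι := Y.nicholsIncl
  act := Y.nicholsAct
  coact := Y.nicholsCoactHom
  comul := Y.nicholsComul
  adjoin_range_ι := Y.adjoin_range_nicholsIncl
  act_ι h w := by
    change Y.nicholsMk (Y.tensorAct h (TensorAlgebra.ι k w)) = _
    rw [tensorAct_ι]; rfl
  act_one h := by
    rw [← map_one Y.nicholsMk, nicholsAct_mk, tensorAct_one, Algebra.algebraMap_eq_smul_one,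
      map_smul]
  act_mul h x y := by
    obtain ⟨x, rfl⟩ := Y.nicholsMk_surjective x
    obtain ⟨y, rfl⟩ := Y.nicholsMk_surjective y
    rw [← map_mul, nicholsAct_mk]
    refine (congrArg Y.nicholsMk (Y.tensorQuotient.act_mul h x y)).trans ?_
    simp only [map_sweedler, map_mul]
    rfl
  coact_ι w := by
    change LinearMap.lTensor H Y.nicholsMk.toLinearMap (Y.tensorCoact (TensorAlgebra.ι k w)) = _
    have h : Y.tensorCoact (TensorAlgebra.ι k w) =
      LinearMap.lTensor H (TensorAlgebra.ι k) (Y.coact w) := Y.tensorQuotient.coact_ι w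
    rw [h, ← LinearMap.comp_apply, ← LinearMap.lTensor_comp]
    rfl
  comul_one := by
    have h : Y.tensorComul 1 = 1 ⊗ₜ 1 := Y.tensorQuotient.comul_one
    rw [← map_one Y.nicholsMk, nicholsComul_mk, h]
    rfl
  comul_ι_mul w x := by
    obtain ⟨x, rfl⟩ := Y.nicholsMk_surjective x
    change Y.nicholsComul (Y.nicholsMk (TensorAlgebra.ι k w * x)) = _
    rw [nicholsComul_mk, nicholsComul_mk, tensorComul_ι_mul, map_add, map_sweedler]
    generalize Y.tensorComul x = t
    congr 1
    · induction t with
      | zero => simp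
      | add a b ha hb => simp only [map_add, ha, hb]
      | tmul a b => simp [nicholsIncl]
    · congr 1; funext h v
      induction t with
      | zero => simp
      | add a b ha hb => simp only [map_add, ha, hb]
      | tmul a b => simp [nicholsIncl]; rfl

end YetterDrinfeld

/-! ### Subspaces of the form I ⊗ B + A ⊗ J -/

section TensorSup

variable {k : Type*} [Field k] {A B C D P : Type*} [AddCommGroup A] [Module k A]
  [AddCommGroup B] [Module k B] [AddCommGroup C] [Module k C] [AddCommGroup D] [Module k D]
  [AddCommGroup P] [Module k P]

/-- The subspace `I ⊗ B + A ⊗ J` of `A ⊗ B`. -/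
def tensorSup (I : Submodule k A) (J : Submodule k B) : Submodule k (A ⊗[k] B) :=
  LinearMap.range (LinearMap.rTensor B I.subtype) ⊔
    LinearMap.range (LinearMap.lTensor A J.subtype)

theorem tmul_mem_tensorSup_left {I : Submodule k A} (J : Submodule k B) {a : A} (ha : a ∈ I)
    (b : B) : a ⊗ₜ b ∈ tensorSup I J :=
  Submodule.mem_sup_left ⟨⟨a, ha⟩ ⊗ₜ b, rfl⟩

theorem tmul_mem_tensorSup_right (I : Submodule k A) {J : Submodule k B} (a : A) {b : B}
    (hb : b ∈ J) : a ⊗ₜ b ∈ tensorSup I J :=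
  Submodule.mem_sup_right ⟨a ⊗ₜ ⟨b, hb⟩, rfl⟩

theorem tensorSup_le {I : Submodule k A} {J : Submodule k B} {Q : Submodule k (A ⊗[k] B)}
    (h1 : ∀ a ∈ I, ∀ b, a ⊗ₜ b ∈ Q) (h2 : ∀ a, ∀ b ∈ J, a ⊗ₜ b ∈ Q) : tensorSup I J ≤ Q := by
  refine sup_le ?_ ?_
  · rintro _ ⟨s, rfl⟩
    induction s with
    | zero => simp
    | add x y hx hy => rw [map_add]; exact Q.add_mem hx hy
    | tmul a b => exact h1 a a.2 b
  · rintro _ ⟨s, rfl⟩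
    induction s with
    | zero => simp
    | add x y hx hy => rw [map_add]; exact Q.add_mem hx hy
    | tmul a b => exact h2 a b b.2

theorem tensorSup_mono {I I' : Submodule k A} {J J' : Submodule k B} (hI : I ≤ I') (hJ : J ≤ J') :
    tensorSup I J ≤ tensorSup I' J' :=
  tensorSup_le (fun _ ha b => tmul_mem_tensorSup_left J' (hI ha) b)
    fun a _ hb => tmul_mem_tensorSup_right I' a (hJ hb)

theorem map_mem_tensorSup {I : Submodule k A} {J : Submodule k B} {Q : Submodule k P}
    (φ : A ⊗[k] B →ₗ[k] P) (h1 : ∀ a ∈ I, ∀ b, φ (a ⊗ₜ b) ∈ Q)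
    (h2 : ∀ a, ∀ b ∈ J, φ (a ⊗ₜ b) ∈ Q) {t : A ⊗[k] B} (ht : t ∈ tensorSup I J) : φ t ∈ Q :=
  tensorSup_le (Q := Q.comap φ) h1 h2 ht

/-- Right exactness of the tensor product in both variables. It allows coideal conditions to be
tested after passing to quotients. -/
theorem ker_map_eq_tensorSup {f : A →ₗ[k] C} {g : B →ₗ[k] D} (hf : Function.Surjective f)
    (hg : Function.Surjective g) :
    LinearMap.ker (TensorProduct.map f g) = tensorSup (LinearMap.ker f) (LinearMap.ker g) := by
  rw [tensorSup, sup_comm]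
  exact TensorProduct.map_ker (LinearMap.exact_subtype_ker_map f) hf
    (LinearMap.exact_subtype_ker_map g) hg

end TensorSup

namespace YetterDrinfeld

variable {k : Type*} [Field k] {H : Type*} [Ring H] [HopfAlgebra k H]
variable {W : Type*} [AddCommGroup W] [Module k W]

namespace BraidedQuotient

variable {Y : YetterDrinfeld k H W} {R : Type*} [Ring R] [Algebra k R] (S : BraidedQuotient Y R)

theorem isYDSubmodule_inf {M : Type*} [AddCommGroup M] [Module k M]
    {act : H →ₗ[k] M →ₗ[k] M} {coact : M →ₗ[k] H ⊗[k] M} {N N' : Submodule k M}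
    (h : IsYDSubmodule act coact N) (h' : IsYDSubmodule act coact N') :
    IsYDSubmodule act coact (N ⊓ N') :=
  ⟨fun g x hx => ⟨h.act_mem g x hx.1, h'.act_mem g x hx.2⟩, fun x hx =>
    mem_range_lTensor_iff.2 fun f => ⟨mem_range_lTensor_iff.1 (h.coact_mem x hx.1) f,
      mem_range_lTensor_iff.1 (h'.coact_mem x hx.2) f⟩⟩

theorem isYDSubmodule_sup {M : Type*} [AddCommGroup M] [Module k M]
    {act : H →ₗ[k] M →ₗ[k] M} {coact : M →ₗ[k] H ⊗[k] M} {N N' : Submodule k M}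
    (h : IsYDSubmodule act coact N) (h' : IsYDSubmodule act coact N') :
    IsYDSubmodule act coact (N ⊔ N') := by
  refine ⟨fun g x hx => ?_, fun x hx => ?_⟩
  · obtain ⟨a, ha, b, hb, rfl⟩ := Submodule.mem_sup.1 hx
    rw [map_add]
    exact add_mem (Submodule.mem_sup_left (h.act_mem g a ha))
      (Submodule.mem_sup_right (h'.act_mem g b hb))
  · obtain ⟨a, ha, b, hb, rfl⟩ := Submodule.mem_sup.1 hx
    rw [map_add]
    exact add_mem (range_lTensor_mono le_sup_left (h.coact_mem a ha))
      (range_lTensor_mono le_sup_right (h'.coact_mem b hb))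

/-! ### Gradings -/

/-- A family of projections of `R` onto homogeneous components, for a grading of `R` in which
`W` has degree one. -/
structure IsGrading (p : ℕ → R →ₗ[k] R) : Prop where
  zero_one : p 0 1 = 1
  succ_one : ∀ n, p (n + 1) 1 = 0
  zero_ι_mul : ∀ w x, p 0 (S.ι w * x) = 0
  succ_ι_mul : ∀ n w x, p (n + 1) (S.ι w * x) = S.ι w * p n x

namespace IsGrading

variable {S} {p : ℕ → R →ₗ[k] R} (hp : S.IsGrading p)
include hp

/-- The rules of `IsGrading` prescribe the projections only on 1 and on products ι w * x. That every
element is the finite sum of its components, and that p n projects onto the n-th power of W, is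
recovered here and below by induction. -/
theorem exists_eq_sum (x : R) : ∃ N, (∀ n ≥ N, p n x = 0) ∧ x = ∑ n ∈ Finset.range N, p n x := by
  induction x using S.induction with
  | one =>
    refine ⟨1, fun n hn => ?_, by simp [hp.zero_one]⟩
    obtain ⟨m, rfl⟩ := Nat.exists_eq_add_of_le' hn
    exact hp.succ_one m
  | ι_mul w x hx =>
    obtain ⟨N, hN, hs⟩ := hx
    refine ⟨N + 1, fun n hn => ?_, ?_⟩
    · obtain ⟨m, rfl⟩ := Nat.exists_eq_add_of_le' (Nat.le_of_add_left_le hn : 1 ≤ n)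
      rw [hp.succ_ι_mul, hN m (by omega), mul_zero]
    · rw [Finset.sum_range_succ', hp.zero_ι_mul, add_zero]
      simp only [hp.succ_ι_mul]
      rw [← Finset.mul_sum, ← hs]
  | add x y hx hy =>
    obtain ⟨N, hN, hs⟩ := hx
    obtain ⟨N', hN', hs'⟩ := hy
    refine ⟨max N N', fun n hn => ?_, ?_⟩
    · rw [map_add, hN n (le_of_max_le_left hn), hN' n (le_of_max_le_right hn), add_zero]
    · have h1 : x = ∑ n ∈ Finset.range (max N N'), p n x := by
        refine hs.trans (Finset.sum_subset (by simp) fun n _ hn => hN n (by simpa using hn))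
      have h2 : y = ∑ n ∈ Finset.range (max N N'), p n y := by
        refine hs'.trans (Finset.sum_subset (by simp) fun n _ hn => hN' n (by simpa using hn))
      simp only [map_add, Finset.sum_add_distrib]
      rw [← h1, ← h2]
  | smul c x hx =>
    obtain ⟨N, hN, hs⟩ := hx
    refine ⟨N, fun n hn => by rw [map_smul, hN n hn, smul_zero], ?_⟩
    simp only [map_smul]
    rw [← Finset.smul_sum, ← hs]

theorem eq_of_forall_ne {x : R} (n : ℕ) (h : ∀ m ≠ n, p m x = 0) : x = p n x := by
  obtain ⟨N, hN, hs⟩ := hp.exists_eq_sum x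
  conv_lhs => rw [hs]
  refine Finset.sum_eq_single n (fun m _ hm => h m hm) fun hn => hN n (by simpa using hn)

theorem eq_zero_of_forall {x : R} (h : ∀ m, p m x = 0) : x = 0 := by
  rw [hp.eq_of_forall_ne 0 fun m _ => h m, h]

theorem proj_mem (n : ℕ) (x : R) : p n x ∈ LinearMap.range S.ι ^ n := by
  induction x using S.induction generalizing n with
  | one =>
    cases n with
    | zero => rw [hp.zero_one, pow_zero]; exact Submodule.one_le.1 le_rfl
    | succ n => rw [hp.succ_one]; exact zero_mem _
  | ι_mul w x hx =>
    cases n with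
    | zero => rw [hp.zero_ι_mul]; exact zero_mem _
    | succ n =>
      rw [hp.succ_ι_mul, pow_succ']
      exact Submodule.mul_mem_mul ⟨w, rfl⟩ (hx n)
  | add x y hx hy => rw [map_add]; exact add_mem (hx n) (hy n)
  | smul c x hx => rw [map_smul]; exact Submodule.smul_mem _ c (hx n)

theorem mem_pow_induction {q : ℕ → R → Prop} (one : q 0 1)
    (ι_mul : ∀ n w x, x ∈ LinearMap.range S.ι ^ n → q n x → q (n + 1) (S.ι w * x))
    (add : ∀ n x y, q n x → q n y → q n (x + y)) (smul : ∀ n (c : k) x, q n x → q n (c • x))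
    {n : ℕ} {x : R} (hx : x ∈ LinearMap.range S.ι ^ n) : q n x := by
  induction n generalizing x with
  | zero =>
    rw [pow_zero] at hx
    obtain ⟨c, rfl⟩ := Submodule.mem_one.1 hx
    rw [Algebra.algebraMap_eq_smul_one]
    exact smul 0 c 1 one
  | succ n ih =>
    rw [pow_succ'] at hx
    refine Submodule.mul_induction_on hx ?_ (add (n + 1))
    rintro _ ⟨w, rfl⟩ y hy
    exact ι_mul n w y hy (ih hy)

theorem proj_of_mem {n : ℕ} {x : R} (hx : x ∈ LinearMap.range S.ι ^ n) (m : ℕ) :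
    p m x = if m = n then x else 0 := by
  revert m
  refine hp.mem_pow_induction (q := fun n x => ∀ m, p m x = if m = n then x else 0)
    ?_ ?_ ?_ ?_ hx
  · rintro (_ | m)
    · simp [hp.zero_one]
    · simp [hp.succ_one]
  · rintro n w x - h (_ | m)
    · simp [hp.zero_ι_mul]
    · simp [hp.succ_ι_mul, h, mul_ite]
  · intro n x y hx hy m
    rw [map_add, hx, hy]; split_ifs <;> simp
  · intro n c x hx m
    rw [map_smul, hx]; split_ifs <;> simp

theorem mem_iff {n : ℕ} {x : R} : x ∈ LinearMap.range S.ι ^ n ↔ p n x = x :=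
  ⟨fun h => by rw [hp.proj_of_mem h, if_pos rfl], fun h => h ▸ hp.proj_mem n x⟩

theorem proj_act (n : ℕ) (h : H) (x : R) : p n (S.act h x) = S.act h (p n x) := by
  induction x using S.induction generalizing n h with
  | one =>
    cases n with
    | zero => simp [act_one, hp.zero_one]
    | succ n => simp [act_one, hp.succ_one]
  | ι_mul w x hx =>
    cases n with
    | zero => simp [act_mul, map_sweedler, act_ι, hp.zero_ι_mul]
    | succ n => simp [act_mul, map_sweedler, act_ι, hp.succ_ι_mul, hx]
  | add x y hx hy => simp only [map_add, hx, hy]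
  | smul c x hx => simp only [map_smul, hx]

theorem coact_proj (n : ℕ) (x : R) :
    S.coact (p n x) = LinearMap.lTensor H (p n) (S.coact x) := by
  induction x using S.induction generalizing n with
  | one =>
    cases n with
    | zero => simp [hp.zero_one, Algebra.TensorProduct.one_def]
    | succ n => simp [hp.succ_one, Algebra.TensorProduct.one_def]
  | ι_mul w x hx =>
    have h0 : ∀ t : H ⊗[k] R, LinearMap.lTensor H (p n) (S.coact (S.ι w) * t) =
        match n with
        | 0 => 0
        | m + 1 => S.coact (S.ι w) * LinearMap.lTensor H (p m) t := by
      intro t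
      rw [coact_ι]
      generalize Y.coact w = s
      induction s with
      | zero => cases n <;> simp
      | add a b ha hb =>
        rw [map_add, add_mul, map_add, ha, hb]
        cases n
        · simp
        · simp [add_mul]
      | tmul g v =>
        induction t with
        | zero => cases n <;> simp
        | add a b ha hb =>
          rw [mul_add, map_add, ha, hb]
          cases n
          · simp
          · simp [mul_add]
        | tmul g' y =>
          cases n
          · simp [hp.zero_ι_mul]
          · simp [hp.succ_ι_mul]
    rw [map_mul S.coact, h0]
    cases n with
    | zero => simp [hp.zero_ι_mul]
    | succ n => simp [hp.succ_ι_mul, hx]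
  | add x y hx hy => simp only [map_add, hx, hy]
  | smul c x hx => simp only [map_smul, hx]

/-- The homogeneous components are Yetter-Drinfeld submodules. -/
theorem isYDSubmodule_pow (n : ℕ) :
    IsYDSubmodule S.act S.coact.toLinearMap (LinearMap.range S.ι ^ n) where
  act_mem h x hx := by
    rw [hp.mem_iff, hp.proj_act, hp.mem_iff.1 hx]
  coact_mem x hx := mem_range_lTensor_iff.2 fun f => by
    rw [hp.mem_iff, ← slice_lTensor, AlgHom.toLinearMap_apply, ← hp.coact_proj, hp.mem_iff.1 hx]

/-- Δ preserves the total degree because each summand of `primMul` raises exactly one of the two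
degrees by one. Accordingly the antidiagonal of n + 1 loses the pair with first entry 0 for one
summand and the pair with second entry 0 for the other. -/
theorem comul_proj (n : ℕ) (x : R) :
    S.comul (p n x) =
      ∑ ij ∈ Finset.HasAntidiagonal.antidiagonal n, TensorProduct.map (p ij.1) (p ij.2) (S.comul x) := by
  induction x using S.induction generalizing n with
  | one =>
    cases n with
    | zero => simp [hp.zero_one, comul_one]
    | succ n =>
      rw [hp.succ_one, map_zero, comul_one]
      refine (Finset.sum_eq_zero fun ij hij => ?_).symm
      rw [Finset.HasAntidiagonal.mem_antidiagonal] at hij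
      obtain ⟨i, j⟩ := ij
      rcases i with _ | i
      · rcases j with _ | j
        · simp at hij
        · simp [hp.succ_one]
      · simp [hp.succ_one]
  | ι_mul w x hx =>
    rw [comul_ι_mul_eq]
    generalize ht : S.comul x = t at hx
    cases n with
    | zero =>
      rw [hp.zero_ι_mul, map_zero]
      simp only [Finset.Nat.antidiagonal_zero, Finset.sum_singleton]
      clear ht hx
      induction t with
      | zero => simp
      | add a b ha hb => rw [map_add, map_add, ← ha, ← hb, add_zero]
      | tmul a b => simp [primMul_tmul, map_sweedler, hp.zero_ι_mul]
    | succ n =>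
      rw [hp.succ_ι_mul, comul_ι_mul_eq, hx, map_sum]
      clear ht hx
      induction t with
      | zero => simp
      | add a b ha hb => simp only [map_add, Finset.sum_add_distrib, ha, hb]
      | tmul a b =>
        simp only [TensorProduct.map_tmul, primMul_tmul, map_add, map_sweedler,
          Finset.sum_add_distrib]
        congr 1
        · rw [Finset.Nat.antidiagonal_succ]
          simp [hp.zero_ι_mul, hp.succ_ι_mul]
        · rw [Finset.Nat.antidiagonal_succ']
          simp only [Finset.sum_cons, Finset.sum_map, hp.zero_ι_mul, TensorProduct.tmul_zero,
            sweedler_zero_fun, zero_add]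
          refine Finset.sum_congr rfl fun ij _ => ?_
          simp [hp.succ_ι_mul, hp.proj_act]
  | add x y hx hy => simp only [map_add, Finset.sum_add_distrib, hx, hy]
  | smul c x hx => simp only [map_smul, Finset.smul_sum, hx]

/-- The component of `Δ(x)` whose second factor has top degree is `1 ⊗ x`. -/
theorem lTensor_proj_comul_of_mem {n : ℕ} {x : R} (hx : x ∈ LinearMap.range S.ι ^ n) {m : ℕ}
    (hm : n ≤ m) : LinearMap.lTensor R (p m) (S.comul x) = 1 ⊗ₜ p m x := by
  revert m
  refine hp.mem_pow_induction
    (q := fun n x => ∀ {m}, n ≤ m → LinearMap.lTensor R (p m) (S.comul x) = 1 ⊗ₜ p m x)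
    ?_ ?_ ?_ ?_ hx
  · intro m _
    simp [comul_one]
  · rintro n w x hx h (_ | m) hm
    · omega
    · have h1 : ∀ t : R ⊗[k] R, LinearMap.lTensor R (p (m + 1)) (S.primMul w t) =
          LinearMap.rTensor R (LinearMap.mulLeft k (S.ι w)) (LinearMap.lTensor R (p (m + 1)) t) +
          sweedler (Y.coact w) fun h v =>
            TensorProduct.map (S.act h) (LinearMap.mulLeft k (S.ι v))
              (LinearMap.lTensor R (p m) t) := by
        intro t
        induction t with
        | zero => simp
        | add a b ha hb => simp only [map_add, sweedler_add_fun, ha, hb]; abel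
        | tmul a b => simp [primMul_tmul, map_sweedler, hp.succ_ι_mul]
      -- The induction hypothesis is used at m + 1 and at m, which is why the claim covers all
      -- degrees ≥ n. As x has degree n ≤ m, its component of degree m + 1 is zero, and only the
      -- part where w enters the second factor remains.
      rw [comul_ι_mul_eq, h1, h (by omega), h (by omega), hp.proj_of_mem hx, if_neg (by omega),
        hp.succ_ι_mul]
      simp only [TensorProduct.tmul_zero, map_zero, zero_add, TensorProduct.map_tmul, act_one,
        LinearMap.mulLeft_apply, ← TensorProduct.smul_tmul']
      rw [sweedler_counit_left (Y.counit_coact w) (f := fun v => 1 ⊗ₜ[k] (S.ι v * p m x))]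
      constructor <;> intros <;> simp [add_mul, TensorProduct.tmul_add]
  · intro n x y hx hy m hm
    simp only [map_add, TensorProduct.tmul_add, hx hm, hy hm]
  · intro n c x hx m hm
    simp only [map_smul, TensorProduct.tmul_smul, hx hm]

theorem lTensor_proj_comul {x : R} {m : ℕ} (hx : ∀ d > m, p d x = 0) :
    LinearMap.lTensor R (p m) (S.comul x) = 1 ⊗ₜ p m x := by
  obtain ⟨N, -, hs⟩ := hp.exists_eq_sum x
  rw [hs]
  simp only [map_sum, TensorProduct.tmul_sum]
  refine Finset.sum_congr rfl fun n _ => ?_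
  by_cases hn : n ≤ m
  · exact hp.lTensor_proj_comul_of_mem (hp.proj_mem n x) hn
  · simp [hx n (by omega)]

end IsGrading

end BraidedQuotient
end YetterDrinfeld

/-! ### Primitive elements, and ideals in the braided tensor square -/

namespace YetterDrinfeld

variable {k : Type*} [Field k] {H : Type*} [Ring H] [HopfAlgebra k H]
variable {W : Type*} [AddCommGroup W] [Module k W]
variable {V : Type*} [AddCommGroup V] [Module k V]

namespace BraidedQuotient

variable {Y : YetterDrinfeld k H W} {R : Type*} [Ring R] [Algebra k R] (S : BraidedQuotient Y R)

/-- The subspace of primitive elements. -/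
def primitives : Submodule k R :=
  LinearMap.ker (S.comul - (TensorProduct.mk k R R).flip 1 - TensorProduct.mk k R R 1)

theorem mem_primitives {x : R} : x ∈ S.primitives ↔ S.comul x = x ⊗ₜ 1 + 1 ⊗ₜ x := by
  rw [primitives, LinearMap.mem_ker]
  simp only [LinearMap.sub_apply, LinearMap.flip_apply, TensorProduct.mk_apply]
  rw [sub_sub, sub_eq_zero]

/-- H acts and coacts trivially on 1, so x ↦ x ⊗ 1 + 1 ⊗ x is linear and colinear over H, and so is
Δ. -/
theorem isYDSubmodule_primitives :
    IsYDSubmodule S.act S.coact.toLinearMap S.primitives where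
  act_mem h x hx := by
    rw [mem_primitives] at hx ⊢
    rw [comul_act, hx]
    simp only [map_add, TensorProduct.map_tmul, act_one, sweedler_add_fun,
      TensorProduct.tmul_smul, ← TensorProduct.smul_tmul']
    rw [sweedler_comul_counit_right h (f := fun a => S.act a x ⊗ₜ[k] (1 : R)),
      sweedler_comul_counit_left h (f := fun a => (1 : R) ⊗ₜ[k] S.act a x)]
    · constructor <;> intros <;> simp [TensorProduct.tmul_add]
    · constructor <;> intros <;> simp [TensorProduct.add_tmul, ← TensorProduct.smul_tmul']
  coact_mem x hx := mem_range_lTensor_iff.2 fun f => by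
    have h1 : S.comul x = _ := S.mem_primitives.1 hx
    have h2 := S.coact₂_comul x
    rw [h1, map_add, coact₂_tmul, coact₂_tmul, map_one, map_one, map_one, one_mul, mul_one] at h2
    have h3 : ∀ t : H ⊗[k] R,
        inclLeft t = LinearMap.lTensor H ((TensorProduct.mk k R R).flip 1) t := fun t => rfl
    have h4 : ∀ t : H ⊗[k] R,
        inclRight t = LinearMap.lTensor H (TensorProduct.mk k R R 1) t := fun t => rfl
    rw [AlgHom.toLinearMap_apply, mem_primitives, ← slice_lTensor, ← h2, map_add, h3, h4,
      slice_lTensor, slice_lTensor]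
    rfl

section Ideal

variable {J : Submodule k R} (hJ : IsYDSubmodule S.act S.coact.toLinearMap J)
include hJ

/-- In (x ⊗ y)(a ⊗ b) = x (y₋₁ a) ⊗ y₀ b, the right operand is touched by the action of H, the left
one by the coaction. Stability of J under the action is therefore used here, stability under the
coaction in `braidedMul_mem_of_left`. -/
theorem braidedMul_mem_of_right (hl : ∀ a, ∀ x ∈ J, a * x ∈ J)
    (s : R ⊗[k] R) {t : R ⊗[k] R} (ht : t ∈ tensorSup J J) :
    S.braidedMul s t ∈ tensorSup J J := by
  induction s with
  | zero => simp
  | add a b ha hb => rw [map_add]; exact add_mem ha hb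
  | tmul x y =>
    refine map_mem_tensorSup (S.braidedMul (x ⊗ₜ y)) (fun a ha b => ?_) (fun a b hb => ?_) ht
    · rw [braidedMul_tmul]
      exact sweedler_mem _ _ _ fun h z =>
        tmul_mem_tensorSup_left _ (hl _ _ (hJ.act_mem h a ha)) _
    · rw [braidedMul_tmul]
      exact sweedler_mem _ _ _ fun h z => tmul_mem_tensorSup_right _ _ (hl _ _ hb)

theorem braidedMul_mem_of_left (hr : ∀ a, ∀ x ∈ J, x * a ∈ J)
    {s : R ⊗[k] R} (hs : s ∈ tensorSup J J) (t : R ⊗[k] R) :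
    S.braidedMul s t ∈ tensorSup J J := by
  induction t with
  | zero => simp
  | add a b ha hb => rw [map_add]; exact add_mem ha hb
  | tmul a b =>
    refine map_mem_tensorSup (S.braidedMul.flip (a ⊗ₜ b)) (fun x hx y => ?_)
      (fun x y hy => ?_) hs
    · rw [LinearMap.flip_apply, braidedMul_tmul]
      exact sweedler_mem _ _ _ fun h z => tmul_mem_tensorSup_left _ (hr _ _ hx) _
    · rw [LinearMap.flip_apply, braidedMul_tmul]
      refine sweedler_mem_of_mem_range_lTensor _ (hJ.coact_mem y hy) ?_ fun h z hz =>
        tmul_mem_tensorSup_right _ _ (hr _ _ hz)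
      constructor <;> intros <;> simp [add_mul, mul_add, TensorProduct.add_tmul,
        TensorProduct.tmul_add, ← TensorProduct.smul_tmul']

end Ideal

theorem mul_mem_range_lTensor {J J' : Submodule k R} {s t : H ⊗[k] R}
    (hs : s ∈ LinearMap.range (LinearMap.lTensor H J.subtype))
    (ht : t ∈ LinearMap.range (LinearMap.lTensor H J'.subtype)) :
    s * t ∈ LinearMap.range (LinearMap.lTensor H (J * J').subtype) := by
  obtain ⟨s, rfl⟩ := hs
  obtain ⟨t, rfl⟩ := ht
  induction s with
  | zero => simp
  | add a b ha hb => rw [map_add, add_mul]; exact add_mem ha hb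
  | tmul g x =>
    induction t with
    | zero => simp
    | add a b ha hb => rw [map_add, mul_add]; exact add_mem ha hb
    | tmul g' y => exact ⟨(g * g') ⊗ₜ ⟨x * y, Submodule.mul_mem_mul x.2 y.2⟩, by simp⟩

theorem isYDSubmodule_mul {J J' : Submodule k R}
    (hJ : IsYDSubmodule S.act S.coact.toLinearMap J)
    (hJ' : IsYDSubmodule S.act S.coact.toLinearMap J') :
    IsYDSubmodule S.act S.coact.toLinearMap (J * J') where
  act_mem h x hx := by
    refine Submodule.mul_induction_on (C := fun x => S.act h x ∈ J * J') hx
      (fun a ha b hb => ?_) fun a b ha hb => by rw [map_add]; exact add_mem ha hb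
    rw [act_mul]
    exact sweedler_mem _ _ _ fun c d =>
      Submodule.mul_mem_mul (hJ.act_mem c a ha) (hJ'.act_mem d b hb)
  coact_mem x hx := by
    refine Submodule.mul_induction_on (C := fun x => S.coact.toLinearMap x ∈ _) hx
      (fun a ha b hb => ?_) fun a b ha hb => by rw [map_add]; exact add_mem ha hb
    rw [AlgHom.toLinearMap_apply, map_mul]
    exact mul_mem_range_lTensor (hJ.coact_mem a ha) (hJ'.coact_mem b hb)

theorem isYDSubmodule_top : IsYDSubmodule S.act S.coact.toLinearMap ⊤ :=
  ⟨fun _ _ _ => Submodule.mem_top, fun _ _ => mem_range_lTensor_iff.2 fun _ => Submodule.mem_top⟩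

end BraidedQuotient

/-! ### The gradings of T(W) and B(W) -/

section Grading

variable (Y : YetterDrinfeld k H W)

/-- The projection of `T(W)` onto its component of degree `n`. -/
def tensorDegProj (n : ℕ) : TensorAlgebra k W →ₗ[k] TensorAlgebra k W :=
  GradedAlgebra.proj
    (fun n : ℕ => LinearMap.range (TensorAlgebra.ι k : W →ₗ[k] TensorAlgebra k W) ^ n) n

theorem isGrading_tensorDegProj : Y.tensorQuotient.IsGrading (tensorDegProj (k := k)) where
  zero_one := by
    rw [tensorDegProj, GradedAlgebra.proj_apply]
    exact DirectSum.decompose_of_mem_same _ (Submodule.one_le.1 le_rfl)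
  succ_one n := by
    rw [tensorDegProj, GradedAlgebra.proj_apply]
    exact DirectSum.decompose_of_mem_ne (i := 0) _ (Submodule.one_le.1 le_rfl) (by omega)
  zero_ι_mul w x := by
    rw [tensorDegProj, GradedAlgebra.proj_apply]
    refine DirectSum.coe_decompose_mul_of_left_mem_of_not_le (i := 1) _ ?_ (by omega)
    rw [pow_one]
    exact ⟨w, rfl⟩
  succ_ι_mul n w x := by
    rw [tensorDegProj, tensorDegProj, GradedAlgebra.proj_apply, GradedAlgebra.proj_apply, add_comm]
    refine DirectSum.coe_decompose_mul_add_of_left_mem (i := 1) _ ?_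
    rw [pow_one]
    exact ⟨w, rfl⟩

theorem iSup_range_ι_pow :
    ⨆ n : ℕ, LinearMap.range (TensorAlgebra.ι k : W →ₗ[k] TensorAlgebra k W) ^ n = ⊤ :=
  (DirectSum.Decomposition.isInternal
    fun n : ℕ => LinearMap.range (TensorAlgebra.ι k : W →ₗ[k] TensorAlgebra k W) ^ n).submodule_iSup_eq_top

theorem tensorDegProj_mem_nicholsSubspace (n : ℕ) {x : TensorAlgebra k W}
    (hx : x ∈ Y.nicholsSubspace) : tensorDegProj n x ∈ Y.nicholsSubspace := by
  have h : Y.nicholsSubspace ≤ Y.nicholsSubspace.comap (tensorDegProj n) := by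
    refine Y.isNicholsHopfIdeal_nicholsSubspace.homogeneous.trans (iSup_le fun m x hx => ?_)
    have h1 := Y.isGrading_tensorDegProj.proj_of_mem hx.2 n
    change tensorDegProj n x ∈ Y.nicholsSubspace
    rw [h1]
    split_ifs
    · exact hx.1
    · exact zero_mem _
  exact h hx

/-- The projection of `B(W)` onto its component of degree `n`. -/
def nicholsDegProj (n : ℕ) : Y.NicholsAlgebra →ₗ[k] Y.NicholsAlgebra :=
  Y.nicholsLift (Y.nicholsMk.toLinearMap ∘ₗ tensorDegProj n)
    fun _ hx => Y.nicholsMk_eq_zero (Y.tensorDegProj_mem_nicholsSubspace n hx)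

theorem isGrading_nicholsDegProj : Y.nicholsQuotient.IsGrading Y.nicholsDegProj where
  zero_one := congrArg Y.nicholsMk Y.isGrading_tensorDegProj.zero_one
  succ_one n := (congrArg Y.nicholsMk (Y.isGrading_tensorDegProj.succ_one n)).trans (map_zero _)
  zero_ι_mul w x := by
    obtain ⟨x, rfl⟩ := Y.nicholsMk_surjective x
    exact (congrArg Y.nicholsMk (Y.isGrading_tensorDegProj.zero_ι_mul w x)).trans (map_zero _)
  succ_ι_mul n w x := by
    obtain ⟨x, rfl⟩ := Y.nicholsMk_surjective x
    exact (congrArg Y.nicholsMk (Y.isGrading_tensorDegProj.succ_ι_mul n w x)).trans (map_mul _ _ _)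

end Grading

/-! ### Consequences of the maximality of the Nichols ideal -/

section Coideal

variable (Y : YetterDrinfeld k H W)

/-- A homogeneous Yetter-Drinfeld coideal of `T(W)` in degrees at least two is contained in the
defining ideal of the Nichols algebra. -/
theorem le_nicholsSubspace_of_coideal {G : Submodule k (TensorAlgebra k W)}
    (hG : IsYDSubmodule Y.tensorAct Y.tensorCoact.toLinearMap G)
    (hdeg : G ≤ ⨆ n : ℕ, G ⊓ LinearMap.range (TensorAlgebra.ι k : W →ₗ[k] _) ^ (n + 2))
    (hΔ : ∀ x ∈ G, Y.tensorComul x ∈ tensorSup G G) : G ≤ Y.nicholsSubspace := by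
  let S := Y.tensorQuotient
  -- The two-sided ideal generated by G. Since Δ is multiplicative for the braided product, and
  -- `tensorSup J J` absorbs this product on both sides, J is again a coideal.
  let J : Submodule k (TensorAlgebra k W) := ⊤ * (G * ⊤)
  have hGJ : G ≤ J := fun x hx => by
    have : (1 : TensorAlgebra k W) * (x * 1) ∈ J :=
      Submodule.mul_mem_mul Submodule.mem_top (Submodule.mul_mem_mul hx Submodule.mem_top)
    simpa using this
  have hJ : IsYDSubmodule S.act S.coact.toLinearMap J :=
    S.isYDSubmodule_mul S.isYDSubmodule_top (S.isYDSubmodule_mul hG S.isYDSubmodule_top)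
  have hl : ∀ a, ∀ x ∈ J, a * x ∈ J := fun a x hx => by
    refine Submodule.mul_induction_on (C := fun x => a * x ∈ J) hx (fun b _ c hc => ?_)
      fun y z hy hz => by rw [mul_add]; exact add_mem hy hz
    rw [← mul_assoc]
    exact Submodule.mul_mem_mul Submodule.mem_top hc
  have hr : ∀ a, ∀ x ∈ J, x * a ∈ J := fun a x hx => by
    refine Submodule.mul_induction_on (C := fun x => x * a ∈ J) hx (fun b hb c hc => ?_)
      fun y z hy hz => by rw [add_mul]; exact add_mem hy hz
    rw [mul_assoc]
    refine Submodule.mul_mem_mul hb ?_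
    refine Submodule.mul_induction_on (C := fun c => c * a ∈ G * ⊤) hc (fun d hd e _ => ?_)
      fun y z hy hz => by rw [add_mul]; exact add_mem hy hz
    rw [mul_assoc]
    exact Submodule.mul_mem_mul hd Submodule.mem_top
  refine hGJ.trans (Y.le_nicholsSubspace ⟨hl, hr, ?_, hJ, fun x hx => ?_⟩)
  · have h1 : J ≤ (⨆ i : ℕ, LinearMap.range (TensorAlgebra.ι k : W →ₗ[k] _) ^ i) *
        ((⨆ n : ℕ, G ⊓ LinearMap.range (TensorAlgebra.ι k : W →ₗ[k] _) ^ (n + 2)) *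
          ⨆ j : ℕ, LinearMap.range (TensorAlgebra.ι k : W →ₗ[k] _) ^ j) := by
      rw [iSup_range_ι_pow]
      exact mul_le_mul_right (mul_le_mul_left hdeg _) _
    refine h1.trans ?_
    simp only [Submodule.iSup_mul, Submodule.mul_iSup]
    refine iSup_le fun i => iSup_le fun n => iSup_le fun j => ?_
    refine le_trans (le_inf ?_ ?_) (le_iSup (fun n : ℕ =>
      J ⊓ LinearMap.range (TensorAlgebra.ι k : W →ₗ[k] TensorAlgebra k W) ^ (n + 2)) (i + n + j))
    · exact mul_le_mul' le_top (mul_le_mul' inf_le_left le_top)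
    · refine (mul_le_mul_right (mul_le_mul_left inf_le_right _) _).trans ?_
      rw [← pow_add, ← pow_add]
      exact (congrArg _ (by omega)).le
  · change Y.tensorComul x ∈ tensorSup J J
    refine Submodule.mul_induction_on (C := fun x => S.comul x ∈ tensorSup J J) hx
      (fun a _ c hc => ?_) fun y z hy hz => by rw [map_add]; exact add_mem hy hz
    rw [S.comul_mul]
    refine S.braidedMul_mem_of_right hJ hl _ ?_
    refine Submodule.mul_induction_on (C := fun x => S.comul x ∈ tensorSup J J) hc
      (fun g hg b _ => ?_) fun y z hy hz => by rw [map_add]; exact add_mem hy hz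
    rw [S.comul_mul]
    exact S.braidedMul_mem_of_left hJ hr (tensorSup_mono hGJ hGJ (hΔ g hg)) _

theorem isYDSubmodule_nicholsPrimitives :
    IsYDSubmodule Y.nicholsAct Y.nicholsCoact Y.nicholsQuotient.primitives :=
  Y.nicholsQuotient.isYDSubmodule_primitives

theorem isYDSubmodule_comap_nicholsMk {N : Submodule k Y.NicholsAlgebra}
    (hN : IsYDSubmodule Y.nicholsAct Y.nicholsCoact N) :
    IsYDSubmodule Y.tensorAct Y.tensorCoact.toLinearMap (N.comap Y.nicholsMk.toLinearMap) where
  act_mem h x hx := hN.act_mem h _ hx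
  coact_mem x hx := mem_range_lTensor_iff.2 fun f => by
    rw [Submodule.mem_comap, ← slice_lTensor]
    exact mem_range_lTensor_iff.1 (hN.coact_mem _ hx) f

/-- There are no nonzero primitive elements of degree at least two in a Nichols algebra. -/
theorem eq_zero_of_mem_primitives {n : ℕ} {y : Y.NicholsAlgebra}
    (hy : y ∈ Y.nicholsQuotient.primitives) (hn : y ∈ LinearMap.range Y.nicholsIncl ^ (n + 2)) :
    y = 0 := by
  -- The elements of T(W) of degree n + 2 with primitive image in B(W). Adding P to the Nichols
  -- ideal gives a homogeneous coideal in degrees at least two, which by maximality is no larger;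
  -- hence P dies in B(W).
  let P : Submodule k (TensorAlgebra k W) := LinearMap.range (TensorAlgebra.ι k) ^ (n + 2) ⊓
    Y.nicholsQuotient.primitives.comap Y.nicholsMk.toLinearMap
  have hI := Y.isNicholsHopfIdeal_nicholsSubspace
  have hPYD : IsYDSubmodule Y.tensorAct Y.tensorCoact.toLinearMap P := by
    refine BraidedQuotient.isYDSubmodule_inf
      (Y.isGrading_tensorDegProj.isYDSubmodule_pow (n + 2))
      (Y.isYDSubmodule_comap_nicholsMk Y.isYDSubmodule_nicholsPrimitives)
  have hker : LinearMap.ker Y.nicholsMk.toLinearMap = Y.nicholsSubspace := by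
    ext x
    exact Ideal.Quotient.eq_zero_iff_mem
  have h := Y.le_nicholsSubspace_of_coideal (G := Y.nicholsSubspace ⊔ P)
    (BraidedQuotient.isYDSubmodule_sup hI.isYDSubmodule hPYD) ?_ ?_
  · obtain ⟨x, rfl⟩ := Y.nicholsMk_surjective y
    have h1 := (Y.isGrading_nicholsDegProj.mem_iff).1 hn
    rw [← h1]
    refine Y.nicholsMk_eq_zero (h (Submodule.mem_sup_right ⟨?_, ?_⟩))
    · exact Y.isGrading_tensorDegProj.proj_mem (n + 2) x
    · change Y.nicholsDegProj (n + 2) (Y.nicholsMk x) ∈ Y.nicholsQuotient.primitives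
      rw [h1]
      exact hy
  · refine sup_le (hI.homogeneous.trans (iSup_mono fun m => inf_le_inf_right _ le_sup_left)) ?_
    exact le_trans (le_inf le_sup_right inf_le_left) (le_iSup (fun m : ℕ =>
      (Y.nicholsSubspace ⊔ P) ⊓
        LinearMap.range (TensorAlgebra.ι k : W →ₗ[k] TensorAlgebra k W) ^ (m + 2)) n)
  · intro x hx
    obtain ⟨a, ha, b, hb, rfl⟩ := Submodule.mem_sup.1 hx
    rw [map_add]
    refine add_mem (tensorSup_mono le_sup_left le_sup_left (hI.comul_mem a ha)) ?_
    -- Primitivity of the image of b says that this difference vanishes in B(W) ⊗ B(W), and the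
    -- kernel of T(W) ⊗ T(W) → B(W) ⊗ B(W) is I ⊗ T(W) + T(W) ⊗ I for the Nichols ideal I.
    have h1 : Y.tensorComul b - b ⊗ₜ 1 - 1 ⊗ₜ b ∈
        tensorSup Y.nicholsSubspace Y.nicholsSubspace := by
      rw [← hker, ← ker_map_eq_tensorSup Y.nicholsMk_surjective Y.nicholsMk_surjective,
        LinearMap.mem_ker, map_sub, map_sub, ← nicholsComul_mk]
      have h2 : Y.nicholsComul (Y.nicholsMk b) = _ := Y.nicholsQuotient.mem_primitives.1 hb.2
      rw [h2]
      simp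
    have h3 : Y.tensorComul b = (Y.tensorComul b - b ⊗ₜ 1 - 1 ⊗ₜ b) + b ⊗ₜ 1 + 1 ⊗ₜ b := by abel
    rw [h3]
    have hb' : b ∈ Y.nicholsSubspace ⊔ P := Submodule.mem_sup_right hb
    exact add_mem (add_mem (tensorSup_mono le_sup_left le_sup_left h1)
      (tmul_mem_tensorSup_left _ hb' _)) (tmul_mem_tensorSup_right _ _ hb')

variable {Y} {Z : YetterDrinfeld k H V} {f : V →ₗ[k] W}

/-- As f need not be surjective, the image of the Nichols ideal need not be an ideal. It is still a
homogeneous Yetter-Drinfeld coideal in degrees at least two, and this suffices. -/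
theorem IsHom.map_mem_nicholsSubspace (hf : IsHom Z Y f) {x : TensorAlgebra k V}
    (hx : x ∈ Z.nicholsSubspace) : tensorMap f x ∈ Y.nicholsSubspace := by
  have hI := Z.isNicholsHopfIdeal_nicholsSubspace
  let g : TensorAlgebra k V →ₗ[k] TensorAlgebra k W := (tensorMap f).toLinearMap
  refine Y.le_nicholsSubspace_of_coideal (G := Z.nicholsSubspace.map g) ⟨?_, ?_⟩ ?_ ?_
    (Submodule.mem_map_of_mem hx)
  · rintro h _ ⟨x, hx, rfl⟩
    exact ⟨_, hI.isYDSubmodule.act_mem h x hx, hf.map_tensorAct h x⟩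
  · rintro _ ⟨x, hx, rfl⟩
    rw [mem_range_lTensor_iff]
    intro φ
    refine ⟨_, mem_range_lTensor_iff.1 (hI.isYDSubmodule.coact_mem x hx) φ, ?_⟩
    rw [← slice_lTensor]
    exact congrArg _ (hf.map_tensorCoact x).symm
  · refine (Submodule.map_mono hI.homogeneous).trans ?_
    rw [Submodule.map_iSup]
    refine iSup_mono fun n => (Submodule.map_inf_le _).trans (inf_le_inf_left _ ?_)
    rw [Submodule.map_pow]
    refine pow_le_pow_left' ?_ _
    rintro _ ⟨_, ⟨w, rfl⟩, rfl⟩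
    exact ⟨f w, by simp⟩
  · rintro _ ⟨x, hx, rfl⟩
    change Y.tensorComul (tensorMap f x) ∈ _
    rw [hf.map_tensorComul]
    refine map_mem_tensorSup (TensorProduct.map g g) (fun a ha b => ?_) (fun a b hb => ?_)
      (hI.comul_mem x hx)
    · exact tmul_mem_tensorSup_left _ (Submodule.mem_map_of_mem ha) _
    · exact tmul_mem_tensorSup_right _ _ (Submodule.mem_map_of_mem hb)

/-- The map `B(V) → B(W)` induced by a morphism `f : V → W`. -/
def IsHom.nicholsMap (hf : IsHom Z Y f) : Z.NicholsAlgebra →ₐ[k] Y.NicholsAlgebra :=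
  Ideal.Quotient.liftₐ Z.nicholsIdeal (Y.nicholsMk.comp (tensorMap f)) fun _ hx =>
    Y.nicholsMk_eq_zero (hf.map_mem_nicholsSubspace hx)

theorem IsHom.nicholsMap_incl (hf : IsHom Z Y f) (v : V) :
    hf.nicholsMap (Z.nicholsIncl v) = Y.nicholsIncl (f v) := by
  change Y.nicholsMk (tensorMap f (TensorAlgebra.ι k v)) = _
  rw [tensorMap_ι]
  rfl

theorem IsHom.nicholsMap_act (hf : IsHom Z Y f) (h : H) (x : Z.NicholsAlgebra) :
    hf.nicholsMap (Z.nicholsAct h x) = Y.nicholsAct h (hf.nicholsMap x) := by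
  obtain ⟨x, rfl⟩ := Z.nicholsMk_surjective x
  exact congrArg Y.nicholsMk (hf.map_tensorAct h x)

end Coideal

end YetterDrinfeld

/-! ### Cancellations with the antipode and its inverse -/

section AntipodeSweedler

variable {k : Type*} [Field k] {H : Type*} [Ring H] [HopfAlgebra k H]
variable {M P : Type*} [AddCommGroup M] [Module k M] [AddCommGroup P] [Module k P]

/-- The inverse of a bijective antipode. -/
def antipodeInv (hS : Function.Bijective (HopfAlgebra.antipode k (A := H))) : H →ₗ[k] H :=
  (LinearEquiv.ofBijective (HopfAlgebra.antipode k (A := H)) hS).symm.toLinearMap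

theorem antipode_antipodeInv (hS : Function.Bijective (HopfAlgebra.antipode k (A := H))) (h : H) :
    HopfAlgebra.antipode k (antipodeInv hS h) = h :=
  (LinearEquiv.ofBijective (HopfAlgebra.antipode k (A := H)) hS).apply_symm_apply h

/-- The antipode is injective and reverses products; applying it turns S⁻¹(h₂) h₁ into S(h₁) h₂. -/
theorem sweedler_antipodeInv_mul (hS : Function.Bijective (HopfAlgebra.antipode k (A := H)))
    (h : H) {f : H → P} (hf : IsLin k f) :
    sweedler (Coalgebra.comul (R := k) h) (fun a b => f (antipodeInv hS b * a)) =
      Coalgebra.counit (R := k) h • f 1 := by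
  have h1 : sweedler (Coalgebra.comul (R := k) h) (fun a b => antipodeInv hS b * a) =
      Coalgebra.counit (R := k) h • (1 : H) := by
    apply hS.1
    simp only [map_sweedler, HopfAlgebra.antipode_mul_antidistrib, antipode_antipodeInv, map_smul,
      HopfAlgebra.antipode_one]
    exact sweedler_antipode_mul h (f := fun x => x) ⟨fun _ _ => rfl, fun _ _ => rfl⟩
  let F : H →ₗ[k] P := ⟨⟨f, hf.add⟩, hf.smul⟩
  have h2 := congrArg F h1
  rw [map_sweedler, map_smul] at h2
  exact h2

variable {δ : M →ₗ[k] H ⊗[k] M} {x : M}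
    (hδ : TensorProduct.assoc k H H M (LinearMap.rTensor M Coalgebra.comul (δ x)) =
      LinearMap.lTensor H δ (δ x))
    (hε : TensorProduct.lid k M (LinearMap.rTensor M Coalgebra.counit (δ x)) = x)
    {f : H → M → P} (hf : IsBilin k f)
include hδ hε hf

theorem sweedler_antipode_coact :
    sweedler (δ x) (fun h v => sweedler (δ v) fun c u => f (HopfAlgebra.antipode k h * c) u) =
      f 1 x := by
  rw [← sweedler_coassoc hδ (f := fun h c u => f (HopfAlgebra.antipode k h * c) u)]
  · have hl : ∀ u, IsLin k fun a : H => f a u := fun u =>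
      ⟨fun a a' => hf.add_left a a' u, fun c a => hf.smul_left c a u⟩
    simp only [fun h u => sweedler_antipode_mul h (hl u)]
    exact sweedler_counit_left hε (f := f 1) ⟨hf.add_right 1, fun c => hf.smul_right c 1⟩
  · constructor <;> intros <;> simp [add_mul, mul_add, hf.add_left, hf.add_right, hf.smul_left,
      hf.smul_right]

theorem sweedler_antipodeInv_coact
    (hS : Function.Bijective (HopfAlgebra.antipode k (A := H))) :
    sweedler (δ x) (fun h v => sweedler (δ v) fun c u => f (antipodeInv hS c * h) u) =
      f 1 x := by
  rw [← sweedler_coassoc hδ (f := fun h c u => f (antipodeInv hS c * h) u)]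
  · have hl : ∀ u, IsLin k fun a : H => f a u := fun u =>
      ⟨fun a a' => hf.add_left a a' u, fun c a => hf.smul_left c a u⟩
    simp only [fun h u => sweedler_antipodeInv_mul hS h (hl u)]
    exact sweedler_counit_left hε (f := f 1) ⟨hf.add_right 1, fun c => hf.smul_right c 1⟩
  · constructor <;> intros <;> simp [add_mul, mul_add, hf.add_left, hf.add_right, hf.smul_left,
      hf.smul_right]

end AntipodeSweedler

section SliceLemmas

variable {k : Type*} [Field k]
variable {A B C : Type*} [AddCommGroup A] [Module k A] [AddCommGroup B] [Module k B]
  [AddCommGroup C] [Module k C]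

theorem slice_eq_sweedler (f : A →ₗ[k] k) (t : A ⊗[k] B) :
    slice f t = sweedler t fun a b => f a • b := by
  conv_lhs => rw [← sweedler_tmul_self t]
  simp [map_sweedler]

/-- Both conditions say that t vanishes in C ⊗ B/N. -/
theorem mem_tensorSup_ker_iff {g : A →ₗ[k] C} (hg : Function.Surjective g) {N : Submodule k B}
    {t : A ⊗[k] B} :
    t ∈ tensorSup (LinearMap.ker g) N ↔ ∀ f : C →ₗ[k] k, slice (f ∘ₗ g) t ∈ N := by
  have h1 : tensorSup (LinearMap.ker g) N = LinearMap.ker (TensorProduct.map g N.mkQ) := by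
    rw [ker_map_eq_tensorSup hg N.mkQ_surjective, N.ker_mkQ]
  have h2 : TensorProduct.map g N.mkQ t =
      LinearMap.lTensor C N.mkQ (LinearMap.rTensor B g t) := by
    rw [← LinearMap.comp_apply, LinearMap.lTensor_comp_rTensor]
  rw [h1, LinearMap.mem_ker, h2]
  refine ⟨fun h f => ?_, fun h => eq_zero_of_slice_eq_zero fun f => ?_⟩
  · rw [← slice_rTensor, ← N.ker_mkQ, LinearMap.mem_ker, ← slice_lTensor, h, map_zero]
  · rw [slice_lTensor, slice_rTensor]
    simpa using h f

end SliceLemmas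

/-! ### Operators on the second tensor factor -/

namespace YetterDrinfeld

variable {k : Type*} [Field k] {H : Type*} [Ring H] [HopfAlgebra k H]
variable {W : Type*} [AddCommGroup W] [Module k W]

namespace BraidedQuotient

variable {Y : YetterDrinfeld k H W} {R : Type*} [Ring R] [Algebra k R] (S : BraidedQuotient Y R)

/-- The diagonal action is untwisted by S(h₁) h₂ = ε(h) on the first factor. The diagonal action on
Δ(x) is Δ(h x), and the correction touches only the first factor, where it preserves the kernel of
B(W) → B(V). In `lTensor_ad_eq` the same is done with the coaction of w. -/
theorem lTensor_act_eq (h : H) (t : R ⊗[k] R) :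
    LinearMap.lTensor R (S.act h) t = sweedler (Coalgebra.comul (R := k) h) fun a b =>
      LinearMap.rTensor R (S.act (HopfAlgebra.antipode k a))
        (sweedler (Coalgebra.comul (R := k) b) fun c d =>
          TensorProduct.map (S.act c) (S.act d) t) := by
  induction t with
  | zero => simp
  | add x y hx hy => simp only [map_add, sweedler_add_fun, hx, hy]
  | tmul p q =>
    simp only [map_sweedler, TensorProduct.map_tmul, LinearMap.rTensor_tmul, act_act,
      LinearMap.lTensor_tmul]
    rw [sweedler_antipode_coact (Coalgebra.coassoc_apply h) (by simp)
      (f := fun a d => S.act a p ⊗ₜ[k] S.act d q), act_one_apply]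
    constructor <;> intros <;> simp [TensorProduct.add_tmul, TensorProduct.tmul_add,
      ← TensorProduct.smul_tmul']

theorem lTensor_ad_eq (w : W) (t : R ⊗[k] R) :
    LinearMap.lTensor R (S.ad w) t = sweedler (Y.coact w) fun h v =>
      LinearMap.rTensor R (S.act (HopfAlgebra.antipode k h))
        (sweedler (Y.coact v) fun c u => TensorProduct.map (S.act c) (S.ad u) t) := by
  induction t with
  | zero => simp
  | add x y hx hy => simp only [map_add, sweedler_add_fun, hx, hy]
  | tmul p q =>
    simp only [map_sweedler, TensorProduct.map_tmul, LinearMap.rTensor_tmul, act_act,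
      LinearMap.lTensor_tmul]
    rw [sweedler_antipode_coact (Y.coassoc_coact w) (Y.counit_coact w)
      (f := fun a u => S.act a p ⊗ₜ[k] S.ad u q), act_one_apply]
    constructor <;> intros <;> simp [TensorProduct.add_tmul, TensorProduct.tmul_add, ad_add,
      ad_smul, ← TensorProduct.smul_tmul']

/-- The coaction on the second tensor factor, expressed through the codiagonal coaction. -/
theorem lTensor_slice_coact_eq (hS : Function.Bijective (HopfAlgebra.antipode k (A := H)))
    (φ : H →ₗ[k] k) (t : R ⊗[k] R) :
    LinearMap.lTensor R (slice φ ∘ₗ S.coact.toLinearMap) t =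
      sweedler (S.coact₂ t) fun g s => LinearMap.rTensor R
        (slice (φ ∘ₗ LinearMap.mulRight k g ∘ₗ antipodeInv hS) ∘ₗ S.coact.toLinearMap) s := by
  -- κ g sends x to φ(S⁻¹(x₋₁) g) x₀. For g = p₋₁ q₋₁, applied to p₀, the factor S⁻¹(p₋₁) p₋₂
  -- collapses to a counit and leaves φ(q₋₁). This is where bijectivity of the antipode enters the
  -- theorem.
  let κ : H →ₗ[k] R →ₗ[k] R :=
    { toFun := fun g =>
        slice (φ ∘ₗ LinearMap.mulRight k g ∘ₗ antipodeInv hS) ∘ₗ S.coact.toLinearMap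
      map_add' := fun g g' => by
        ext x
        simp [slice_eq_sweedler, mul_add, add_smul, sweedler_add_fun]
      map_smul' := fun c g => by
        ext x
        simp [slice_eq_sweedler, mul_smul, sweedler_smul_fun] }
  have hb : IsBilin k fun (g : H) (s : R ⊗[k] R) => LinearMap.rTensor R (κ g) s := by
    constructor <;> intros <;> simp [LinearMap.rTensor_add, LinearMap.rTensor_smul]
  change _ = sweedler (S.coact₂ t) fun g s => LinearMap.rTensor R (κ g) s
  have hκ : ∀ g x, κ g x = sweedler (S.coact x) fun c y => φ (antipodeInv hS c * g) • y :=
    fun g x => slice_eq_sweedler _ _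
  induction t with
  | zero => simp [sweedler_zero hb]
  | add x y hx hy => rw [map_add, map_add, sweedler_add hb, hx, hy]
  | tmul p q =>
    rw [coact₂_tmul, sweedler_mul hb]
    have h3 : ∀ t : H ⊗[k] R,
        inclLeft t = LinearMap.lTensor H ((TensorProduct.mk k R R).flip 1) t := fun t => rfl
    have h4 : ∀ t : H ⊗[k] R,
        inclRight t = LinearMap.lTensor H (TensorProduct.mk k R R 1) t := fun t => rfl
    have hb2 : ∀ (c : H) (z : R ⊗[k] R), IsBilin k fun (g : H) (s : R ⊗[k] R) =>
        LinearMap.rTensor R (κ (c * g)) (z * s) := by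
      intro c z
      constructor <;> intros <;> simp [LinearMap.rTensor_add, LinearMap.rTensor_smul, mul_add]
    rw [h3, sweedler_lTensor]
    · simp only [h4, sweedler_lTensor (hb2 _ _)]
      simp only [LinearMap.flip_apply, TensorProduct.mk_apply,
        Algebra.TensorProduct.tmul_mul_tmul, mul_one, one_mul, LinearMap.rTensor_tmul, hκ,
        sweedler_tmul_right]
      have hf : IsBilin k fun (h : H) (u : R) => sweedler (S.coact q) fun d q' =>
          (φ (h * d) • u) ⊗ₜ[k] q' := by
        constructor <;> intros <;> simp [add_mul, add_smul, TensorProduct.add_tmul,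
          ← TensorProduct.smul_tmul', sweedler_add_fun, sweedler_smul_fun, mul_smul]
        rw [← sweedler_smul_fun]
        congr 1; funext a b
        rw [smul_comm]
      have key := sweedler_antipodeInv_coact (δ := S.coact.toLinearMap) (S.coact_coassoc p)
        (S.counit_coact p) hf hS
      simp only [one_mul, mul_assoc, AlgHom.toLinearMap_apply] at key
      refine Eq.trans ?_ (key.symm.trans ?_)
      · rw [LinearMap.lTensor_tmul, LinearMap.comp_apply, slice_eq_sweedler, sweedler_tmul_left]
        simp [TensorProduct.tmul_smul, ← TensorProduct.smul_tmul']
      · congr 1; funext c x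
        exact sweedler_comm _ _ _
    · constructor <;> intros <;> simp [add_mul, LinearMap.rTensor_add, LinearMap.rTensor_smul,
        sweedler_add_fun, sweedler_smul_fun]

section Stability

variable {K N : Submodule k R}

theorem map_act_mem_tensorSup (hK : IsYDSubmodule S.act S.coact.toLinearMap K)
    (hN : IsYDSubmodule S.act S.coact.toLinearMap N) (a b : H) {t : R ⊗[k] R}
    (ht : t ∈ tensorSup K N) :
    TensorProduct.map (S.act a) (S.act b) t ∈ tensorSup K N :=
  map_mem_tensorSup _ (fun x hx _ => tmul_mem_tensorSup_left _ (hK.act_mem a x hx) _)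
    (fun _ y hy => tmul_mem_tensorSup_right _ _ (hN.act_mem b y hy)) ht

theorem rTensor_mem_tensorSup {f : R →ₗ[k] R} (hf : ∀ x ∈ K, f x ∈ K) {t : R ⊗[k] R}
    (ht : t ∈ tensorSup K N) : LinearMap.rTensor R f t ∈ tensorSup K N :=
  map_mem_tensorSup _ (fun x hx _ => tmul_mem_tensorSup_left _ (hf x hx) _)
    (fun _ _ hy => tmul_mem_tensorSup_right _ _ hy) ht

/-- (x ⊗ y)(v ⊗ 1) = x (y₋₁ v) ⊗ y₀, so N has to be stable under the coaction but need not be an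
ideal. -/
theorem braidedMul_tmul_one_mem_tensorSup
    (hN : IsYDSubmodule S.act S.coact.toLinearMap N) (hr : ∀ a, ∀ x ∈ K, x * a ∈ K) (v : R)
    {t : R ⊗[k] R} (ht : t ∈ tensorSup K N) :
    S.braidedMul t (v ⊗ₜ 1) ∈ tensorSup K N := by
  refine map_mem_tensorSup (S.braidedMul.flip (v ⊗ₜ 1)) (fun x hx y => ?_) (fun x y hy => ?_) ht
  · rw [LinearMap.flip_apply, braidedMul_tmul]
    exact sweedler_mem _ _ _ fun h z => tmul_mem_tensorSup_left _ (hr _ _ hx) _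
  · rw [LinearMap.flip_apply, braidedMul_tmul]
    refine sweedler_mem_of_mem_range_lTensor _ (hN.coact_mem y hy) ?_ fun h z hz =>
      tmul_mem_tensorSup_right _ _ (by rwa [mul_one])
    constructor <;> intros <;> simp [mul_add, TensorProduct.add_tmul,
      TensorProduct.tmul_add, ← TensorProduct.smul_tmul']

end Stability

end BraidedQuotient
end YetterDrinfeld

/-! ### Degrees of adjoint actions and of coproducts -/

namespace YetterDrinfeld

namespace BraidedQuotient

variable {k : Type*} [Field k] {H : Type*} [Ring H] [HopfAlgebra k H]
variable {W : Type*} [AddCommGroup W] [Module k W]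
variable {Y : YetterDrinfeld k H W} {R : Type*} [Ring R] [Algebra k R] (S : BraidedQuotient Y R)

theorem ad_one (w : W) : S.ad w 1 = 0 := by
  rw [ad_apply, mul_one]
  simp only [act_one, smul_mul_assoc, one_mul]
  rw [sweedler_counit_left (Y.counit_coact w) (f := S.ι), sub_self]
  exact ⟨map_add _, map_smul _⟩

namespace IsGrading

variable {S} {p : ℕ → R →ₗ[k] R} (hp : S.IsGrading p)
include hp

/-- The axioms of a grading concern left multiplication only. Both claims are proved together,
because the second one at n = 0 uses the first in the induction. -/
theorem proj_mul_ι (x : R) (v : W) :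
    p 0 (x * S.ι v) = 0 ∧ ∀ n, p (n + 1) (x * S.ι v) = p n x * S.ι v := by
  induction x using S.induction with
  | one =>
    rw [one_mul, ← mul_one (S.ι v)]
    refine ⟨hp.zero_ι_mul v 1, fun n => ?_⟩
    rw [hp.succ_ι_mul]
    cases n with
    | zero => rw [hp.zero_one]; simp
    | succ n => rw [hp.succ_one]; simp
  | ι_mul w x hx =>
    refine ⟨by rw [mul_assoc, hp.zero_ι_mul], fun n => ?_⟩
    rw [mul_assoc, hp.succ_ι_mul]
    cases n with
    | zero => rw [hx.1, hp.zero_ι_mul, mul_zero, zero_mul]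
    | succ n => rw [hx.2, hp.succ_ι_mul, mul_assoc]
  | add x y hx hy => simp [add_mul, hx, hy]
  | smul c x hx => simp [hx]

theorem proj_zero_ad (w : W) (x : R) : p 0 (S.ad w x) = 0 := by
  simp [ad_apply, map_sweedler, hp.zero_ι_mul, (hp.proj_mul_ι _ _).1]

theorem proj_succ_ad (n : ℕ) (w : W) (x : R) : p (n + 1) (S.ad w x) = S.ad w (p n x) := by
  simp [ad_apply, map_sweedler, hp.succ_ι_mul, (hp.proj_mul_ι _ _).2, hp.proj_act]

theorem ad_mem {n : ℕ} (w : W) {x : R} (hx : x ∈ LinearMap.range S.ι ^ n) :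
    S.ad w x ∈ LinearMap.range S.ι ^ (n + 1) := by
  rw [hp.mem_iff, hp.proj_succ_ad, hp.mem_iff.1 hx]

/-- Homogeneous components of primitive elements are primitive. -/
theorem proj_mem_primitives {x : R} (hx : x ∈ S.primitives) (n : ℕ) :
    p (n + 1) x ∈ S.primitives := by
  rw [mem_primitives] at hx ⊢
  rw [hp.comul_proj, hx]
  simp only [map_add, TensorProduct.map_tmul, Finset.sum_add_distrib]
  congr 1
  · rw [Finset.Nat.antidiagonal_succ', Finset.sum_cons, Finset.sum_map]
    simp [hp.zero_one, hp.succ_one]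
  · rw [Finset.Nat.antidiagonal_succ, Finset.sum_cons, Finset.sum_map]
    simp [hp.zero_one, hp.succ_one]

/-- The subspace of elements of degree less than `n`. -/
def degLT (_ : S.IsGrading p) (n : ℕ) : Submodule k R where
  carrier := {x | ∀ m ≥ n, p m x = 0}
  add_mem' ha hb m hm := by rw [map_add, ha m hm, hb m hm, add_zero]
  zero_mem' m _ := map_zero _
  smul_mem' c x hx m hm := by rw [map_smul, hx m hm, smul_zero]

theorem degLT_zero : hp.degLT 0 = ⊥ :=
  (Submodule.eq_bot_iff _).2 fun _ hx => hp.eq_zero_of_forall fun m => hx m (Nat.zero_le m)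

theorem pow_le_degLT {m n : ℕ} (h : m < n) : LinearMap.range S.ι ^ m ≤ hp.degLT n :=
  fun x hx d hd => by rw [hp.proj_of_mem hx, if_neg (by omega)]

/-- The part of Δ(x) with second factor of top degree n is 1 ⊗ x_n, where x_n is the component of x
of degree n. Up to the term 1 ⊗ x, coactions therefore lower the degree; this drives both the search
for coinvariants and the comparison of top degrees. -/
theorem slice_comul_sub_mem_degLT {n : ℕ} {x : R} (hx : x ∈ hp.degLT (n + 1)) (f : R →ₗ[k] k) :
    slice f (S.comul x) - f 1 • x ∈ hp.degLT n := by
  intro m hm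
  rw [map_sub, map_smul, ← slice_lTensor, hp.lTensor_proj_comul fun d hd => hx d (by omega),
    slice_tmul, sub_self]

theorem slice_comul_mem_degLT {n : ℕ} {x : R} (hx : x ∈ hp.degLT n) (f : R →ₗ[k] k) :
    slice f (S.comul x) ∈ hp.degLT n := by
  intro m hm
  rw [← slice_lTensor, hp.lTensor_proj_comul fun d hd => hx d (by omega), slice_tmul,
    hx m hm, smul_zero]

end IsGrading

end BraidedQuotient

/-! ### The projection B(W) → B(V), its kernel and subcomodules -/

namespace DirectSummand

variable {k : Type*} [Field k] {H : Type*} [Ring H] [HopfAlgebra k H]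
variable {W : Type*} [AddCommGroup W] [Module k W] {Y : YetterDrinfeld k H W}
variable {V : Type*} [AddCommGroup V] [Module k V] {Z : YetterDrinfeld k H V}
variable (D : DirectSummand Z Y)

theorem nicholsProj_incl (w : W) : D.nicholsProj (Y.nicholsIncl w) = Z.nicholsIncl (D.proj w) :=
  YetterDrinfeld.nicholsMap_incl _ _ w

theorem nicholsProj_nicholsMap (x : Z.NicholsAlgebra) :
    D.nicholsProj (D.isHom_incl.nicholsMap x) = x := by
  have h : D.nicholsProj.comp D.isHom_incl.nicholsMap = AlgHom.id k Z.NicholsAlgebra := by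
    refine Z.nicholsQuotient.algHom_ext fun v => ?_
    change D.nicholsProj (D.isHom_incl.nicholsMap (Z.nicholsIncl v)) = Z.nicholsIncl v
    rw [IsHom.nicholsMap_incl, nicholsProj_incl, D.leftInverse v]
  exact DFunLike.congr_fun h x

theorem nicholsProj_surjective : Function.Surjective D.nicholsProj :=
  fun x => ⟨_, D.nicholsProj_nicholsMap x⟩

/-- The kernel of the projection `B(W) → B(V)`. -/
def projKer : Submodule k Y.NicholsAlgebra := LinearMap.ker D.nicholsProj.toLinearMap

theorem mem_projKer {x : Y.NicholsAlgebra} : x ∈ D.projKer ↔ D.nicholsProj x = 0 := Iff.rfl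

theorem mul_mem_projKer_left (a : Y.NicholsAlgebra) {x : Y.NicholsAlgebra} (hx : x ∈ D.projKer) :
    a * x ∈ D.projKer := by
  rw [mem_projKer] at hx ⊢
  rw [map_mul, hx, mul_zero]

theorem mul_mem_projKer_right (a : Y.NicholsAlgebra) {x : Y.NicholsAlgebra} (hx : x ∈ D.projKer) :
    x * a ∈ D.projKer := by
  rw [mem_projKer] at hx ⊢
  rw [map_mul, hx, zero_mul]

theorem nicholsProj_act (h : H) (x : Y.NicholsAlgebra) :
    D.nicholsProj (Y.nicholsAct h x) = Z.nicholsAct h (D.nicholsProj x) := by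
  obtain ⟨x, rfl⟩ := Y.nicholsMk_surjective x
  exact congrArg Z.nicholsMk (D.isHom_proj.map_tensorAct h x)

theorem nicholsCoact_nicholsProj (x : Y.NicholsAlgebra) :
    Z.nicholsCoact (D.nicholsProj x) =
      LinearMap.lTensor H D.nicholsProj.toLinearMap (Y.nicholsCoact x) := by
  obtain ⟨x, rfl⟩ := Y.nicholsMk_surjective x
  change LinearMap.lTensor H Z.nicholsMk.toLinearMap (Z.tensorCoact (tensorMap D.proj x)) = _
  rw [D.isHom_proj.map_tensorCoact, nicholsCoact_mk, ← LinearMap.comp_apply,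
    ← LinearMap.comp_apply, ← LinearMap.lTensor_comp, ← LinearMap.lTensor_comp]
  rfl

theorem isYDSubmodule_projKer : IsYDSubmodule Y.nicholsQuotient.act
    Y.nicholsQuotient.coact.toLinearMap D.projKer where
  act_mem h x hx := by
    change D.nicholsProj (Y.nicholsAct h x) = 0
    rw [nicholsProj_act, D.mem_projKer.1 hx, map_zero]
  coact_mem x hx := mem_range_lTensor_iff.2 fun f => by
    change D.nicholsProj.toLinearMap (slice f (Y.nicholsCoact x)) = 0
    rw [← slice_lTensor, ← nicholsCoact_nicholsProj, D.mem_projKer.1 hx, map_zero, map_zero]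

theorem comul_mem_tensorSup_iff {N : Submodule k Y.NicholsAlgebra} {x : Y.NicholsAlgebra} :
    Y.nicholsQuotient.comul x ∈ tensorSup D.projKer N ↔
      ∀ f : Z.NicholsAlgebra →ₗ[k] k,
        slice (f ∘ₗ D.nicholsProj.toLinearMap) (Y.nicholsQuotient.comul x) ∈ N :=
  mem_tensorSup_ker_iff D.nicholsProj_surjective

theorem isSubcomodule_iff_slice {N : Submodule k Y.NicholsAlgebra} :
    IsSubcomodule D.nicholsLeftCoact N ↔ ∀ x ∈ N, ∀ f : Z.NicholsAlgebra →ₗ[k] k,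
      slice (f ∘ₗ D.nicholsProj.toLinearMap) (Y.nicholsQuotient.comul x) ∈ N := by
  refine forall₂_congr fun x _ => ?_
  rw [mem_range_lTensor_iff]
  refine forall_congr' fun f => ?_
  rw [← slice_rTensor]
  rfl

/-- Expressing the condition through Δ itself, modulo the kernel of the projection, makes the
formulas for Δ in B(W) directly applicable. -/
theorem isSubcomodule_iff {N : Submodule k Y.NicholsAlgebra} :
    IsSubcomodule D.nicholsLeftCoact N ↔
      ∀ x ∈ N, Y.nicholsQuotient.comul x ∈ tensorSup D.projKer N := by
  rw [isSubcomodule_iff_slice]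
  exact forall₂_congr fun x _ => D.comul_mem_tensorSup_iff.symm

/-- The coaction of an element of V does not leave H ⊗ V. This matters because stability under ad_c
is only available for elements of V. -/
theorem sweedler_coact_incl {P : Type*} [AddCommGroup P] [Module k P] (v : V) {f : H → W → P}
    (hf : IsBilin k f) :
    sweedler (Y.coact (D.incl v)) f = sweedler (Z.coact v) fun h u => f h (D.incl u) := by
  rw [D.isHom_incl.map_coact, sweedler_lTensor hf]

/-! ### The comultiplication on elements `ad_c x (b)` -/

section Ad

variable {N : Submodule k Y.NicholsAlgebra}

theorem rTensor_mulLeft_mem (a : Y.NicholsAlgebra)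
    {t : Y.NicholsAlgebra ⊗[k] Y.NicholsAlgebra} (ht : t ∈ tensorSup D.projKer N) :
    LinearMap.rTensor Y.NicholsAlgebra (LinearMap.mulLeft k a) t ∈ tensorSup D.projKer N :=
  BraidedQuotient.rTensor_mem_tensorSup (fun _ hx => D.mul_mem_projKer_left a hx) ht

theorem sweedler_braidedMul_mem
    (hN : IsYDSubmodule Y.nicholsQuotient.act Y.nicholsQuotient.coact.toLinearMap N) (w : W)
    {t : Y.NicholsAlgebra ⊗[k] Y.NicholsAlgebra} (ht : t ∈ tensorSup D.projKer N) :
    (sweedler (Y.coact w) fun h v => sweedler (Coalgebra.comul (R := k) h) fun a b =>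
      Y.nicholsQuotient.braidedMul
        (TensorProduct.map (Y.nicholsQuotient.act a) (Y.nicholsQuotient.act b) t)
        (Y.nicholsQuotient.ι v ⊗ₜ 1)) ∈ tensorSup D.projKer N :=
  sweedler_mem _ _ _ fun _ _ => sweedler_mem _ _ _ fun a b =>
    Y.nicholsQuotient.braidedMul_tmul_one_mem_tensorSup hN
      (fun _ _ hx => D.mul_mem_projKer_right _ hx) _
      (Y.nicholsQuotient.map_act_mem_tensorSup D.isYDSubmodule_projKer hN a b ht)

theorem map_act_ad_bilin (t : Y.NicholsAlgebra ⊗[k] Y.NicholsAlgebra) :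
    IsBilin k fun (h : H) (u : W) =>
      TensorProduct.map (Y.nicholsQuotient.act h) (Y.nicholsQuotient.ad u) t := by
  constructor <;> intros <;> simp [BraidedQuotient.ad_add, BraidedQuotient.ad_smul,
    TensorProduct.map_add_left, TensorProduct.map_add_right, TensorProduct.map_smul_left,
    TensorProduct.map_smul_right]

/-- Each of the three terms of `comul_ad` is treated separately: the kernel of the projection is an
ideal and a Yetter-Drinfeld submodule, and N is a Yetter-Drinfeld submodule stable under ad_c V. -/
theorem comul_ad_mem
    (hN : IsYDSubmodule Y.nicholsQuotient.act Y.nicholsQuotient.coact.toLinearMap N)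
    (had : ∀ v, ∀ x ∈ N, Y.nicholsQuotient.ad (D.incl v) x ∈ N) (v : V) {x : Y.NicholsAlgebra}
    (hx : Y.nicholsQuotient.comul x ∈ tensorSup D.projKer N) :
    Y.nicholsQuotient.comul (Y.nicholsQuotient.ad (D.incl v) x) ∈ tensorSup D.projKer N := by
  rw [BraidedQuotient.comul_ad]
  refine sub_mem (add_mem (D.rTensor_mulLeft_mem _ hx) ?_) (D.sweedler_braidedMul_mem hN _ hx)
  rw [D.sweedler_coact_incl v (map_act_ad_bilin _)]
  refine sweedler_mem _ _ _ fun h u => map_mem_tensorSup _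
    (fun a ha b => tmul_mem_tensorSup_left _ (D.isYDSubmodule_projKer.act_mem h a ha) _)
    (fun a b hb => tmul_mem_tensorSup_right _ _ (had u b hb)) hx

/-- If `Δ(x)` and all `Δ(ad_c v (x))`, `v ∈ V`, lie in `K ⊗ B(W) + B(W) ⊗ N`, then so do all
`(id ⊗ ad_c v) Δ(x)`. -/
theorem lTensor_ad_comul_mem
    (hN : IsYDSubmodule Y.nicholsQuotient.act Y.nicholsQuotient.coact.toLinearMap N)
    {x : Y.NicholsAlgebra} (hx : Y.nicholsQuotient.comul x ∈ tensorSup D.projKer N)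
    (hadx : ∀ v, Y.nicholsQuotient.comul (Y.nicholsQuotient.ad (D.incl v) x) ∈
      tensorSup D.projKer N) (v : V) :
    LinearMap.lTensor Y.NicholsAlgebra (Y.nicholsQuotient.ad (D.incl v))
      (Y.nicholsQuotient.comul x) ∈ tensorSup D.projKer N := by
  -- The formula `comul_ad` solved for its middle term; the two other terms depend only on Δ(x).
  have key : ∀ u : V, (sweedler (Y.coact (D.incl u)) fun c w =>
      TensorProduct.map (Y.nicholsQuotient.act c) (Y.nicholsQuotient.ad w)
        (Y.nicholsQuotient.comul x)) ∈ tensorSup D.projKer N := fun u => by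
    have h1 := Y.nicholsQuotient.comul_ad (D.incl u) x
    rw [eq_sub_iff_add_eq, add_comm (LinearMap.rTensor _ _ _), ← sub_eq_iff_eq_add] at h1
    rw [← h1]
    exact sub_mem (add_mem (hadx u) (D.sweedler_braidedMul_mem hN _ hx))
      (D.rTensor_mulLeft_mem _ hx)
  -- The action of c on the first factor is removed by the antipode, which preserves the kernel of
  -- the projection there.
  rw [BraidedQuotient.lTensor_ad_eq, D.isHom_incl.map_coact, sweedler_lTensor]
  · exact sweedler_mem _ _ _ fun h u => BraidedQuotient.rTensor_mem_tensorSup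
      (fun y hy => D.isYDSubmodule_projKer.act_mem _ y hy) (key u)
  · have hb := map_act_ad_bilin (Y.nicholsQuotient.comul x)
    have h2 : ∀ (w : W), (sweedler (Y.coact w) fun c u =>
        TensorProduct.map (Y.nicholsQuotient.act c) (Y.nicholsQuotient.ad u)
          (Y.nicholsQuotient.comul x)) = (hb.lift ∘ₗ Y.coact) w :=
      fun w => sweedler_eq_lift hb _
    simp only [h2]
    constructor <;> intros <;> simp [LinearMap.rTensor_add, LinearMap.rTensor_smul]

end Ad

end DirectSummand

end YetterDrinfeld

namespace YetterDrinfeld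

namespace DirectSummand

variable {k : Type*} [Field k] {H : Type*} [Ring H] [HopfAlgebra k H]
variable {W : Type*} [AddCommGroup W] [Module k W] {Y : YetterDrinfeld k H W}
variable {V : Type*} [AddCommGroup V] [Module k V] {Z : YetterDrinfeld k H V}
variable (D : DirectSummand Z Y)

/-! ### The module `L` -/

section L

variable {U : Submodule k W}

/-- The induction principle for L: properties of its elements are proved by taking for N the
subspace they define. -/
theorem L_le {N : Submodule k Y.NicholsAlgebra} (hU : ∀ y ∈ U, Y.nicholsIncl y ∈ N)
    (had : ∀ v, ∀ x ∈ N, Y.nicholsQuotient.ad (D.incl v) x ∈ N) : D.L U ≤ N := by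
  refine Submodule.span_le.2 ?_
  rintro _ ⟨l, y, hy, rfl⟩
  induction l with
  | nil => exact hU y hy
  | cons v l ih => exact had v _ ih

theorem incl_mem_L {y : W} (hy : y ∈ U) : Y.nicholsIncl y ∈ D.L U :=
  Submodule.subset_span ⟨[], y, hy, rfl⟩

theorem ad_mem_L (v : V) {x : Y.NicholsAlgebra} (hx : x ∈ D.L U) :
    Y.nicholsQuotient.ad (D.incl v) x ∈ D.L U := by
  have h : D.L U ≤ (D.L U).comap (Y.nicholsQuotient.ad (D.incl v)) := by
    refine Submodule.span_le.2 ?_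
    rintro _ ⟨l, y, hy, rfl⟩
    exact Submodule.subset_span ⟨v :: l, y, hy, rfl⟩
  exact h hx

theorem isYDSubmodule_L (hU : IsYDSubmodule Y.act.toLinearMap Y.coact U) :
    IsYDSubmodule Y.nicholsQuotient.act Y.nicholsQuotient.coact.toLinearMap (D.L U) where
  act_mem h x hx := by
    -- All translates are controlled at once, since h · ad_c v (x) involves both h₁ · v and h₂ · x.
    let N : Submodule k Y.NicholsAlgebra :=
      D.L U ⊓ ⨅ h, (D.L U).comap (Y.nicholsQuotient.act h)
    have hN : D.L U ≤ N := by
      refine D.L_le (fun y hy => ⟨D.incl_mem_L hy, ?_⟩) fun v x hx => ⟨D.ad_mem_L v hx.1, ?_⟩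
      · rw [SetLike.mem_coe, Submodule.mem_iInf]
        intro g
        rw [Submodule.mem_comap]
        refine (Y.nicholsQuotient.act_ι g y).symm ▸ ?_
        exact D.incl_mem_L (hU.act_mem g y hy)
      · rw [SetLike.mem_coe, Submodule.mem_iInf]
        intro g
        rw [Submodule.mem_comap, BraidedQuotient.act_ad]
        refine sweedler_mem _ _ _ fun a b => ?_
        rw [← D.isHom_incl.map_act]
        exact D.ad_mem_L _ ((Submodule.mem_iInf _).1 hx.2 b)
    exact (Submodule.mem_iInf _).1 (hN hx).2 h
  coact_mem x hx := by
    let N : Submodule k Y.NicholsAlgebra := D.L U ⊓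
      (LinearMap.range (LinearMap.lTensor H (D.L U).subtype)).comap
        Y.nicholsQuotient.coact.toLinearMap
    have hN : D.L U ≤ N := by
      refine D.L_le (fun y hy => ⟨D.incl_mem_L hy, ?_⟩) fun v x hx => ⟨D.ad_mem_L v hx.1, ?_⟩
      · change Y.nicholsQuotient.coact (Y.nicholsQuotient.ι y) ∈
          LinearMap.range (LinearMap.lTensor H (D.L U).subtype)
        rw [BraidedQuotient.coact_ι, mem_range_lTensor_iff]
        intro f
        rw [slice_lTensor]
        exact D.incl_mem_L (mem_range_lTensor_iff.1 (hU.coact_mem y hy) f)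
      · change Y.nicholsQuotient.coact (Y.nicholsQuotient.ad (D.incl v) x) ∈
          LinearMap.range (LinearMap.lTensor H (D.L U).subtype)
        have hb : IsBilin k fun (g : H) (w : W) => (g ⊗ₜ[k] (1 : Y.NicholsAlgebra)) *
            LinearMap.lTensor H (Y.nicholsQuotient.ad w) (Y.nicholsQuotient.coact x) := by
          constructor <;> intros <;> simp only [BraidedQuotient.ad_add,
            BraidedQuotient.ad_smul, TensorProduct.add_tmul, add_mul, mul_add,
            LinearMap.lTensor_add, LinearMap.lTensor_smul, LinearMap.add_apply,
            LinearMap.smul_apply, ← TensorProduct.smul_tmul']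
          · exact smul_mul_assoc _ _ _
          · exact mul_smul_comm _ _ _
        rw [BraidedQuotient.coact_ad, D.sweedler_coact_incl v hb]
        refine sweedler_mem _ _ _ fun g u => ?_
        obtain ⟨s, hs⟩ := hx.2
        rw [AlgHom.toLinearMap_apply] at hs
        rw [← hs]
        clear hs
        induction s with
        | zero => simp
        | add a b ha hb => simp only [map_add, mul_add]; exact add_mem ha hb
        | tmul g' z =>
          exact ⟨(g * g') ⊗ₜ ⟨_, D.ad_mem_L u z.2⟩, by simp⟩
    exact (hN hx).2

theorem L_le_projKer (hU : U ≤ LinearMap.ker D.proj) : D.L U ≤ D.projKer := by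
  refine D.L_le (fun y hy => ?_) fun v x hx => ?_
  · rw [mem_projKer, nicholsProj_incl, LinearMap.mem_ker.1 (hU hy), map_zero]
  · rw [BraidedQuotient.ad_apply]
    exact sub_mem (D.mul_mem_projKer_left _ hx) (sweedler_mem _ _ _ fun h w =>
      D.mul_mem_projKer_right _ (D.isYDSubmodule_projKer.act_mem h x hx))

/-- `L` is a `B(V)`-subcomodule. -/
theorem isSubcomodule_L (hU : U ≤ LinearMap.ker D.proj)
    (hYD : IsYDSubmodule Y.act.toLinearMap Y.coact U) :
    IsSubcomodule D.nicholsLeftCoact (D.L U) := by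
  rw [isSubcomodule_iff]
  have hN : D.L U ≤ D.L U ⊓ (tensorSup D.projKer (D.L U)).comap Y.nicholsQuotient.comul := by
    refine D.L_le (fun y hy => ⟨D.incl_mem_L hy, ?_⟩) fun v x hx => ⟨D.ad_mem_L v hx.1, ?_⟩
    · change Y.nicholsQuotient.comul (Y.nicholsQuotient.ι y) ∈ tensorSup D.projKer (D.L U)
      rw [BraidedQuotient.comul_ι]
      exact add_mem (tmul_mem_tensorSup_left _ (D.L_le_projKer hU (D.incl_mem_L hy)) _)
        (tmul_mem_tensorSup_right _ _ (D.incl_mem_L hy))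
    · exact D.comul_ad_mem (D.isYDSubmodule_L hYD) (fun v x hx => D.ad_mem_L v hx) v hx.2
  exact fun x hx => (hN hx).2

/-- For `x ∈ L`, the element `Δ(x) - x ⊗ 1` lies in `B(V) ⊗ B(W)`. -/
theorem comul_sub_mem_range (U : Submodule k W) {x : Y.NicholsAlgebra} (hx : x ∈ D.L U) :
    Y.nicholsQuotient.comul x - x ⊗ₜ 1 ∈ LinearMap.range
      (LinearMap.rTensor Y.NicholsAlgebra D.isHom_incl.nicholsMap.toLinearMap) := by
  let S := Y.nicholsQuotient
  let j := D.isHom_incl.nicholsMap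
  let A := LinearMap.range (LinearMap.rTensor Y.NicholsAlgebra j.toLinearMap)
  have hj : ∀ v, S.ι (D.incl v) = j (Z.nicholsIncl v) :=
    fun v => (D.isHom_incl.nicholsMap_incl v).symm
  have hA : ∀ (a : Z.NicholsAlgebra) (b : Y.NicholsAlgebra), j a ⊗ₜ b ∈ A :=
    fun a b => ⟨a ⊗ₜ b, rfl⟩
  have hmap : ∀ φ : Y.NicholsAlgebra ⊗[k] Y.NicholsAlgebra →ₗ[k]
      Y.NicholsAlgebra ⊗[k] Y.NicholsAlgebra, (∀ a b, φ (j a ⊗ₜ b) ∈ A) → ∀ s ∈ A, φ s ∈ A := by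
    rintro φ hφ _ ⟨s, rfl⟩
    induction s with
    | zero => simp
    | add a b ha hb => simp only [map_add]; exact add_mem ha hb
    | tmul a b => exact hφ a b
  let N : Submodule k Y.NicholsAlgebra :=
    A.comap (S.comul - (TensorProduct.mk k Y.NicholsAlgebra Y.NicholsAlgebra).flip 1)
  refine D.L_le (N := N) (fun y _ => ?_) (fun v x hx => ?_) hx
  · change S.comul (S.ι y) - S.ι y ⊗ₜ 1 ∈ A
    rw [BraidedQuotient.comul_ι, add_sub_cancel_left, ← map_one j]
    exact hA _ _
  · change S.comul (S.ad (D.incl v) x) - S.ad (D.incl v) x ⊗ₜ 1 ∈ A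
    have hx' : S.comul x - x ⊗ₜ 1 ∈ A := hx
    obtain ⟨s, hs⟩ : ∃ s, s = S.comul x - x ⊗ₜ 1 := ⟨_, rfl⟩
    rw [← hs] at hx'
    have hc : S.comul x = x ⊗ₜ 1 + s := by rw [hs]; abel
    have hb : IsBilin k fun (h : H) (u : W) => TensorProduct.map (S.act h) (S.ad u) s :=
      map_act_ad_bilin s
    have h1 : (sweedler (Y.coact (D.incl v)) fun h w => sweedler (Coalgebra.comul (R := k) h)
        fun a b => S.braidedMul (TensorProduct.map (S.act a) (S.act b) (x ⊗ₜ 1)) (S.ι w ⊗ₜ 1)) =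
        sweedler (Y.coact (D.incl v)) fun h w => (S.act h x * S.ι w) ⊗ₜ 1 := by
      congr 1; funext h w
      have h2 : ∀ p : Y.NicholsAlgebra,
          S.braidedMul (p ⊗ₜ 1) (S.ι w ⊗ₜ 1) = (p * S.ι w) ⊗ₜ 1 := fun p => by
        rw [BraidedQuotient.braidedMul_tmul_apply, map_one, BraidedQuotient.actMul_one]
        simp
      simp only [TensorProduct.map_tmul, BraidedQuotient.act_one, TensorProduct.tmul_smul,
        map_smul, LinearMap.smul_apply, h2]
      refine sweedler_comul_counit_right h (f := fun a => (S.act a x * S.ι w) ⊗ₜ[k] 1) ?_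
      constructor <;> intros <;> simp [add_mul, TensorProduct.add_tmul,
        ← TensorProduct.smul_tmul']
    -- The contribution of x ⊗ 1 to `comul_ad` is exactly ad_c v (x) ⊗ 1, because ad_c kills 1. What
    -- remains depends only on s, whose first factors come from B(V).
    have h3 : S.comul (S.ad (D.incl v) x) - S.ad (D.incl v) x ⊗ₜ 1 =
        LinearMap.rTensor Y.NicholsAlgebra (LinearMap.mulLeft k (S.ι (D.incl v))) s +
        (sweedler (Z.coact v) fun h u => TensorProduct.map (S.act h) (S.ad (D.incl u)) s) -
        sweedler (Y.coact (D.incl v)) fun h w => sweedler (Coalgebra.comul (R := k) h)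
          fun a b => S.braidedMul (TensorProduct.map (S.act a) (S.act b) s) (S.ι w ⊗ₜ 1) := by
      rw [← D.sweedler_coact_incl v hb, BraidedQuotient.comul_ad, hc]
      simp only [map_add, LinearMap.add_apply, sweedler_add_fun]
      rw [h1]
      simp only [TensorProduct.map_tmul, BraidedQuotient.ad_one, TensorProduct.tmul_zero,
        sweedler_zero_fun, LinearMap.rTensor_tmul, LinearMap.mulLeft_apply]
      rw [S.ad_apply (D.incl v) x]
      simp only [TensorProduct.sub_tmul, sweedler_tmul_right]
      abel
    rw [h3]
    refine sub_mem (add_mem ?_ (sweedler_mem _ _ _ fun h u => ?_)) ?_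
    · refine hmap _ (fun a b => ?_) s hx'
      rw [hj, LinearMap.rTensor_tmul, LinearMap.mulLeft_apply, ← map_mul]
      exact hA _ _
    · refine hmap _ (fun a b => ?_) s hx'
      have h4 : S.act h (j a) = j (Z.nicholsAct h a) := (D.isHom_incl.nicholsMap_act h a).symm
      rw [TensorProduct.map_tmul, h4]
      exact hA _ _
    -- F and G exhibit the double Sweedler sum as bilinear in h and w, so that the coaction of `incl
    -- v` may be replaced by that of v. The first factors are then multiplied by elements of B(V)
    -- only.
    · let F : W →ₗ[k] Module.End k (Y.NicholsAlgebra ⊗[k] Y.NicholsAlgebra) :=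
        S.braidedMul.flip ∘ₗ
          (TensorProduct.mk k Y.NicholsAlgebra Y.NicholsAlgebra).flip 1 ∘ₗ S.ι
      let G : H →ₗ[k] Y.NicholsAlgebra ⊗[k] Y.NicholsAlgebra :=
        LinearMap.applyₗ s ∘ₗ TensorProduct.homTensorHomMap (RingHom.id k) _ _ _ _ ∘ₗ
          TensorProduct.map S.act S.act ∘ₗ Coalgebra.comul
      have hG : ∀ h, G h = sweedler (Coalgebra.comul (R := k) h) fun a b =>
          TensorProduct.map (S.act a) (S.act b) s := fun h => by
        change (LinearMap.applyₗ s ∘ₗ TensorProduct.homTensorHomMap (RingHom.id k) _ _ _ _ ∘ₗ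
          TensorProduct.map S.act S.act) (Coalgebra.comul h) = _
        rw [← sweedler_linearMap]
        rfl
      have hFG : ∀ h w, (sweedler (Coalgebra.comul (R := k) h) fun a b =>
          S.braidedMul (TensorProduct.map (S.act a) (S.act b) s) (S.ι w ⊗ₜ 1)) = F w (G h) := by
        intro h w
        rw [hG, map_sweedler]
        rfl
      simp only [hFG]
      rw [D.sweedler_coact_incl]
      · refine sweedler_mem _ _ _ fun h u => ?_
        rw [← hFG]
        refine sweedler_mem _ _ _ fun a b => ?_
        refine hmap ((S.braidedMul.flip (S.ι (D.incl u) ⊗ₜ 1)) ∘ₗ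
          TensorProduct.map (S.act a) (S.act b)) (fun c d => ?_) s hx'
        have h4 : ∀ (h : H) c, S.act h (j c) = j (Z.nicholsAct h c) :=
          fun h c => (D.isHom_incl.nicholsMap_act h c).symm
        rw [LinearMap.comp_apply, TensorProduct.map_tmul, LinearMap.flip_apply,
          BraidedQuotient.braidedMul_tmul]
        refine sweedler_mem _ _ _ fun e z => ?_
        rw [hj, h4, h4, ← map_mul]
        exact hA _ _
      · constructor <;> intros <;> simp

/-- Coinvariant elements of `L` are primitive. -/
theorem mem_primitives_of_coinvariant (hU : U ≤ LinearMap.ker D.proj) {x : Y.NicholsAlgebra}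
    (hx : x ∈ D.L U) (hco : D.nicholsLeftCoact x = 1 ⊗ₜ x) :
    x ∈ Y.nicholsQuotient.primitives := by
  rw [BraidedQuotient.mem_primitives]
  obtain ⟨s, hs⟩ := D.comul_sub_mem_range U hx
  -- B(V) → B(W) is split by the projection, so s is recovered from its image. The projection also
  -- kills x ⊗ 1, and coinvariance identifies what is left as 1 ⊗ x.
  have h1 : LinearMap.rTensor Y.NicholsAlgebra D.nicholsProj.toLinearMap
      (LinearMap.rTensor Y.NicholsAlgebra D.isHom_incl.nicholsMap.toLinearMap s) = s := by
    rw [← LinearMap.comp_apply, ← LinearMap.rTensor_comp]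
    have h2 : D.nicholsProj.toLinearMap ∘ₗ D.isHom_incl.nicholsMap.toLinearMap =
        LinearMap.id := LinearMap.ext D.nicholsProj_nicholsMap
    rw [h2, LinearMap.rTensor_id, LinearMap.id_apply]
  have h3 : s = 1 ⊗ₜ x := by
    rw [← h1, hs, map_sub, LinearMap.rTensor_tmul, AlgHom.toLinearMap_apply,
      D.mem_projKer.1 (D.L_le_projKer hU hx), TensorProduct.zero_tmul, sub_zero]
    exact hco
  rw [h3, LinearMap.rTensor_tmul, AlgHom.toLinearMap_apply, map_one] at hs
  rw [hs]
  abel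

/-- ad_c raises degrees by one and U sits in degree one, so degree zero is empty and only U itself
contributes to degree one. -/
theorem L_proj (U : Submodule k W) {x : Y.NicholsAlgebra} (hx : x ∈ D.L U) :
    Y.nicholsDegProj 0 x = 0 ∧ Y.nicholsDegProj 1 x ∈ U.map Y.nicholsIncl := by
  have hp := Y.isGrading_nicholsDegProj
  have h : D.L U ≤ LinearMap.ker (Y.nicholsDegProj 0) ⊓
      (U.map Y.nicholsIncl).comap (Y.nicholsDegProj 1) := by
    refine D.L_le (fun y hy => ?_) fun v x hx => ?_
    · have h1 : Y.nicholsIncl y = Y.nicholsQuotient.ι y * 1 := (mul_one _).symm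
      rw [h1]
      refine ⟨hp.zero_ι_mul y 1, ?_⟩
      rw [SetLike.mem_coe, Submodule.mem_comap, hp.succ_ι_mul, hp.zero_one, mul_one]
      exact Submodule.mem_map_of_mem hy
    · refine ⟨hp.proj_zero_ad _ _, ?_⟩
      rw [SetLike.mem_coe, Submodule.mem_comap, hp.proj_succ_ad, LinearMap.mem_ker.1 hx.1,
        map_zero]
      exact zero_mem _
  exact h hx

/-- Primitive elements of `L` lie in `U`. -/
theorem mem_map_incl_of_mem_primitives {x : Y.NicholsAlgebra} (hx : x ∈ D.L U)
    (hP : x ∈ Y.nicholsQuotient.primitives) : x ∈ U.map Y.nicholsIncl := by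
  have hp := Y.isGrading_nicholsDegProj
  have h := D.L_proj U hx
  have h1 : ∀ m ≠ 1, Y.nicholsDegProj m x = 0 := by
    intro m hm
    match m, hm with
    | 0, _ => exact h.1
    | n + 2, _ =>
      exact Y.eq_zero_of_mem_primitives (hp.proj_mem_primitives hP (n + 1)) (hp.proj_mem _ x)
  rw [hp.eq_of_forall_ne 1 h1]
  exact h.2

end L

/-! ### The subcomodule generated by a subspace -/

/-- The smallest `B(V)`-subcomodule of `B(W)` containing the subspace `L'`. -/
def subcomoduleClosure (L' : Submodule k Y.NicholsAlgebra) : Submodule k Y.NicholsAlgebra :=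
  sInf {N | IsSubcomodule D.nicholsLeftCoact N ∧ L' ≤ N}

variable {L' : Submodule k Y.NicholsAlgebra}

theorem le_subcomoduleClosure : L' ≤ D.subcomoduleClosure L' := le_sInf fun _ hN => hN.2

theorem subcomoduleClosure_le {N : Submodule k Y.NicholsAlgebra}
    (hN : IsSubcomodule D.nicholsLeftCoact N) (h : L' ≤ N) : D.subcomoduleClosure L' ≤ N :=
  sInf_le ⟨hN, h⟩

theorem isSubcomodule_subcomoduleClosure :
    IsSubcomodule D.nicholsLeftCoact (D.subcomoduleClosure L') := by
  rw [isSubcomodule_iff_slice]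
  intro x hx f
  rw [subcomoduleClosure, Submodule.mem_sInf] at hx ⊢
  exact fun N hN => D.isSubcomodule_iff_slice.1 hN.1 x (hx N hN) f

theorem comul_mem_subcomoduleClosure {x : Y.NicholsAlgebra} (hx : x ∈ D.subcomoduleClosure L') :
    Y.nicholsQuotient.comul x ∈ tensorSup D.projKer (D.subcomoduleClosure L') :=
  D.isSubcomodule_iff.1 D.isSubcomodule_subcomoduleClosure x hx

/-- To show that a family of operators maps the subcomodule closure into itself it suffices to
check this on `L'` and to check that it extends along the coaction. -/
theorem map_mem_subcomoduleClosure {I : Type*}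
    (φ : I → Y.NicholsAlgebra →ₗ[k] Y.NicholsAlgebra)
    (h1 : ∀ i, ∀ x ∈ L', φ i x ∈ D.subcomoduleClosure L')
    (h2 : ∀ x ∈ D.subcomoduleClosure L', (∀ i, φ i x ∈ D.subcomoduleClosure L') → ∀ i,
      LinearMap.lTensor Y.NicholsAlgebra (φ i) (Y.nicholsQuotient.comul x) ∈
        tensorSup D.projKer (D.subcomoduleClosure L')) (i : I) {x : Y.NicholsAlgebra}
    (hx : x ∈ D.subcomoduleClosure L') : φ i x ∈ D.subcomoduleClosure L' := by
  -- The elements of the closure that all operators keep inside it. This is a subcomodule containing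
  -- L', hence the whole closure. The family is treated jointly because h2 for one index may use the
  -- other operators.
  let N : Submodule k Y.NicholsAlgebra :=
    D.subcomoduleClosure L' ⊓ ⨅ i, (D.subcomoduleClosure L').comap (φ i)
  have hN : IsSubcomodule D.nicholsLeftCoact N := by
    rw [isSubcomodule_iff_slice]
    refine fun y hy f => ⟨D.isSubcomodule_iff_slice.1 D.isSubcomodule_subcomoduleClosure y hy.1 f,
      ?_⟩
    rw [SetLike.mem_coe, Submodule.mem_iInf]
    intro i
    rw [Submodule.mem_comap, ← slice_lTensor]
    exact (mem_tensorSup_ker_iff D.nicholsProj_surjective).1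
      (h2 y hy.1 (fun i => (Submodule.mem_iInf _).1 hy.2 i) i) f
  have hL : L' ≤ N := fun y hy => ⟨D.le_subcomoduleClosure hy, by
    rw [SetLike.mem_coe, Submodule.mem_iInf]
    exact fun i => h1 i y hy⟩
  exact (Submodule.mem_iInf _).1 (D.subcomoduleClosure_le hN hL hx).2 i

/-- The subcomodule generated by a Yetter-Drinfeld submodule is a Yetter-Drinfeld submodule. -/
theorem isYDSubmodule_subcomoduleClosure
    (hS : Function.Bijective (HopfAlgebra.antipode k (A := H)))
    (hL : IsYDSubmodule Y.nicholsQuotient.act Y.nicholsQuotient.coact.toLinearMap L') :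
    IsYDSubmodule Y.nicholsQuotient.act Y.nicholsQuotient.coact.toLinearMap
      (D.subcomoduleClosure L') where
  act_mem h x hx := by
    refine D.map_mem_subcomoduleClosure Y.nicholsQuotient.act
      (fun h x hx => D.le_subcomoduleClosure (hL.act_mem h x hx)) (fun x hx hxa h => ?_) h hx
    -- The inner sum is Δ(b · x), and b · x belongs to the closure by assumption; the outer
    -- operation affects the first factor only.
    rw [BraidedQuotient.lTensor_act_eq]
    refine sweedler_mem _ _ _ fun a b => BraidedQuotient.rTensor_mem_tensorSup
      (fun y hy => D.isYDSubmodule_projKer.act_mem _ y hy) ?_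
    rw [← BraidedQuotient.comul_act]
    exact D.comul_mem_subcomoduleClosure (hxa b)
  coact_mem x hx := by
    rw [mem_range_lTensor_iff]
    intro φ
    refine D.map_mem_subcomoduleClosure
      (fun φ : H →ₗ[k] k => slice φ ∘ₗ Y.nicholsQuotient.coact.toLinearMap)
      (fun φ x hx => D.le_subcomoduleClosure (mem_range_lTensor_iff.1 (hL.coact_mem x hx) φ))
      (fun x hx hxa φ => ?_) φ hx
    -- By colinearity of Δ, the slices of this element are Δ of the slices of the coaction of x,
    -- which belong to the closure by assumption.
    have hmem : Y.nicholsQuotient.coact₂ (Y.nicholsQuotient.comul x) ∈ LinearMap.range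
        (LinearMap.lTensor H (tensorSup D.projKer (D.subcomoduleClosure L')).subtype) := by
      rw [BraidedQuotient.coact₂_comul, mem_range_lTensor_iff]
      intro ψ
      rw [slice_lTensor]
      exact D.comul_mem_subcomoduleClosure (hxa ψ)
    rw [Y.nicholsQuotient.lTensor_slice_coact_eq hS]
    refine sweedler_mem_of_mem_range_lTensor _ hmem ?_ fun g s hs =>
      BraidedQuotient.rTensor_mem_tensorSup (fun y hy =>
        mem_range_lTensor_iff.1 (D.isYDSubmodule_projKer.coact_mem y hy) _) hs
    have hadd : ∀ (f g : H →ₗ[k] k),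
        (slice (f + g) : H ⊗[k] Y.NicholsAlgebra →ₗ[k] Y.NicholsAlgebra) =
        slice f + slice g := fun f g =>
      TensorProduct.ext' fun a b => by simp [add_smul]
    have hsmul : ∀ (c : k) (f : H →ₗ[k] k),
        (slice (c • f) : H ⊗[k] Y.NicholsAlgebra →ₗ[k] Y.NicholsAlgebra) =
        c • slice f := fun c f =>
      TensorProduct.ext' fun a b => by simp [mul_smul]
    have hr : ∀ a b : H, LinearMap.mulRight k (a + b) =
        LinearMap.mulRight k a + LinearMap.mulRight k b := fun a b => by
      ext; simp [mul_add]
    have hrs : ∀ (c : k) (a : H), LinearMap.mulRight k (c • a) =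
        c • LinearMap.mulRight k a := fun c a => by
      ext; simp
    constructor <;> intros <;> simp [hr, hrs, LinearMap.comp_add, LinearMap.add_comp,
      LinearMap.comp_smul, LinearMap.smul_comp, hadd, hsmul, LinearMap.rTensor_add,
      LinearMap.rTensor_smul]

/-- On L' the operators ad_c v vanish, so they trivially stay in the closure, and
`lTensor_ad_comul_mem` propagates this along the coaction. -/
theorem ad_mem_subcomoduleClosure (hS : Function.Bijective (HopfAlgebra.antipode k (A := H)))
    (hL : IsYDSubmodule Y.nicholsQuotient.act Y.nicholsQuotient.coact.toLinearMap L')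
    (had : ∀ v, ∀ x ∈ L', Y.nicholsQuotient.ad (D.incl v) x = 0) (v : V) {x : Y.NicholsAlgebra}
    (hx : x ∈ D.subcomoduleClosure L') :
    Y.nicholsQuotient.ad (D.incl v) x ∈ D.subcomoduleClosure L' := by
  refine D.map_mem_subcomoduleClosure (fun v => Y.nicholsQuotient.ad (D.incl v))
    (fun v x hx => by rw [had v x hx]; exact zero_mem _) (fun x hx hxa v => ?_) v hx
  exact D.lTensor_ad_comul_mem (D.isYDSubmodule_subcomoduleClosure hS hL)
    (D.comul_mem_subcomoduleClosure hx) (fun v => D.comul_mem_subcomoduleClosure (hxa v)) v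

/-- A nonzero subcomodule of `L` contains a nonzero element of `U`. -/
theorem exists_incl_mem {U : Submodule k W} (hU : U ≤ LinearMap.ker D.proj)
    {N : Submodule k Y.NicholsAlgebra} (hN : IsSubcomodule D.nicholsLeftCoact N)
    (hNL : N ≤ D.L U) (hN0 : N ≠ ⊥) : ∃ u ∈ U, Y.nicholsIncl u ∈ N ∧ u ≠ 0 := by
  classical
  have hp := Y.isGrading_nicholsDegProj
  -- The least such n bounds the degree of a lowest element of N. It is of the form m + 1, since
  -- nothing nonzero has degree less than 0.
  have hex : ∃ n, N ⊓ hp.degLT n ≠ ⊥ := by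
    obtain ⟨x, hx, hx0⟩ := Submodule.exists_mem_ne_zero_of_ne_bot hN0
    obtain ⟨n, hn, -⟩ := hp.exists_eq_sum x
    exact ⟨n, fun h => hx0 ((Submodule.eq_bot_iff _).1 h x ⟨hx, hn⟩)⟩
  obtain ⟨m, hm⟩ : ∃ m, Nat.find hex = m + 1 := by
    refine Nat.exists_eq_succ_of_ne_zero fun h0 => Nat.find_spec hex ?_
    rw [h0, hp.degLT_zero, inf_bot_eq]
  have h1 : N ⊓ hp.degLT (m + 1) ≠ ⊥ := hm ▸ Nat.find_spec hex
  have h2 : N ⊓ hp.degLT m = ⊥ := by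
    by_contra h
    exact Nat.find_min hex (by omega) h
  obtain ⟨x, hx, hx0⟩ := Submodule.exists_mem_ne_zero_of_ne_bot h1
  -- Every slice of the difference lies in N and has degree less than m, so it is zero by
  -- minimality.
  have hco : D.nicholsLeftCoact x = 1 ⊗ₜ x := by
    rw [← sub_eq_zero]
    refine eq_zero_of_slice_eq_zero fun f => ?_
    refine (Submodule.eq_bot_iff _).1 h2 _ ⟨?_, ?_⟩
    · rw [map_sub, slice_tmul]
      refine sub_mem ?_ (N.smul_mem _ hx.1)
      exact mem_range_lTensor_iff.1 (hN x hx.1) f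
    · have h3 := hp.slice_comul_sub_mem_degLT hx.2 (f ∘ₗ D.nicholsProj.toLinearMap)
      rw [← slice_rTensor, LinearMap.comp_apply, AlgHom.toLinearMap_apply, map_one] at h3
      rw [map_sub, slice_tmul]
      exact h3
  obtain ⟨u, hu, hux⟩ := D.mem_map_incl_of_mem_primitives (hNL hx.1)
    (D.mem_primitives_of_coinvariant hU (hNL hx.1) hco)
  refine ⟨u, hu, hux ▸ hx.1, ?_⟩
  rintro rfl
  rw [map_zero] at hux
  exact hx0 hux.symm

/-- A nonzero Yetter-Drinfeld submodule of `L` which is annihilated by `ad_c v` for `v ∈ V`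
generates `L` as a comodule if `U` is irreducible. -/
theorem subcomoduleClosure_eq_L (hS : Function.Bijective (HopfAlgebra.antipode k (A := H)))
    {U : Submodule k W} (hU : U ≤ LinearMap.ker D.proj)
    (hirr : IsIrreducibleYDSubmodule Y.act.toLinearMap Y.coact U)
    (hL : IsYDSubmodule Y.nicholsQuotient.act Y.nicholsQuotient.coact.toLinearMap L')
    (hL0 : L' ≠ ⊥) (hLL : L' ≤ D.L U)
    (had : ∀ v, ∀ x ∈ L', Y.nicholsQuotient.ad (D.incl v) x = 0) :
    D.subcomoduleClosure L' = D.L U := by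
  have hle : D.subcomoduleClosure L' ≤ D.L U :=
    D.subcomoduleClosure_le (D.isSubcomodule_L hU hirr.isYDSubmodule) hLL
  refine le_antisymm hle (D.L_le (fun y hy => ?_)
    fun v x hx => D.ad_mem_subcomoduleClosure hS hL had v hx)
  have hN0 : D.subcomoduleClosure L' ≠ ⊥ :=
    fun h => hL0 (le_bot_iff.1 (h ▸ D.le_subcomoduleClosure))
  have hYD := D.isYDSubmodule_subcomoduleClosure hS hL
  obtain ⟨u, hu, huN, hu0⟩ := D.exists_incl_mem hU D.isSubcomodule_subcomoduleClosure hle hN0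
  -- The intersection contains u ≠ 0, so irreducibility forces it to be U.
  have hU' : IsYDSubmodule Y.act.toLinearMap Y.coact
      (U ⊓ (D.subcomoduleClosure L').comap Y.nicholsIncl) := by
    refine BraidedQuotient.isYDSubmodule_inf hirr.isYDSubmodule
      ⟨fun h x hx => ?_, fun x hx => ?_⟩
    · have h2 : Y.nicholsQuotient.act h (Y.nicholsIncl x) = Y.nicholsIncl (Y.act h x) :=
        Y.nicholsQuotient.act_ι h x
      have h1 := hYD.act_mem h _ hx
      rw [h2] at h1
      exact h1
    · rw [mem_range_lTensor_iff]
      intro f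
      have h1 := mem_range_lTensor_iff.1 (hYD.coact_mem _ hx) f
      have h2 : Y.nicholsQuotient.coact.toLinearMap (Y.nicholsIncl x) =
          LinearMap.lTensor H Y.nicholsIncl (Y.coact x) := Y.nicholsQuotient.coact_ι x
      rw [h2, slice_lTensor] at h1
      exact h1
  rcases hirr.eq_bot_or_eq _ inf_le_left hU' with h | h
  · exact absurd ((Submodule.eq_bot_iff _).1 h u ⟨hu, huN⟩) hu0
  · rw [← h] at hy
    exact hy.2

theorem isYDSubmodule_LDeg {U : Submodule k W}
    (hU : IsYDSubmodule Y.act.toLinearMap Y.coact U) (n : ℕ) :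
    IsYDSubmodule Y.nicholsAct Y.nicholsCoact (D.LDeg U n) :=
  BraidedQuotient.isYDSubmodule_inf (D.isYDSubmodule_L hU)
    (Y.isGrading_nicholsDegProj.isYDSubmodule_pow n)

/-- ad_c v raises the degree by one without leaving L. -/
theorem ad_eq_zero_of_mem_LDeg {U : Submodule k W} {M : ℕ} (hM : D.LDeg U (M + 1) = ⊥) (v : V)
    {x : Y.NicholsAlgebra} (hx : x ∈ D.LDeg U M) : Y.nicholsQuotient.ad (D.incl v) x = 0 :=
  (Submodule.eq_bot_iff _).1 hM _
    ⟨D.ad_mem_L v hx.1, Y.isGrading_nicholsDegProj.ad_mem (D.incl v) hx.2⟩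

/-- The component of top degree of the subcomodule generated by `L' ⊆ Bᴹ(W)` is `L'`. -/
theorem mem_of_mem_subcomoduleClosure {M : ℕ} (hL : L' ≤ Y.nicholsDeg M) {x : Y.NicholsAlgebra}
    (hx : x ∈ D.subcomoduleClosure L') (hxM : x ∈ Y.nicholsDeg M) : x ∈ L' := by
  have hp := Y.isGrading_nicholsDegProj
  -- Coactions lower the degree up to the term 1 ⊗ x, so this sum is a subcomodule containing the
  -- closure, and its part of degree M is L'.
  have hN : IsSubcomodule D.nicholsLeftCoact (L' ⊔ hp.degLT M) := by
    rw [isSubcomodule_iff_slice]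
    intro y hy f
    obtain ⟨a, ha, b, hb, rfl⟩ := Submodule.mem_sup.1 hy
    rw [map_add, map_add]
    refine add_mem ?_ (Submodule.mem_sup_right (hp.slice_comul_mem_degLT hb _))
    have h1 := hp.slice_comul_sub_mem_degLT (hp.pow_le_degLT (Nat.lt_succ_self M) (hL ha))
      (f ∘ₗ D.nicholsProj.toLinearMap)
    have h2 := add_mem (Submodule.mem_sup_right h1 : _ ∈ L' ⊔ hp.degLT M)
      (Submodule.mem_sup_left (L'.smul_mem ((f ∘ₗ D.nicholsProj.toLinearMap) 1) ha))
    rwa [sub_add_cancel] at h2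
  obtain ⟨a, ha, b, hb, rfl⟩ := Submodule.mem_sup.1
    (D.subcomoduleClosure_le hN le_sup_left hx)
  have h1 : b ∈ Y.nicholsDeg M := by
    have := sub_mem hxM (hL ha)
    rwa [add_sub_cancel_left] at this
  have h2 : b = 0 := (hp.mem_iff.1 h1).symm.trans (hb M le_rfl)
  rw [h2, add_zero]
  exact ha

end DirectSummand

end YetterDrinfeld

end

/-! ### The theorem -/

theorem theorem3p5 {k : Type*} [Field k] {H : Type*} [Ring H] [HopfAlgebra k H]
    (hS : Function.Bijective (HopfAlgebra.antipode k (A := H)))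
    {V : Type*} [AddCommGroup V] [Module k V] {W : Type*} [AddCommGroup W] [Module k W]
    (Z : YetterDrinfeld k H V) (Y : YetterDrinfeld k H W)
    (D : YetterDrinfeld.DirectSummand Z Y)
    (U : Submodule k W) (hU : U ≤ LinearMap.ker D.proj)
    (hirr : IsIrreducibleYDSubmodule Y.act.toLinearMap Y.coact U)
    (M : ℕ) (hM : D.LDeg U M ≠ ⊥) (hMmax : ∀ p > M, D.LDeg U p = ⊥) :
    IsIrreducibleYDSubmodule Y.nicholsAct Y.nicholsCoact (D.LDeg U M) ∧
      IsLeast {N | IsSubcomodule D.nicholsLeftCoact N ∧ D.LDeg U M ≤ N} (D.L U) := by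
  have hYD := D.isYDSubmodule_LDeg hirr.isYDSubmodule M
  -- Every nonzero Yetter-Drinfeld submodule of L^max generates L, since ad_c V maps it into L^{M+1}
  -- = 0.
  have key : ∀ L' ≤ D.LDeg U M, IsYDSubmodule Y.nicholsAct Y.nicholsCoact L' → L' ≠ ⊥ →
      D.subcomoduleClosure L' = D.L U := fun L' hL' hL'YD hL'0 =>
    D.subcomoduleClosure_eq_L hS hU hirr hL'YD hL'0 (hL'.trans inf_le_left)
      fun v x hx => D.ad_eq_zero_of_mem_LDeg (hMmax _ (Nat.lt_succ_self M)) v (hL' hx)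
  refine ⟨⟨hYD, hM, fun N' hN' hN'YD => ?_⟩,
    ⟨D.isSubcomodule_L hU hirr.isYDSubmodule, inf_le_left⟩, fun N hN => ?_⟩
  -- An element of L^max lies in L, which is the closure of N', and has degree M; hence it lies in
  -- N'.
  · refine or_iff_not_imp_left.2 fun h0 => le_antisymm hN' fun x hx => ?_
    refine D.mem_of_mem_subcomoduleClosure (hN'.trans inf_le_right) ?_ hx.2
    rw [key N' hN' hN'YD h0]
    exact hx.1
  · rw [← key _ le_rfl hYD hM]
    exact D.subcomoduleClosure_le hN.1 hN.2
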